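/- Let $n\ge 1$. Write $\mathcal K$ for the set of convex bodies (nonempty compact convex subsets) of $\mathbb R^n$ with the Borel $\sigma$-algebra of the Hausdorff metric, $\mathcal K_0\subset\mathcal K$ for those whose smallest enclosing ball is centered at the origin, $V_n$ for volume, $B^m$ for the unit ball of $\mathbb R^m$, $\kappa_m$ for its volume, and $\omega_m=m\kappa_m$. For $K\in\mathcal K$ let $\Lambda_0(K;\cdot),\dots,\Lambda_{n-1}(K;\cdot)$ be its support measures on $\Sigma=\mathbb R^n\times S^{n-1}$, i.e. the measures determined by the local Steiner formula $$V_n\big(\{x\in (K+\varepsilon B^n)\setminus K:\ (p(K,x),u(K,x))\in\eta\}\big)=\sum_{k=0}^{n-1}\varepsilon^{n-k}\kappa_{n-k}\Lambda_k(K;\eta)\qquad(\varepsilon>0,\ \eta\subset\Sigma\text{ Borel}),$$ where $p(K,x)$ is the point of $K$ nearest to $x$ and $u(K,x)=(x-p(K,x))/\|x-p(K,x)\|$. For an integer $s\ge0$ let $$\Phi_{n-1}^{0,s}(K)=\frac1{s!}\,\frac{\omega_1}{\omega_{1+s}}\int_\Sigma u^s\,\Lambda_{n-1}(K;d(x,u)),$$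 where $u^s$ is the $s$-fold symmetric tensor power of $u$, viewed as the symmetric $s$-linear functional $(v_1,\dots,v_s)\mapsto\prod_i\langle u,v_i\rangle$. The same symbol denotes the additive extension of $\Phi_{n-1}^{0,s}$ to finite unions of convex bodies, with value $0$ at $\emptyset$. Let $\gamma>0$, and let $\mathbb Q$ be a probability measure on $\mathcal K$, concentrated on $\mathcal K_0$, with $\int V_n(K+B^n)\,\mathbb Q(dK)<\infty$. Let $X$ be a Poisson process in $\mathcal K$ with intensity measure $\Theta(\mathcal A)=\gamma\int_{\mathbb R^n}\int_{\mathcal K_0}\mathbf 1\{K+x\in\mathcal A\}\,\mathbb Q(dK)\,dx$, and let $Z=\bigcup_{K\in X}K$ be the corresponding stationary Boolean model with convex grains. Then $V_n$ and $\Phi_{n-1}^{0,s}$ are $\mathbb Q$-integrable for every integer $s\ge0$, so that the densities $$\overline V_n(X)=\gamma\int V_n\,d\mathbb Q,\qquad \overline\Phi_{n-1}^{\,0,s}(X)=\gamma\int\Phi_{n-1}^{0,s}\,d\mathbb Q$$ are well defined. Moreover, for every integer $s\ge 0$ and every $W\in\mathcal K$ with $V_n(W)>0$, and for every $\varrho>0$,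 the set $Z\cap\varrho W$ is almost surely a finite (possibly empty) union of convex bodies and $\Phi_{n-1}^{0,s}(Z\cap\varrho W)$ is integrable; and the density $$\overline\Phi_{n-1}^{\,0,s}(Z):=\lim_{\varrho\to\infty}\frac{\mathbb E\big[\Phi_{n-1}^{0,s}(Z\cap\varrho W)\big]}{V_n(\varrho W)}$$ exists, does not depend on $W$, and satisfies $$\overline\Phi_{n-1}^{\,0,s}(Z)=\overline\Phi_{n-1}^{\,0,s}(X)\,e^{-\overline V_n(X)}.$$ -/

import Mathlib

open MeasureTheory ProbabilityTheory Filter Topology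
open scoped Pointwise ENNReal NNReal

noncomputable section

namespace BooleanModel

/-! ### Convex bodies, their σ-algebra, translations, and the grain space -/

/-- The space of convex bodies carries the Borel σ-algebra of the Hausdorff metric. -/
instance instMeasurableSpaceConvexBody (n : ℕ) :
    MeasurableSpace (ConvexBody (EuclideanSpace ℝ (Fin n))) := borel _

instance instBorelSpaceConvexBody (n : ℕ) :
    BorelSpace (ConvexBody (EuclideanSpace ℝ (Fin n))) := ⟨rfl⟩

variable {n : ℕ}

/-- The translate `K + x` of a convex body. -/
def translate (K : ConvexBody (EuclideanSpace ℝ (Fin n))) (x : EuclideanSpace ℝ (Fin n)) :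
    ConvexBody (EuclideanSpace ℝ (Fin n)) where
  carrier := (fun y => y + x) '' (K : Set (EuclideanSpace ℝ (Fin n)))
  convex' := by
    have h := K.convex.translate x
    simpa only [add_comm] using h
  isCompact' := K.isCompact.image (by fun_prop)
  nonempty' := K.nonempty.image _

/-- The volume functional `V_n`. -/
def vol (K : ConvexBody (EuclideanSpace ℝ (Fin n))) : ℝ :=
  (volume (K : Set (EuclideanSpace ℝ (Fin n)))).toReal

/-- `c` is the center of the smallest ball containing `K`. -/
def IsCircumcenter (K : ConvexBody (EuclideanSpace ℝ (Fin n)))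
    (c : EuclideanSpace ℝ (Fin n)) : Prop :=
  ∃ r : ℝ, (K : Set (EuclideanSpace ℝ (Fin n))) ⊆ Metric.closedBall c r ∧
    ∀ (c' : EuclideanSpace ℝ (Fin n)) (r' : ℝ),
      (K : Set (EuclideanSpace ℝ (Fin n))) ⊆ Metric.closedBall c' r' → r ≤ r'

/-- The grain space `𝒦₀`: the convex bodies whose smallest enclosing ball is centered at `0`. -/
def grainSpace (n : ℕ) : Set (ConvexBody (EuclideanSpace ℝ (Fin n))) :=
  {K | IsCircumcenter K 0}

/-! ### Support measures and translation invariant Minkowski tensors -/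

/-- The metric projection of `x` to `K`: the (unique) point of `K` nearest to `x`. -/
def metricProj (K : ConvexBody (EuclideanSpace ℝ (Fin n))) (x : EuclideanSpace ℝ (Fin n)) :
    EuclideanSpace ℝ (Fin n) :=
  (K.isCompact.exists_infDist_eq_dist K.nonempty x).choose

/-- The local parallel set
`M_ε(K, η) = {x ∈ (K + ε B) \ K : (p(K,x), (x - p(K,x)) / ‖x - p(K,x)‖) ∈ η}`. -/
def localParallelSet (K : ConvexBody (EuclideanSpace ℝ (Fin n))) (ε : ℝ)
    (η : Set (EuclideanSpace ℝ (Fin n) × Metric.sphere (0 : EuclideanSpace ℝ (Fin n)) 1)) :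
    Set (EuclideanSpace ℝ (Fin n)) :=
  {x | x ∈ ((K : Set (EuclideanSpace ℝ (Fin n))) + Metric.closedBall 0 ε) \
      (K : Set (EuclideanSpace ℝ (Fin n))) ∧
    ∃ u : Metric.sphere (0 : EuclideanSpace ℝ (Fin n)) 1,
      (u : EuclideanSpace ℝ (Fin n)) = ‖x - metricProj K x‖⁻¹ • (x - metricProj K x) ∧
      (metricProj K x, u) ∈ η}

/-- The volume `κ_m` of the unit ball in `ℝ^m`. -/
def unitBallVolume (m : ℕ) : ℝ := Real.pi ^ ((m : ℝ) / 2) / Real.Gamma (1 + (m : ℝ) / 2)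

/-- The surface area `ω_m = m κ_m` of the unit sphere in `ℝ^m`. -/
def unitSphereArea (m : ℕ) : ℝ := m * unitBallVolume m

/-- The local Steiner formula, which determines the measures `Λ₀, …, Λ_{n-1}` uniquely. -/
def SatisfiesLocalSteiner (K : ConvexBody (EuclideanSpace ℝ (Fin n)))
    (L : Fin n →
      Measure (EuclideanSpace ℝ (Fin n) × Metric.sphere (0 : EuclideanSpace ℝ (Fin n)) 1)) :
    Prop :=
  ∀ ε : ℝ, 0 < ε → ∀ η, MeasurableSet η →
    volume (localParallelSet K ε η) =
      ∑ k : Fin n, ENNReal.ofReal (ε ^ (n - (k : ℕ)) * unitBallVolume (n - (k : ℕ))) * L k η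

open Classical in
/-- The support measures `Λ₀(K; ·), …, Λ_{n-1}(K; ·)` of a convex body `K`, defined by the local
Steiner formula. -/
def supportMeasure (K : ConvexBody (EuclideanSpace ℝ (Fin n))) :
    Fin n → Measure (EuclideanSpace ℝ (Fin n) × Metric.sphere (0 : EuclideanSpace ℝ (Fin n)) 1) :=
  if h : ∃ L, SatisfiesLocalSteiner K L then h.choose else 0

/-- The `s`-fold symmetric tensor power `u^s`, as the symmetric `s`-linear functional
`(v₁, …, v_s) ↦ ∏ᵢ ⟨u, vᵢ⟩`. -/
def tensorPow (s : ℕ) (u : EuclideanSpace ℝ (Fin n)) :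
    ContinuousMultilinearMap ℝ (fun _ : Fin s => EuclideanSpace ℝ (Fin n)) ℝ :=
  (ContinuousMultilinearMap.mkPiAlgebra ℝ (Fin s) ℝ).compContinuousLinearMap
    (fun _ => innerSL ℝ u)

theorem tensorPow_apply (s : ℕ) (u : EuclideanSpace ℝ (Fin n))
    (v : Fin s → EuclideanSpace ℝ (Fin n)) :
    tensorPow s u v = ∏ i, inner ℝ u (v i) := by
  simp [tensorPow]

/-- The Minkowski tensor
`Φ_j^{0,s}(K) = (1 / s!) (ω_{n-j} / ω_{n-j+s}) ∫ u^s Λ_j(K; d(x,u))` of a convex body. -/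
def minkowskiTensor (j : Fin n) (s : ℕ) (K : ConvexBody (EuclideanSpace ℝ (Fin n))) :
    ContinuousMultilinearMap ℝ (fun _ : Fin s => EuclideanSpace ℝ (Fin n)) ℝ :=
  ((1 / (s.factorial : ℝ)) *
      (unitSphereArea (n - (j : ℕ)) / unitSphereArea (n - (j : ℕ) + s))) •
    ∫ q, tensorPow s (q.2 : EuclideanSpace ℝ (Fin n)) ∂(supportMeasure K j)

/-! ### Additive extension to the convex ring -/

/-- Polyconvex sets: finite unions of convex bodies (the empty set included). -/
def IsPolyconvex (A : Set (EuclideanSpace ℝ (Fin n))) : Prop :=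
  ∃ F : Set (ConvexBody (EuclideanSpace ℝ (Fin n))), F.Finite ∧
    A = ⋃ K ∈ F, (K : Set (EuclideanSpace ℝ (Fin n)))

/-- `ψ` is an additive extension of the functional `φ` to the convex ring. -/
structure IsAdditiveExtension {T : Type*} [AddCommGroup T]
    (φ : ConvexBody (EuclideanSpace ℝ (Fin n)) → T)
    (ψ : Set (EuclideanSpace ℝ (Fin n)) → T) : Prop where
  empty : ψ ∅ = 0
  extends_body : ∀ K : ConvexBody (EuclideanSpace ℝ (Fin n)), ψ K = φ K
  additive : ∀ A B, IsPolyconvex A → IsPolyconvex B → ψ (A ∪ B) + ψ (A ∩ B) = ψ A + ψ B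

open Classical in
/-- The additive extension of `φ` to the convex ring (its values there are determined by `φ`
through inclusion–exclusion). -/
def additiveExtension {T : Type*} [AddCommGroup T]
    (φ : ConvexBody (EuclideanSpace ℝ (Fin n)) → T) (A : Set (EuclideanSpace ℝ (Fin n))) : T :=
  if h : IsPolyconvex A ∧ ∃ ψ, IsAdditiveExtension φ ψ then h.2.choose A else 0

/-! ### The particle process and the Boolean model -/

/-- The intensity measure
`Θ(𝒜) = γ ∫_{ℝⁿ} ∫ 1{K + x ∈ 𝒜} ℚ(dK) dx` of the stationary particle process with intensity `γ`
and grain distribution `ℚ`; see `particleIntensity_apply`. -/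
def particleIntensity (γ : ℝ) (Q : Measure (ConvexBody (EuclideanSpace ℝ (Fin n)))) :
    Measure (ConvexBody (EuclideanSpace ℝ (Fin n))) :=
  ENNReal.ofReal γ • Measure.map
    (fun p : EuclideanSpace ℝ (Fin n) × ConvexBody (EuclideanSpace ℝ (Fin n)) =>
      translate p.2 p.1) (volume.prod Q)

theorem continuous_translate :
    Continuous (fun p : EuclideanSpace ℝ (Fin n) × ConvexBody (EuclideanSpace ℝ (Fin n)) =>
      translate p.2 p.1) := by
  refine continuous_prod_of_continuous_lipschitzWith _ 1 (fun x => ?_) (fun K => ?_)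
  · refine (Isometry.of_dist_eq fun K L => ?_).continuous
    exact Metric.hausdorffDist_image (isometry_add_right x)
  · refine LipschitzWith.of_dist_le_mul fun x y => ?_
    rw [NNReal.coe_one, one_mul]
    refine Metric.hausdorffDist_le_of_mem_dist dist_nonneg ?_ ?_
    · rintro _ ⟨z, hz, rfl⟩
      exact ⟨z + y, ⟨z, hz, rfl⟩, by simp⟩
    · rintro _ ⟨z, hz, rfl⟩
      exact ⟨z + x, ⟨z, hz, rfl⟩, by simp [dist_comm x y]⟩

theorem particleIntensity_apply (γ : ℝ)
    (Q : Measure (ConvexBody (EuclideanSpace ℝ (Fin n)))) [IsProbabilityMeasure Q]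
    {A : Set (ConvexBody (EuclideanSpace ℝ (Fin n)))} (hA : MeasurableSet A) :
    particleIntensity γ Q A =
      ENNReal.ofReal γ * ∫⁻ x : EuclideanSpace ℝ (Fin n), ∫⁻ K,
        A.indicator 1 (translate K x) ∂Q := by
  have hm := (continuous_translate (n := n)).measurable
  rw [particleIntensity, Measure.smul_apply, smul_eq_mul, Measure.map_apply hm hA,
    Measure.prod_apply (hm hA)]
  congr 1
  refine lintegral_congr fun x => ?_
  have hx : MeasurableSet (Prod.mk x ⁻¹' ((fun p : EuclideanSpace ℝ (Fin n) ×
      ConvexBody (EuclideanSpace ℝ (Fin n)) => translate p.2 p.1) ⁻¹' A)) :=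
    measurable_prodMk_left (hm hA)
  rw [← lintegral_indicator_one hx]
  rfl

/-- `X` is a (simple) Poisson point process of convex bodies with intensity measure `Θ`. -/
structure IsPoissonProcess {Ω : Type*} [MeasurableSpace Ω] (P : Measure Ω)
    (X : Ω → Set (ConvexBody (EuclideanSpace ℝ (Fin n))))
    (Θ : Measure (ConvexBody (EuclideanSpace ℝ (Fin n)))) : Prop where
  /-- Only finitely many particles hit a given compact set. -/
  locallyFinite : ∀ ω, ∀ C : Set (EuclideanSpace ℝ (Fin n)), IsCompact C →
    {K ∈ X ω | ((K : Set (EuclideanSpace ℝ (Fin n))) ∩ C).Nonempty}.Finite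
  measurable_count : ∀ A, MeasurableSet A → Measurable fun ω => (X ω ∩ A).encard
  poisson_count : ∀ A, MeasurableSet A → Θ A ≠ ∞ →
    P.map (fun ω => (X ω ∩ A).encard) =
      (poissonMeasure (Θ A).toNNReal).map (fun k : ℕ => (k : ℕ∞))
  infinite_count : ∀ A, MeasurableSet A → Θ A = ∞ → ∀ᵐ ω ∂P, (X ω ∩ A).encard = ⊤
  indep_count : ∀ (m : ℕ) (A : Fin m → Set (ConvexBody (EuclideanSpace ℝ (Fin n)))),
    (∀ i, MeasurableSet (A i)) → Pairwise (fun i k => Disjoint (A i) (A k)) →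
    iIndepFun (fun i ω => (X ω ∩ A i).encard) P

/-- The union set `Z = ⋃_{K ∈ X} K` of a particle process. -/
def unionSet {Ω : Type*} (X : Ω → Set (ConvexBody (EuclideanSpace ℝ (Fin n)))) (ω : Ω) :
    Set (EuclideanSpace ℝ (Fin n)) :=
  ⋃ K ∈ X ω, (K : Set (EuclideanSpace ℝ (Fin n)))

/-! ### Densities -/

/-- The volume density `V̄_n(X) = γ ∫ V_n dℚ` of the particle process. -/
def volDensity (γ : ℝ) (Q : Measure (ConvexBody (EuclideanSpace ℝ (Fin n)))) : ℝ :=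
  γ * ∫ K, vol K ∂Q

/-- The tensor density `Φ̄_j^{0,s}(X) = γ ∫ Φ_j^{0,s} dℚ` of the particle process. -/
def tensorDensity (j : Fin n) (s : ℕ) (γ : ℝ)
    (Q : Measure (ConvexBody (EuclideanSpace ℝ (Fin n)))) :
    ContinuousMultilinearMap ℝ (fun _ : Fin s => EuclideanSpace ℝ (Fin n)) ℝ :=
  γ • ∫ K, minkowskiTensor j s K ∂Q

/-- The density `Φ̄_j^{0,s}(Z)` of the random set `Z` exists and equals `T`: for every window
`W ∈ 𝒦` with `V_n(W) > 0`, the expectations `𝔼 Φ_j^{0,s}(Z ∩ ϱW)` exist and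
`𝔼 Φ_j^{0,s}(Z ∩ ϱW) / V_n(ϱW) → T` as `ϱ → ∞`. -/
def HasTensorDensity {Ω : Type*} [MeasurableSpace Ω] (P : Measure Ω)
    (Z : Ω → Set (EuclideanSpace ℝ (Fin n))) (j : Fin n) (s : ℕ)
    (T : ContinuousMultilinearMap ℝ (fun _ : Fin s => EuclideanSpace ℝ (Fin n)) ℝ) : Prop :=
  ∀ W : ConvexBody (EuclideanSpace ℝ (Fin n)), 0 < vol W →
    (∀ ρ : ℝ, 0 < ρ → (∀ᵐ ω ∂P, IsPolyconvex (Z ω ∩ (ρ • W : ConvexBody _))) ∧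
      Integrable (fun ω => additiveExtension (minkowskiTensor j s)
        (Z ω ∩ (ρ • W : ConvexBody _))) P) ∧
    Tendsto (fun ρ : ℝ => (vol (ρ • W))⁻¹ •
        ∫ ω, additiveExtension (minkowskiTensor j s) (Z ω ∩ (ρ • W : ConvexBody _)) ∂P)
      atTop (𝓝 T)

end BooleanModel

end

/-! Write φ(K) = ∫ f(u) Λ_{n-1}(K; d(x,u)) with f continuous on the sphere; the tensor is the case
where f(u) is a constant multiple of u^s. The theorem follows from an exact formula in every window
W, `IsPoissonProcess.integral_unionSet_inter`: E φ(Z ∩ W) = (1 - e^{-v}) φ(W) + V_n(W) e^{-v} γ∫φ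
dℚ, where v is the volume density. After replacing W by ϱW and dividing by the volume, the first
term is O(1/ϱ), because φ grows at most like ϱ^{n-1}.

The support measures are only known through the local Steiner formula, so its solvability is proved
first. Dilation along normals maps the local parallel set of width 1 onto that of width t. Its
Jacobian is det(A + t(1 - A)), where A, the derivative of the metric projection, is symmetric with
spectrum in [0,1]; this is a polynomial in t with nonnegative coefficients, and the area formula
turns these into the measures. Afterwards Λ_{n-1} is handled only as the first-order term of the
parallel measures as ε → 0. Locality, translation covariance, measurability in K and additivity are
all checked on parallel shells and passed to the limit. Additivity reduces to the Euler
characteristic: every integer relation between indicators of convex bodies survives composition with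
the metric projections (`sum_ite_metricProj_eq_zero`).

The geometric core is the translative formula ∫ φ(K ∩ (M+x)) dx = V_n(M) φ(K) + V_n(K) φ(M). By
locality, the mass of Λ_{n-1}(K ∩ (M+x)) is at least the sum of the contributions of each body
inside the interior of the other. A Steiner-type volume inequality and Fatou's lemma bound the
integrated mass from above by the integral of that sum. Hence nothing is lost for almost every x.

The probabilistic core is that the k-th factorial moment measure of a Poisson process is the k-th
power of its intensity measure (`IsPoissonProcess.bind_tupleMeasure`). Inclusion–exclusion writes
φ(W) - φ(Z ∩ W) as an alternating series over k-tuples of distinct grains. The iterated translative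
formula evaluates the k-th moment as v^k φ(W) + k v^{k-1} V_n(W) γ∫φ dℚ, and summation yields the
exponentials. -/

noncomputable section
namespace BooleanModel

/-- The ambient Euclidean space `ℝⁿ`. -/
abbrev Space (n : ℕ) := EuclideanSpace ℝ (Fin n)

/-- The convex bodies of `ℝⁿ`. -/
abbrev Body (n : ℕ) := ConvexBody (EuclideanSpace ℝ (Fin n))

/-- The unit sphere of `ℝⁿ`. -/
abbrev Sph (n : ℕ) := Metric.sphere (0 : EuclideanSpace ℝ (Fin n)) 1

variable {n : ℕ}

/-! ### The metric projection -/

theorem metricProj_mem (K : Body n) (x : Space n) : metricProj K x ∈ K :=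
  (K.isCompact.exists_infDist_eq_dist K.nonempty x).choose_spec.1

theorem infDist_eq_dist_metricProj (K : Body n) (x : Space n) :
    Metric.infDist x (K : Set (Space n)) = dist x (metricProj K x) :=
  (K.isCompact.exists_infDist_eq_dist K.nonempty x).choose_spec.2

theorem norm_sub_metricProj (K : Body n) (x : Space n) :
    ‖x - metricProj K x‖ = Metric.infDist x (K : Set (Space n)) := by
  rw [infDist_eq_dist_metricProj, dist_eq_norm]

theorem norm_sub_metricProj_le (K : Body n) (x : Space n) {z : Space n} (hz : z ∈ K) :
    ‖x - metricProj K x‖ ≤ ‖x - z‖ := by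
  rw [norm_sub_metricProj, ← dist_eq_norm]
  exact Metric.infDist_le_dist_of_mem hz

theorem inner_sub_metricProj_le (K : Body n) (x : Space n) {z : Space n} (hz : z ∈ K) :
    inner ℝ (x - metricProj K x) (z - metricProj K x) ≤ 0 := by
  refine (norm_eq_iInf_iff_real_inner_le_zero K.convex (metricProj_mem K x)).1 ?_ z hz
  rw [norm_sub_metricProj, Metric.infDist_eq_iInf]
  simp [dist_eq_norm]

/-- Since `metricProj` is defined by a choice, it is always computed through this criterion. Adding
the obtuse-angle inequalities at the two candidate points gives ‖p - y‖² ≤ 0. -/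
theorem metricProj_eq_of_inner_le (K : Body n) {x y : Space n} (hy : y ∈ K)
    (h : ∀ z ∈ K, inner ℝ (x - y) (z - y) ≤ 0) : metricProj K x = y := by
  have h1 := inner_sub_metricProj_le K x hy
  have h2 := h _ (metricProj_mem K x)
  set p := metricProj K x
  have h3 : inner ℝ (p - y) (p - y) ≤ 0 := by
    have : inner ℝ (p - y) (p - y) = inner ℝ (x - p) (y - p) + inner ℝ (x - y) (p - y) := by
      rw [← neg_sub p y, inner_neg_right, ← sub_eq_neg_add, ← inner_sub_left]
      congr 1; abel
    linarith
  exact sub_eq_zero.1 (inner_self_eq_zero.1 (le_antisymm h3 real_inner_self_nonneg))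

theorem metricProj_eq_self (K : Body n) {x : Space n} (hx : x ∈ K) : metricProj K x = x :=
  metricProj_eq_of_inner_le K hx fun z _ => by simp

theorem metricProj_eq_self_iff (K : Body n) {x : Space n} : metricProj K x = x ↔ x ∈ K :=
  ⟨fun h => h ▸ metricProj_mem K x, metricProj_eq_self K⟩

theorem metricProj_add_smul (K : Body n) (x : Space n) {t : ℝ} (ht : 0 ≤ t) :
    metricProj K (metricProj K x + t • (x - metricProj K x)) = metricProj K x := by
  refine metricProj_eq_of_inner_le K (metricProj_mem K x) fun z hz => ?_
  rw [add_sub_cancel_left, inner_smul_left]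
  exact mul_nonpos_of_nonneg_of_nonpos (by simpa using ht) (inner_sub_metricProj_le K x hz)

/-- One estimate with two uses: K = L gives firm nonexpansiveness, and x = y gives Hölder-1/2
continuity of the projection in the body. -/
theorem norm_metricProj_sub_sq_le (K L : Body n) (x y : Space n) :
    ‖metricProj K x - metricProj L y‖ ^ 2 ≤
      inner ℝ (x - y) (metricProj K x - metricProj L y) +
        dist K L * (‖x - metricProj K x‖ + ‖y - metricProj L y‖) := by
  -- The point q of L need not lie in K, but its projection r to K does and is within `dist K L` of
  -- q; the obtuse-angle inequality is applied to r.
  have key : ∀ (K L : Body n) (x y : Space n),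
      inner ℝ (x - metricProj K x) (metricProj L y - metricProj K x) ≤
        dist K L * ‖x - metricProj K x‖ := by
    intro K L x y
    set p := metricProj K x
    set q := metricProj L y
    have h1 := inner_sub_metricProj_le K x (metricProj_mem K q)
    set r := metricProj K q
    have h2 : ‖q - r‖ ≤ dist K L := by
      rw [norm_sub_metricProj, dist_comm]
      exact Metric.infDist_le_hausdorffDist_of_mem (metricProj_mem L y)
        ConvexBody.hausdorffEDist_ne_top
    have h3 : inner ℝ (x - p) (q - p) = inner ℝ (x - p) (r - p) + inner ℝ (x - p) (q - r) := by
      rw [← inner_add_right]; congr 1; abel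
    have h4 := real_inner_le_norm (x - p) (q - r)
    have h5 : ‖x - p‖ * ‖q - r‖ ≤ ‖x - p‖ * dist K L := by gcongr
    linarith
  have h1 := key K L x y
  have h2 := key L K y x
  rw [dist_comm L K] at h2
  set p := metricProj K x
  set q := metricProj L y
  have h3 : ‖p - q‖ ^ 2 = inner ℝ (x - y) (p - q) + inner ℝ (x - p) (q - p)
      + inner ℝ (y - q) (p - q) := by
    rw [← real_inner_self_eq_norm_sq, ← neg_sub p q, inner_neg_right, ← sub_eq_add_neg,
      ← inner_sub_left, ← inner_add_left]
    congr 1; abel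
  linarith

theorem norm_metricProj_sub_sq_le_inner (K : Body n) (x y : Space n) :
    ‖metricProj K x - metricProj K y‖ ^ 2 ≤ inner ℝ (x - y) (metricProj K x - metricProj K y) := by
  simpa using norm_metricProj_sub_sq_le K K x y

theorem lipschitzWith_metricProj (K : Body n) : LipschitzWith 1 (metricProj K) := by
  refine LipschitzWith.of_dist_le_mul fun x y => ?_
  rw [NNReal.coe_one, one_mul, dist_eq_norm, dist_eq_norm]
  have h := norm_metricProj_sub_sq_le_inner K x y
  have h2 := real_inner_le_norm (x - y) (metricProj K x - metricProj K y)
  by_contra! hlt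
  nlinarith [norm_nonneg (x - y)]

theorem continuous_metricProj (K : Body n) : Continuous (metricProj K) :=
  (lipschitzWith_metricProj K).continuous

/-- Joint continuity is the source of all measurability in the body K below. -/
theorem continuous_metricProj_uncurry :
    Continuous fun q : Body n × Space n => metricProj q.1 q.2 := by
  suffices h : Continuous fun q : Space n × Body n => metricProj q.2 q.1 from
    h.comp continuous_swap
  refine continuous_prod_of_continuous_lipschitzWith _ 1 (fun x => ?_)
    (fun K => lipschitzWith_metricProj K)
  rw [continuous_iff_continuousAt]
  intro K
  have hd : Tendsto (fun L : Body n => dist L K) (𝓝 K) (𝓝 0) :=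
    tendsto_iff_dist_tendsto_zero.1 tendsto_id
  have hb : ∀ L : Body n, ‖x - metricProj L x‖ ≤ ‖x - metricProj K x‖ + dist L K := by
    intro L
    rw [norm_sub_metricProj, norm_sub_metricProj, dist_comm]
    exact Metric.infDist_le_infDist_add_hausdorffDist ConvexBody.hausdorffEDist_ne_top
  refine tendsto_iff_norm_sub_tendsto_zero.2 ?_
  have hsq : Tendsto (fun L : Body n => ‖metricProj L x - metricProj K x‖ ^ 2) (𝓝 K) (𝓝 0) := by
    refine squeeze_zero (g := fun L => dist L K *
      ((‖x - metricProj K x‖ + dist L K) + ‖x - metricProj K x‖)) (fun _ => by positivity)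
      (fun L => ?_) ?_
    · have := norm_metricProj_sub_sq_le L K x x
      rw [sub_self, inner_zero_left, zero_add] at this
      refine this.trans ?_
      gcongr
      exact hb L
    · simpa using hd.mul ((hd.const_add ‖x - metricProj K x‖).add_const ‖x - metricProj K x‖)
  have := hsq.sqrt
  simpa using this

instance instSecondCountableTopologyBody : SecondCountableTopology (Body n) := by
  let f : Body n → TopologicalSpace.NonemptyCompacts (Space n) :=
    fun K => ⟨⟨K, K.isCompact⟩, K.nonempty⟩
  have hf : Isometry f := Isometry.of_dist_eq fun K L => rfl
  exact hf.isUniformInducing.isInducing.secondCountableTopology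

theorem measurable_metricProj_uncurry :
    Measurable fun q : Body n × Space n => metricProj q.1 q.2 :=
  continuous_metricProj_uncurry.measurable

/-! ### Differentiating the squared distance -/

/-- The projection of x competes with that of x + h, and conversely. The two minimality inequalities
squeeze the error between multiples of ‖h‖², so the squared distance is differentiable everywhere,
even where the projection is not. -/
theorem hasFDerivAt_infDist_sq (K : Body n) (x : Space n) :
    HasFDerivAt (fun y => 2⁻¹ * ‖y - metricProj K y‖ ^ 2) (innerSL ℝ (x - metricProj K x)) x := by
  rw [hasFDerivAt_iff_isLittleO_nhds_zero]
  have hbound : ∀ h : Space n,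
      ‖2⁻¹ * ‖x + h - metricProj K (x + h)‖ ^ 2 - 2⁻¹ * ‖x - metricProj K x‖ ^ 2
        - innerSL ℝ (x - metricProj K x) h‖ ≤ 2 * ‖h‖ ^ 2 := by
    intro h
    have h1 := norm_sub_metricProj_le K (x + h) (metricProj_mem K x)
    have h2 := norm_sub_metricProj_le K x (metricProj_mem K (x + h))
    have h3 : ‖metricProj K (x + h) - metricProj K x‖ ≤ ‖h‖ := by
      simpa [dist_eq_norm] using (lipschitzWith_metricProj K).dist_le_mul (x + h) x
    set p := metricProj K x
    set q := metricProj K (x + h)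
    have e1 : ‖x + h - p‖ ^ 2 = ‖x - p‖ ^ 2 + 2 * inner ℝ (x - p) h + ‖h‖ ^ 2 := by
      rw [← norm_add_sq_real]; congr 2; abel
    have e2 : ‖x - q‖ ^ 2 = ‖x + h - q‖ ^ 2 - 2 * inner ℝ (x + h - q) h + ‖h‖ ^ 2 := by
      rw [← norm_sub_sq_real]; congr 2; abel
    have e3 : inner ℝ (x + h - q) h = inner ℝ (x - p) h + ‖h‖ ^ 2 - inner ℝ (q - p) h := by
      rw [← real_inner_self_eq_norm_sq, ← inner_add_left, ← inner_sub_left]; congr 1; abel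
    have e4 : |inner ℝ (q - p) h| ≤ ‖h‖ ^ 2 := by
      refine (abs_real_inner_le_norm _ _).trans ?_
      rw [sq]; gcongr
    have s1 : ‖x + h - q‖ ^ 2 ≤ ‖x + h - p‖ ^ 2 := by gcongr
    have s2 : ‖x - p‖ ^ 2 ≤ ‖x - q‖ ^ 2 := by gcongr
    rw [Real.norm_eq_abs, innerSL_apply_apply, abs_le]
    have := abs_le.1 e4
    constructor <;> nlinarith [sq_nonneg ‖h‖]
  refine (Asymptotics.IsBigO.of_bound 2 (Eventually.of_forall fun h => ?_)).trans_isLittleO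
    (g := fun h : Space n => ‖h‖ ^ 2) ?_
  · simpa using hbound h
  · exact Asymptotics.isLittleO_norm_pow_id one_lt_two

/-- The map x ↦ x - p(K,x) is the gradient of half the squared distance, so its derivative is a
second derivative and hence symmetric. -/
theorem inner_fderiv_metricProj_comm (K : Body n) {x : Space n}
    (hx : DifferentiableAt ℝ (metricProj K) x) (v w : Space n) :
    inner ℝ (fderiv ℝ (metricProj K) x v) w = inner ℝ v (fderiv ℝ (metricProj K) x w) := by
  have h1 : HasFDerivAt (fun y => innerSL ℝ (y - metricProj K y))
      ((innerSL ℝ).comp (ContinuousLinearMap.id ℝ (Space n) - fderiv ℝ (metricProj K) x)) x :=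
    (innerSL ℝ).hasFDerivAt.comp x ((hasFDerivAt_id x).sub hx.hasFDerivAt)
  have h2 := second_derivative_symmetric (hasFDerivAt_infDist_sq K) h1 v w
  simp only [ContinuousLinearMap.comp_apply, sub_apply,
    ContinuousLinearMap.id_apply, innerSL_apply_apply, inner_sub_left] at h2
  rw [real_inner_comm w v] at h2
  rw [real_inner_comm _ v]
  linarith

/-- Firm nonexpansiveness in infinitesimal form; together with symmetry it confines the spectrum to
[0,1]. -/
theorem norm_fderiv_metricProj_sq_le (K : Body n) {x : Space n}
    (hx : DifferentiableAt ℝ (metricProj K) x) (v : Space n) :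
    ‖fderiv ℝ (metricProj K) x v‖ ^ 2 ≤ inner ℝ v (fderiv ℝ (metricProj K) x v) := by
  have h1 := hx.hasFDerivAt.lim_real v
  have h2 : Tendsto (fun c : ℝ => ‖c • (metricProj K (x + c⁻¹ • v) - metricProj K x)‖ ^ 2) atTop
      (𝓝 (‖fderiv ℝ (metricProj K) x v‖ ^ 2)) := (h1.norm).pow 2
  have h3 : Tendsto (fun c : ℝ => inner ℝ v (c • (metricProj K (x + c⁻¹ • v) - metricProj K x)))
      atTop (𝓝 (inner ℝ v (fderiv ℝ (metricProj K) x v))) := tendsto_const_nhds.inner h1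
  refine le_of_tendsto_of_tendsto h2 h3 ?_
  filter_upwards [eventually_gt_atTop 0] with c hc
  have h4 := norm_metricProj_sub_sq_le_inner K (x + c⁻¹ • v) x
  rw [add_sub_cancel_left, inner_smul_left] at h4
  rw [norm_smul, mul_pow, inner_smul_right, Real.norm_eq_abs, sq_abs]
  simp only [conj_trivial] at h4
  calc c ^ 2 * _ ≤ c ^ 2 * _ := mul_le_mul_of_nonneg_left h4 (sq_nonneg c)
    _ = _ := by field_simp

/-- The projection is constant along the normal ray through x, so the outer normal lies in the
kernel of its derivative. -/
theorem fderiv_metricProj_sub (K : Body n) {x : Space n}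
    (hx : DifferentiableAt ℝ (metricProj K) x) :
    fderiv ℝ (metricProj K) x (x - metricProj K x) = 0 := by
  have h1 := hx.hasFDerivAt.lim_real (x - metricProj K x)
  refine tendsto_nhds_unique h1 (tendsto_const_nhds.congr' ?_)
  filter_upwards [eventually_gt_atTop 0] with c hc
  have h2 := metricProj_add_smul K x (t := 1 + c⁻¹) (by positivity)
  rw [show metricProj K x + (1 + c⁻¹) • (x - metricProj K x) = x + c⁻¹ • (x - metricProj K x) by
    rw [add_smul, one_smul]; abel] at h2
  rw [h2]; simp


/-! ### The local Steiner formula -/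

theorem unitBallVolume_pos (m : ℕ) : 0 < unitBallVolume m :=
  div_pos (Real.rpow_pos_of_pos Real.pi_pos _) (Real.Gamma_pos_of_pos (by positivity))

/-- The direction of a vector (an arbitrary unit vector for the zero vector). -/
def direction [NeZero n] (v : Space n) : Sph n :=
  ⟨if v = 0 then EuclideanSpace.single 0 1 else ‖v‖⁻¹ • v, by
    split_ifs with h
    · simp
    · simp [norm_smul, h]⟩

theorem coe_direction [NeZero n] {v : Space n} (hv : v ≠ 0) :
    (direction v : Space n) = ‖v‖⁻¹ • v := by simp [direction, hv]

theorem measurable_direction [NeZero n] : Measurable (direction : Space n → Sph n) := by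
  refine Measurable.subtype_mk (Measurable.ite (measurableSet_singleton 0) measurable_const ?_)
  exact measurable_norm.inv.smul measurable_id

theorem direction_smul [NeZero n] {t : ℝ} (ht : 0 < t) (v : Space n) :
    direction (t • v) = direction v := by
  rcases eq_or_ne v 0 with rfl | hv
  · simp
  · ext1
    rw [coe_direction hv, coe_direction (smul_ne_zero ht.ne' hv), norm_smul, smul_smul,
      Real.norm_of_nonneg ht.le]
    congr 1
    field_simp

/-- The pair `(p(K, x), u(K, x))`. -/
def normalPair [NeZero n] (K : Body n) (x : Space n) : Space n × Sph n :=
  (metricProj K x, direction (x - metricProj K x))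

theorem measurable_normalPair_uncurry [NeZero n] :
    Measurable fun q : Body n × Space n => normalPair q.1 q.2 :=
  measurable_metricProj_uncurry.prodMk
    (measurable_direction.comp (measurable_snd.sub measurable_metricProj_uncurry))

theorem measurable_normalPair [NeZero n] (K : Body n) : Measurable (normalPair K) :=
  measurable_normalPair_uncurry.comp measurable_prodMk_left

/-- The outer parallel shell `(K + ε B) \ K`. -/
def shell (K : Body n) (ε : ℝ) : Set (Space n) :=
  ((K : Set (Space n)) + Metric.closedBall 0 ε) \ K

theorem mem_add_closedBall (K : Body n) {ε : ℝ} {x : Space n} :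
    x ∈ (K : Set (Space n)) + Metric.closedBall 0 ε ↔ ‖x - metricProj K x‖ ≤ ε := by
  constructor
  · rintro ⟨y, hy, z, hz, rfl⟩
    refine (norm_sub_metricProj_le K _ hy).trans ?_
    simpa using hz
  · intro h
    exact ⟨metricProj K x, metricProj_mem K x, x - metricProj K x, by simpa using h, by simp⟩

theorem mem_shell (K : Body n) {ε : ℝ} {x : Space n} :
    x ∈ shell K ε ↔ ‖x - metricProj K x‖ ≤ ε ∧ x ∉ K := by
  rw [shell, Set.mem_sdiff, mem_add_closedBall]; rfl

theorem isCompact_add_closedBall (K : Body n) (ε : ℝ) :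
    IsCompact ((K : Set (Space n)) + Metric.closedBall 0 ε) :=
  K.isCompact.add (isCompact_closedBall 0 ε)

theorem measurableSet_shell (K : Body n) (ε : ℝ) : MeasurableSet (shell K ε) :=
  (isCompact_add_closedBall K ε).isClosed.measurableSet.diff K.isClosed.measurableSet

theorem volume_shell_lt_top (K : Body n) (ε : ℝ) : volume (shell K ε) < ∞ :=
  (measure_mono Set.sdiff_subset).trans_lt (isCompact_add_closedBall K ε).measure_lt_top

/-- Outside K the vector x - p(K,x) is nonzero, so the unit vector in the definition is forced and
the value of `direction` at zero plays no role. -/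
theorem localParallelSet_eq [NeZero n] (K : Body n) (ε : ℝ) (η : Set (Space n × Sph n)) :
    localParallelSet K ε η = shell K ε ∩ normalPair K ⁻¹' η := by
  ext x
  refine and_congr_right fun hx => ?_
  have hne : x - metricProj K x ≠ 0 := fun h =>
    hx.2 ((metricProj_eq_self_iff K).1 (sub_eq_zero.1 h).symm)
  constructor
  · rintro ⟨u, hu, hη⟩
    have : direction (x - metricProj K x) = u := by ext1; rw [coe_direction hne, hu]
    simpa [normalPair, this] using hη
  · intro h
    exact ⟨_, coe_direction hne, h⟩

/-- The image of Lebesgue measure on the parallel shell under the normal pair map. -/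
def parallelMeasure [NeZero n] (K : Body n) (ε : ℝ) : Measure (Space n × Sph n) :=
  (volume.restrict (shell K ε)).map (normalPair K)

theorem parallelMeasure_apply [NeZero n] (K : Body n) (ε : ℝ) {η : Set (Space n × Sph n)}
    (hη : MeasurableSet η) : parallelMeasure K ε η = volume (localParallelSet K ε η) := by
  rw [parallelMeasure, Measure.map_apply (measurable_normalPair K) hη,
    Measure.restrict_apply (measurable_normalPair K hη), localParallelSet_eq, Set.inter_comm]

/-- The dilation of the complement of `K` along the normals of `K`. -/
def normalDilation (K : Body n) (t : ℝ) (x : Space n) : Space n :=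
  metricProj K x + t • (x - metricProj K x)

theorem metricProj_normalDilation (K : Body n) {t : ℝ} (ht : 0 ≤ t) (x : Space n) :
    metricProj K (normalDilation K t x) = metricProj K x := metricProj_add_smul K x ht

theorem normalDilation_sub (K : Body n) {t : ℝ} (ht : 0 ≤ t) (x : Space n) :
    normalDilation K t x - metricProj K (normalDilation K t x) = t • (x - metricProj K x) := by
  rw [metricProj_normalDilation K ht, normalDilation, add_sub_cancel_left]

theorem normalDilation_inv (K : Body n) {t : ℝ} (ht : 0 < t) (x : Space n) :
    normalDilation K t⁻¹ (normalDilation K t x) = x := by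
  rw [normalDilation, normalDilation_sub K ht.le, metricProj_normalDilation K ht.le,
    inv_smul_smul₀ ht.ne', add_sub_cancel]

theorem normalDilation_mem_iff (K : Body n) {t : ℝ} (ht : 0 < t) (x : Space n) :
    normalDilation K t x ∈ K ↔ x ∈ K := by
  rw [← metricProj_eq_self_iff, ← metricProj_eq_self_iff, eq_comm, ← sub_eq_zero,
    normalDilation_sub K ht.le, smul_eq_zero_iff_right ht.ne', sub_eq_zero, eq_comm]

theorem normalPair_normalDilation [NeZero n] (K : Body n) {t : ℝ} (ht : 0 < t) (x : Space n) :
    normalPair K (normalDilation K t x) = normalPair K x := by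
  rw [normalPair, normalDilation_sub K ht.le, metricProj_normalDilation K ht.le,
    direction_smul ht, normalPair]

/-- The dilations by t and t⁻¹ are mutually inverse, scale the distance to K, and preserve the pair
(p, u). -/
theorem image_normalDilation [NeZero n] (K : Body n) {t : ℝ} (ht : 0 < t)
    (η : Set (Space n × Sph n)) :
    normalDilation K t '' localParallelSet K 1 η = localParallelSet K t η := by
  have key : ∀ {s r : ℝ}, 0 < s → ∀ {x}, x ∈ localParallelSet K r η →
      normalDilation K s x ∈ localParallelSet K (s * r) η := by
    intro s r hs x hx
    rw [localParallelSet_eq, Set.mem_inter_iff, mem_shell, Set.mem_preimage] at hx ⊢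
    rw [normalDilation_sub K hs.le, normalDilation_mem_iff K hs, normalPair_normalDilation K hs,
      norm_smul, Real.norm_of_nonneg hs.le]
    exact ⟨⟨mul_le_mul_of_nonneg_left hx.1.1 hs.le, hx.1.2⟩, hx.2⟩
  apply Set.Subset.antisymm
  · rintro _ ⟨x, hx, rfl⟩
    simpa using key ht hx
  · intro x hx
    refine ⟨normalDilation K t⁻¹ x, ?_, ?_⟩
    · simpa [ht.ne'] using key (inv_pos.2 ht) hx
    · simpa using normalDilation_inv K (inv_pos.2 ht) x

theorem exists_lipschitzWith_normalDilation (K : Body n) (t : ℝ) :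
    ∃ C, LipschitzWith C (normalDilation K t) := by
  have h : LipschitzWith (‖t‖₊ * (1 + 1)) (fun x => t • (x - metricProj K x)) :=
    (lipschitzWith_smul t).comp (LipschitzWith.id.sub (lipschitzWith_metricProj K))
  exact ⟨_, (lipschitzWith_metricProj K).add h⟩

theorem volume_image_eq_zero_of_lipschitzWith {C : ℝ≥0} {f : Space n → Space n}
    (hf : LipschitzWith C f) {s : Set (Space n)} (hs : volume s = 0) : volume (f '' s) = 0 := by
  have h1 : (Measure.hausdorffMeasure (Module.finrank ℝ (Space n)) : Measure (Space n)) s = 0 :=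
    Measure.absolutelyContinuous_isAddHaarMeasure _ volume hs
  have h2 := hf.hausdorffMeasure_image_le (d := Module.finrank ℝ (Space n)) (by positivity) s
  rw [h1, mul_zero, nonpos_iff_eq_zero] at h2
  exact Measure.absolutelyContinuous_isAddHaarMeasure volume _ h2

/-! ### The Jacobian of the normal dilation -/

theorem coeff_prod_nonneg {ι : Type*} (s : Finset ι) (P : ι → Polynomial ℝ)
    (h : ∀ i ∈ s, ∀ k, 0 ≤ (P i).coeff k) (k : ℕ) : 0 ≤ (∏ i ∈ s, P i).coeff k := by
  classical
  induction s using Finset.induction_on generalizing k with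
  | empty => rw [Finset.prod_empty, Polynomial.coeff_one]; split_ifs <;> norm_num
  | insert a s ha ih =>
    rw [Finset.prod_insert ha, Polynomial.coeff_mul]
    exact Finset.sum_nonneg fun q _ => mul_nonneg (h a (Finset.mem_insert_self a s) _)
      (ih (fun i hi => h i (Finset.mem_insert_of_mem hi)) _)

/-- For a symmetric operator `A` with spectrum in `[0, 1]`, the determinant of `A + t (1 - A)` is a
polynomial in `t` with nonnegative coefficients. -/
theorem exists_polynomial_det_eq (A : Space n →L[ℝ] Space n)
    (hsymm : ∀ v w, inner ℝ (A v) w = inner ℝ v (A w))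
    (hfirm : ∀ v, ‖A v‖ ^ 2 ≤ inner ℝ v (A v)) :
    ∃ P : Polynomial ℝ, P.natDegree ≤ n ∧ (∀ k, 0 ≤ P.coeff k) ∧
      ∀ t : ℝ, (A + t • (1 - A)).det = P.eval t := by
  have hs : (A : Space n →ₗ[ℝ] Space n).IsSymmetric := fun v w => hsymm v w
  have hfin : Module.finrank ℝ (Space n) = n := by simp
  set l := hs.eigenvalues hfin with hl
  set b := hs.eigenvectorBasis hfin with hb
  have hA : ∀ i, A (b i) = l i • b i := fun i => hs.apply_eigenvectorBasis hfin i
  -- Firm nonexpansiveness tested on a unit eigenvector reads l² ≤ l.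
  have hl01 : ∀ i, 0 ≤ l i ∧ l i ≤ 1 := by
    intro i
    have h := hfirm (b i)
    rw [hA, norm_smul, inner_smul_right, real_inner_self_eq_norm_sq, b.norm_eq_one,
      Real.norm_eq_abs] at h
    simp only [mul_one, one_pow, sq_abs] at h
    constructor <;> nlinarith
  refine ⟨∏ i, (Polynomial.C (l i) + Polynomial.C (1 - l i) * Polynomial.X), ?_, ?_, ?_⟩
  · refine (Polynomial.natDegree_prod_le _ _).trans ?_
    refine (Finset.sum_le_card_nsmul _ _ 1 fun i _ => ?_).trans (by simp)
    rw [add_comm]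
    exact Polynomial.natDegree_linear_le
  · refine coeff_prod_nonneg _ _ fun i _ k => ?_
    rw [Polynomial.coeff_add, Polynomial.coeff_C, Polynomial.coeff_C_mul, Polynomial.coeff_X]
    have h0 := (hl01 i).1
    have h1 := sub_nonneg.2 (hl01 i).2
    split_ifs <;> simp [h0, h1]
  · intro t
    rw [ContinuousLinearMap.det, ← LinearMap.det_toMatrix b.toBasis]
    have : LinearMap.toMatrix b.toBasis b.toBasis
        ((A + t • (1 - A) : Space n →L[ℝ] Space n) : Space n →ₗ[ℝ] Space n) =
        Matrix.diagonal fun i => l i + (1 - l i) * t := by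
      ext i j
      rw [LinearMap.toMatrix_apply, Matrix.diagonal_apply]
      have h : (A + t • (1 - A)) (b j) = (l j + (1 - l j) * t) • b j := by
        simp only [add_apply, smul_apply, sub_apply,
          one_apply_eq_self, hA]
        module
      simp only [OrthonormalBasis.coe_toBasis, ContinuousLinearMap.coe_coe, h]
      split_ifs with hij
      · subst hij; simp
      · simp [hij]
    rw [this, Matrix.det_diagonal, Polynomial.eval_prod]
    simp

/-- The derivative of the normal dilation with parameter `t`. -/
def dilationDeriv (K : Body n) (t : ℝ) (x : Space n) : Space n →L[ℝ] Space n :=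
  fderiv ℝ (metricProj K) x + t • (1 - fderiv ℝ (metricProj K) x)

theorem hasFDerivAt_normalDilation (K : Body n) (t : ℝ) {x : Space n}
    (hx : DifferentiableAt ℝ (metricProj K) x) :
    HasFDerivAt (normalDilation K t) (dilationDeriv K t x) x :=
  hx.hasFDerivAt.add (((hasFDerivAt_id x).sub hx.hasFDerivAt).const_smul t)

/-- The coefficient of `t ^ k` in the Jacobian of the normal dilation with parameter `t`. -/
def jacobianCoeff (K : Body n) (k : ℕ) (x : Space n) : ℝ :=
  (Lagrange.interpolate (Finset.range (n + 1)) (fun i : ℕ => (i : ℝ))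
    fun i => (dilationDeriv K i x).det).coeff k

theorem measurable_det_dilationDeriv (K : Body n) (t : ℝ) :
    Measurable fun x => (dilationDeriv K t x).det := by
  have h := measurable_fderiv ℝ (metricProj K)
  exact ContinuousLinearMap.continuous_det.measurable.comp
    (h.add ((measurable_const.sub h).const_smul t))

/-- Lagrange interpolation at the nodes 0, …, n makes each coefficient a fixed linear combination of
n + 1 determinants, so measurability in x needs no measurable choice of eigenvalues. -/
theorem measurable_jacobianCoeff (K : Body n) (k : ℕ) : Measurable (jacobianCoeff K k) := by
  unfold jacobianCoeff
  simp only [Lagrange.interpolate_apply, Polynomial.finsetSum_coeff, Polynomial.coeff_C_mul]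
  exact Finset.measurable_sum _ fun i _ => (measurable_det_dilationDeriv K i).mul_const _

theorem jacobianCoeff_spec (K : Body n) {x : Space n}
    (hx : DifferentiableAt ℝ (metricProj K) x) :
    (∀ k, 0 ≤ jacobianCoeff K k x) ∧
      ∀ t, (dilationDeriv K t x).det = ∑ k ∈ Finset.range (n + 1), jacobianCoeff K k x * t ^ k := by
  obtain ⟨P, hdeg, hnonneg, hP⟩ := exists_polynomial_det_eq (fderiv ℝ (metricProj K) x)
    (inner_fderiv_metricProj_comm K hx) (norm_fderiv_metricProj_sq_le K hx)
  have hint : P = Lagrange.interpolate (Finset.range (n + 1)) (fun i : ℕ => (i : ℝ))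
      fun i => (dilationDeriv K i x).det := by
    refine Lagrange.eq_interpolate_of_eval_eq _ Nat.cast_injective.injOn ?_ fun i _ => (hP i).symm
    rw [Finset.card_range]
    exact (Polynomial.degree_le_of_natDegree_le hdeg).trans_lt
      (by exact_mod_cast Nat.lt_succ_self n)
  have hc : ∀ k, jacobianCoeff K k x = P.coeff k := fun k => by rw [jacobianCoeff, ← hint]
  refine ⟨fun k => hc k ▸ hnonneg k, fun t => ?_⟩
  rw [show (dilationDeriv K t x).det = P.eval t from hP t,
    Polynomial.eval_eq_sum_range' (Nat.lt_succ_of_le hdeg)]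
  simp only [hc]

/-- At t = 0 the Jacobian is the determinant of the derivative of the projection, which kills the
nonzero vector x - p(K,x). This is why the Steiner polynomial of the shell has no constant term. -/
theorem jacobianCoeff_zero (K : Body n) {x : Space n}
    (hx : DifferentiableAt ℝ (metricProj K) x) (hxK : x ∉ K) : jacobianCoeff K 0 x = 0 := by
  have h := (jacobianCoeff_spec K hx).2 0
  rw [Finset.sum_range_succ'] at h
  simp only [ne_eq, Nat.add_eq_zero_iff, one_ne_zero, and_false, not_false_eq_true, zero_pow,
    mul_zero, Finset.sum_const_zero, pow_zero, mul_one, zero_add] at h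
  rw [← h]
  by_contra hdet
  have hinj : LinearMap.ker (dilationDeriv K 0 x : Space n →ₗ[ℝ] Space n) = ⊥ := by
    by_contra hker
    exact hdet (LinearMap.det_eq_zero_iff_ker_ne_bot.2 hker)
  have h0 : x - metricProj K x ∈ LinearMap.ker (dilationDeriv K 0 x : Space n →ₗ[ℝ] Space n) := by
    simp [dilationDeriv, fderiv_metricProj_sub K hx]
  rw [hinj, Submodule.mem_bot, sub_eq_zero] at h0
  exact hxK ((metricProj_eq_self_iff K).1 h0.symm)

theorem ae_differentiableAt_metricProj (K : Body n) :
    ∀ᵐ x, DifferentiableAt ℝ (metricProj K) x :=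
  (lipschitzWith_metricProj K).ae_differentiableAt

theorem measurableSet_localParallelSet [NeZero n] (K : Body n) (ε : ℝ) {η : Set (Space n × Sph n)}
    (hη : MeasurableSet η) : MeasurableSet (localParallelSet K ε η) := by
  rw [localParallelSet_eq]
  exact (measurableSet_shell K ε).inter (measurable_normalPair K hη)

/-- Area formula for the injective normal dilation, applied on the set where the projection is
differentiable. The exceptional set is null by Rademacher's theorem, and so is its image, the
dilation being Lipschitz. -/
theorem volume_localParallelSet_eq_lintegral [NeZero n] (K : Body n) {t : ℝ} (ht : 0 < t)
    {η : Set (Space n × Sph n)} (hη : MeasurableSet η) :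
    volume (localParallelSet K t η) =
      ∫⁻ x in localParallelSet K 1 η, ENNReal.ofReal |(dilationDeriv K t x).det| := by
  set s := localParallelSet K 1 η with hsdef
  have hs : MeasurableSet s := measurableSet_localParallelSet K 1 hη
  set D := {x | DifferentiableAt ℝ (metricProj K) x} with hD
  have hDm : MeasurableSet D := measurableSet_of_differentiableAt ℝ _
  have hDnull : volume (s \ D) = 0 :=
    measure_mono_null (fun x hx => hx.2) (ae_differentiableAt_metricProj K)
  obtain ⟨C, hC⟩ := exists_lipschitzWith_normalDilation K t
  have hinj : Function.Injective (normalDilation K t) :=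
    Function.LeftInverse.injective (normalDilation_inv K ht)
  have h1 := lintegral_abs_det_fderiv_eq_addHaar_image volume (hs.inter hDm)
    (fun x hx => (hasFDerivAt_normalDilation K t hx.2).hasFDerivWithinAt) hinj.injOn
  have h2 : volume (localParallelSet K t η) = volume (normalDilation K t '' (s ∩ D)) := by
    rw [← image_normalDilation K ht, ← hsdef]
    refine le_antisymm ?_ (measure_mono (Set.image_mono Set.inter_subset_left))
    conv_lhs => rw [← Set.inter_union_sdiff s D, Set.image_union]
    refine (measure_union_le _ _).trans ?_
    rw [volume_image_eq_zero_of_lipschitzWith hC hDnull, add_zero]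
  rw [h2, ← h1]
  refine setLIntegral_congr ?_
  filter_upwards [ae_differentiableAt_metricProj K] with x hx
  exact propext ⟨fun h => h.1, fun h => ⟨h, hx⟩⟩

/-- The support measures, as image measures of weighted Lebesgue measures on the parallel shell. -/
def jacobianMeasure [NeZero n] (K : Body n) (k : ℕ) : Measure (Space n × Sph n) :=
  (((volume.restrict (shell K 1)).withDensity fun x => ENNReal.ofReal (jacobianCoeff K k x))).map
    (normalPair K)

theorem jacobianMeasure_apply [NeZero n] (K : Body n) (k : ℕ) {η : Set (Space n × Sph n)}
    (hη : MeasurableSet η) : jacobianMeasure K k η =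
      ∫⁻ x in localParallelSet K 1 η, ENNReal.ofReal (jacobianCoeff K k x) := by
  rw [jacobianMeasure, Measure.map_apply (measurable_normalPair K) hη,
    withDensity_apply _ (measurable_normalPair K hη),
    Measure.restrict_restrict (measurable_normalPair K hη), localParallelSet_eq, Set.inter_comm]

/-- **Local Steiner formula**: every convex body has support measures. -/
theorem exists_satisfiesLocalSteiner [NeZero n] (K : Body n) :
    ∃ L, SatisfiesLocalSteiner K L := by
  refine ⟨fun k => ENNReal.ofReal (unitBallVolume (n - k))⁻¹ • jacobianMeasure K (n - k), ?_⟩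
  intro t ht η hη
  have hs : MeasurableSet (localParallelSet K 1 η) := measurableSet_localParallelSet K 1 hη
  have h1 : volume (localParallelSet K t η) = ∑ k ∈ Finset.range n,
      ENNReal.ofReal (t ^ (k + 1)) * jacobianMeasure K (k + 1) η := by
    rw [volume_localParallelSet_eq_lintegral K ht hη]
    simp only [jacobianMeasure_apply K _ hη]
    have : ∀ k ∈ Finset.range n, ENNReal.ofReal (t ^ (k + 1)) *
        ∫⁻ x in localParallelSet K 1 η, ENNReal.ofReal (jacobianCoeff K (k + 1) x) =
        ∫⁻ x in localParallelSet K 1 η,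
          ENNReal.ofReal (t ^ (k + 1)) * ENNReal.ofReal (jacobianCoeff K (k + 1) x) :=
      fun k _ => (lintegral_const_mul _ (measurable_jacobianCoeff K _).ennreal_ofReal).symm
    rw [Finset.sum_congr rfl this, ← lintegral_finsetSum _ fun k _ =>
      ((measurable_jacobianCoeff K _).ennreal_ofReal).const_mul _]
    refine lintegral_congr_ae ?_
    filter_upwards [ae_restrict_mem hs, ae_restrict_of_ae (ae_differentiableAt_metricProj K)]
      with x hx hd
    obtain ⟨hnn, hdet⟩ := jacobianCoeff_spec K hd
    have hpos : ∀ k, 0 ≤ jacobianCoeff K k x * t ^ k := fun k =>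
      mul_nonneg (hnn k) (pow_nonneg ht.le k)
    rw [hdet, abs_of_nonneg (Finset.sum_nonneg fun k _ => hpos k), Finset.sum_range_succ',
      jacobianCoeff_zero K hd hx.1.2, zero_mul, add_zero,
      ENNReal.ofReal_sum_of_nonneg fun k _ => hpos (k + 1)]
    refine Finset.sum_congr rfl fun k _ => ?_
    rw [mul_comm, ENNReal.ofReal_mul (pow_nonneg ht.le _)]
  -- The coefficient of t^{n-k} belongs to Λ_k, so the sum over powers t^{j+1} with j < n is
  -- reversed by j = n - 1 - k.
  rw [h1, ← Finset.sum_range_reflect, ← Fin.sum_univ_eq_sum_range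
    (fun j => ENNReal.ofReal (t ^ (n - 1 - j + 1)) * jacobianMeasure K (n - 1 - j + 1) η)]
  refine Finset.sum_congr rfl fun k _ => ?_
  have hk : n - 1 - (k : ℕ) + 1 = n - k := by omega
  have hκ := unitBallVolume_pos (n - (k : ℕ))
  rw [hk, Measure.smul_apply, smul_eq_mul, ← mul_assoc, ← ENNReal.ofReal_mul (by positivity),
    mul_assoc, mul_inv_cancel₀ hκ.ne', mul_one]

theorem satisfiesLocalSteiner_supportMeasure [NeZero n] (K : Body n) :
    SatisfiesLocalSteiner K (supportMeasure K) := by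
  rw [supportMeasure, dif_pos (exists_satisfiesLocalSteiner K)]
  exact (exists_satisfiesLocalSteiner K).choose_spec


/-! ### The support measure of order `n - 1` -/

/-- The support measure `Λ_{n-1}(K; ·)`. -/
def areaMeasure [NeZero n] (K : Body n) : Measure (Space n × Sph n) :=
  supportMeasure K ⟨n - 1, Nat.sub_one_lt (NeZero.ne n)⟩

theorem parallelMeasure_eq_sum [NeZero n] (K : Body n) {ε : ℝ} (hε : 0 < ε) :
    parallelMeasure K ε = ∑ k : Fin n,
      ENNReal.ofReal (ε ^ (n - (k : ℕ)) * unitBallVolume (n - (k : ℕ))) • supportMeasure K k := by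
  ext η hη
  rw [parallelMeasure_apply K ε hη, satisfiesLocalSteiner_supportMeasure K ε hε η hη,
    Measure.finsetSum_apply]
  rfl

instance isFiniteMeasure_parallelMeasure [NeZero n] (K : Body n) (ε : ℝ) :
    IsFiniteMeasure (parallelMeasure K ε) := by
  have : IsFiniteMeasure (volume.restrict (shell K ε)) := ⟨by simpa using volume_shell_lt_top K ε⟩
  unfold parallelMeasure
  infer_instance

theorem smul_supportMeasure_le [NeZero n] (K : Body n) {ε : ℝ} (hε : 0 < ε) (k : Fin n) :
    ENNReal.ofReal (ε ^ (n - (k : ℕ)) * unitBallVolume (n - (k : ℕ))) • supportMeasure K k ≤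
      parallelMeasure K ε := by
  rw [parallelMeasure_eq_sum K hε]
  refine Measure.le_iff.2 fun s hs => ?_
  rw [Measure.finsetSum_apply]
  exact Finset.single_le_sum (f := fun k : Fin n => (ENNReal.ofReal
    (ε ^ (n - (k : ℕ)) * unitBallVolume (n - (k : ℕ))) • supportMeasure K k) s)
    (fun _ _ => zero_le) (Finset.mem_univ k)

instance isFiniteMeasure_supportMeasure [NeZero n] (K : Body n) (k : Fin n) :
    IsFiniteMeasure (supportMeasure K k) := by
  refine ⟨lt_top_iff_ne_top.2 fun h => ?_⟩
  have h1 := Measure.le_iff'.1 (smul_supportMeasure_le K one_pos k) Set.univ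
  have hκ := unitBallVolume_pos (n - (k : ℕ))
  rw [Measure.smul_apply, h, smul_eq_mul, ENNReal.mul_top (by simpa using hκ)] at h1
  exact (measure_lt_top (parallelMeasure K 1) Set.univ).not_ge h1

instance isFiniteMeasure_areaMeasure [NeZero n] (K : Body n) : IsFiniteMeasure (areaMeasure K) :=
  isFiniteMeasure_supportMeasure K _

theorem smul_areaMeasure_le [NeZero n] (K : Body n) {ε : ℝ} (hε : 0 < ε) :
    ENNReal.ofReal (ε * unitBallVolume 1) • areaMeasure K ≤ parallelMeasure K ε := by
  have h := smul_supportMeasure_le K hε ⟨n - 1, Nat.sub_one_lt (NeZero.ne n)⟩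
  have h1 : n - (n - 1) = 1 := by have := NeZero.pos n; omega
  simp only [h1, pow_one] at h
  exact h

/-- The free parameter ε matters: ε = 1 gives local bounds, while ε = ϱ gives the growth rate for
the window ϱW. -/
theorem areaMeasure_le [NeZero n] (K : Body n) {ε : ℝ} (hε : 0 < ε) (η : Set (Space n × Sph n)) :
    areaMeasure K η ≤ ENNReal.ofReal (ε * unitBallVolume 1)⁻¹ * parallelMeasure K ε η := by
  have hκ := mul_pos hε (unitBallVolume_pos 1)
  have h := Measure.le_iff'.1 (smul_areaMeasure_le K hε) η
  rw [Measure.smul_apply, smul_eq_mul] at h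
  calc areaMeasure K η = ENNReal.ofReal (ε * unitBallVolume 1)⁻¹ *
        (ENNReal.ofReal (ε * unitBallVolume 1) * areaMeasure K η) := by
        rw [← mul_assoc, ← ENNReal.ofReal_mul (by positivity), inv_mul_cancel₀ hκ.ne',
          ENNReal.ofReal_one, one_mul]
    _ ≤ _ := by gcongr

theorem parallelMeasure_univ [NeZero n] (K : Body n) (ε : ℝ) :
    parallelMeasure K ε Set.univ = volume (shell K ε) := by
  rw [parallelMeasure, Measure.map_apply (measurable_normalPair K) MeasurableSet.univ]
  simp

/-- First order expansion of the parallel measures. -/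
theorem tendsto_integral_parallelMeasure [NeZero n] {T : Type*} [NormedAddCommGroup T]
    [NormedSpace ℝ T] (K : Body n) {f : Space n × Sph n → T}
    (hf : ∀ k, Integrable f (supportMeasure K k)) :
    Tendsto (fun ε : ℝ => (ε * unitBallVolume 1)⁻¹ • ∫ q, f q ∂(parallelMeasure K ε)) (𝓝[>] 0)
      (𝓝 (∫ q, f q ∂(areaMeasure K))) := by
  have hκ := unitBallVolume_pos 1
  let k₀ : Fin n := ⟨n - 1, Nat.sub_one_lt (NeZero.ne n)⟩
  have h1 : ∀ ε ∈ Set.Ioi (0 : ℝ), ∑ k : Fin n, (ε ^ (n - (k : ℕ) - 1) *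
      ((unitBallVolume 1)⁻¹ * unitBallVolume (n - (k : ℕ)))) • ∫ q, f q ∂(supportMeasure K k) =
      (ε * unitBallVolume 1)⁻¹ • ∫ q, f q ∂(parallelMeasure K ε) := by
    intro ε hε
    have hε' : 0 < ε := hε
    rw [parallelMeasure_eq_sum K hε, integral_finsetSum_measure fun k _ =>
      (hf k).smul_measure ENNReal.ofReal_ne_top, Finset.smul_sum]
    refine Finset.sum_congr rfl fun k _ => ?_
    have hk : n - (k : ℕ) = n - (k : ℕ) - 1 + 1 := by omega
    have := unitBallVolume_pos (n - (k : ℕ))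
    rw [integral_smul_measure, smul_smul, ENNReal.toReal_ofReal (by positivity)]
    congr 1
    rw [show ε ^ (n - (k : ℕ)) = ε ^ (n - (k : ℕ) - 1) * ε by rw [← pow_succ, ← hk]]
    field_simp
  have h2 : Tendsto (fun ε : ℝ => ∑ k : Fin n, (ε ^ (n - (k : ℕ) - 1) *
      ((unitBallVolume 1)⁻¹ * unitBallVolume (n - (k : ℕ)))) • ∫ q, f q ∂(supportMeasure K k))
      (𝓝[>] 0) (𝓝 (∑ k : Fin n, ((0 : ℝ) ^ (n - (k : ℕ) - 1) *
      ((unitBallVolume 1)⁻¹ * unitBallVolume (n - (k : ℕ)))) •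
        ∫ q, f q ∂(supportMeasure K k))) := by
    refine (Continuous.tendsto ?_ 0).mono_left nhdsWithin_le_nhds
    fun_prop
  have h3 : (∑ k : Fin n, ((0 : ℝ) ^ (n - (k : ℕ) - 1) *
      ((unitBallVolume 1)⁻¹ * unitBallVolume (n - (k : ℕ)))) •
        ∫ q, f q ∂(supportMeasure K k)) = ∫ q, f q ∂(areaMeasure K) := by
    -- At ε = 0 every summand with n - k - 1 > 0 vanishes; the term k = n - 1 survives because 0 ^ 0
    -- = 1.
    rw [Finset.sum_eq_single k₀]
    · have hk : n - (k₀ : ℕ) = 1 := by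
        change n - (n - 1) = 1
        have := NeZero.pos n; omega
      rw [hk]
      simp [hκ.ne', areaMeasure, k₀]
    · intro k _ hk
      have : n - (k : ℕ) - 1 ≠ 0 := by
        intro h
        exact hk (Fin.ext (show (k : ℕ) = n - 1 by omega))
      simp [this]
    · simp
  rw [← h3]
  exact h2.congr' (eventually_nhdsWithin_of_forall h1)

theorem tendsto_parallelMeasure_real [NeZero n] (K : Body n) {η : Set (Space n × Sph n)}
    (hη : MeasurableSet η) :
    Tendsto (fun ε : ℝ => (ε * unitBallVolume 1)⁻¹ * (parallelMeasure K ε).real η) (𝓝[>] 0)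
      (𝓝 ((areaMeasure K).real η)) := by
  have h := tendsto_integral_parallelMeasure K (f := η.indicator fun _ => (1 : ℝ))
    fun k => (integrable_const 1).indicator hη
  simpa only [integral_indicator_const _ hη, smul_eq_mul, mul_one] using h

/-- The transfer principle from parallel sets to Λ_{n-1}, through the limit ε → 0; locality and
translation covariance are obtained this way. -/
theorem areaMeasure_eq_of_parallelMeasure_eq [NeZero n] {K L : Body n}
    {η ζ : Set (Space n × Sph n)} (hη : MeasurableSet η) (hζ : MeasurableSet ζ)
    (h : ∀ ε > 0, parallelMeasure K ε η = parallelMeasure L ε ζ) :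
    areaMeasure K η = areaMeasure L ζ := by
  have h1 : (areaMeasure K).real η = (areaMeasure L).real ζ := by
    refine tendsto_nhds_unique (tendsto_parallelMeasure_real K hη)
      ((tendsto_parallelMeasure_real L hζ).congr' ?_)
    filter_upwards [self_mem_nhdsWithin] with ε hε
    rw [measureReal_def, measureReal_def, h ε hε]
  exact (ENNReal.toReal_eq_toReal_iff' (measure_ne_top _ _) (measure_ne_top _ _)).1 h1

/-! ### Concentration on the boundary, locality and translation covariance of Λ_{n-1} -/

theorem areaMeasure_eq_zero_of_localParallelSet_eq_empty [NeZero n] (K : Body n)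
    {η : Set (Space n × Sph n)} (hη : MeasurableSet η) (h : localParallelSet K 1 η = ∅) :
    areaMeasure K η = 0 := by
  have h1 := areaMeasure_le K one_pos η
  rw [parallelMeasure_apply K 1 hη, h, measure_empty, mul_zero] at h1
  exact nonpos_iff_eq_zero.1 h1

theorem measurableSet_fst_mem {s : Set (Space n)} (hs : MeasurableSet s) :
    MeasurableSet {q : Space n × Sph n | q.1 ∈ s} := measurable_fst hs

theorem areaMeasure_fst_notMem [NeZero n] (K : Body n) :
    areaMeasure K {q | q.1 ∈ (K : Set (Space n))ᶜ} = 0 := by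
  refine areaMeasure_eq_zero_of_localParallelSet_eq_empty K
    (measurableSet_fst_mem K.isClosed.measurableSet.compl) ?_
  rw [localParallelSet_eq]
  ext x
  simpa [normalPair] using fun _ => metricProj_mem K x

theorem metricProj_notMem_interior (K : Body n) {x : Space n} (hx : x ∉ K) :
    metricProj K x ∉ interior (K : Set (Space n)) := by
  intro h
  have hc : Tendsto (fun t : ℝ => metricProj K x + t • (x - metricProj K x)) (𝓝[>] 0)
      (𝓝 (metricProj K x)) := by
    refine Tendsto.mono_left ?_ nhdsWithin_le_nhds
    have : Continuous fun t : ℝ => metricProj K x + t • (x - metricProj K x) := by fun_prop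
    simpa using this.tendsto 0
  obtain ⟨t, ht, ht0⟩ := ((hc.eventually (mem_interior_iff_mem_nhds.1 h)).and
    self_mem_nhdsWithin).exists
  have ht0 : 0 < t := ht0
  have h1 := inner_sub_metricProj_le K x (show _ ∈ K from ht)
  rw [add_sub_cancel_left, inner_smul_right, real_inner_self_eq_norm_sq] at h1
  have h2 : 0 < ‖x - metricProj K x‖ := by
    rw [norm_pos_iff, sub_ne_zero]
    exact fun h => hx ((metricProj_eq_self_iff K).1 h.symm)
  have : 0 < t * ‖x - metricProj K x‖ ^ 2 := by positivity
  linarith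

theorem areaMeasure_interior [NeZero n] (K : Body n) :
    areaMeasure K {q | q.1 ∈ interior (K : Set (Space n))} = 0 := by
  refine areaMeasure_eq_zero_of_localParallelSet_eq_empty K
    (measurableSet_fst_mem isOpen_interior.measurableSet) ?_
  rw [localParallelSet_eq]
  ext x
  simpa [normalPair] using fun h => metricProj_notMem_interior K ((mem_shell K).1 h).2

/-- Locality of the metric projection. -/
theorem metricProj_inter_iff {K L : Body n} {M : Set (Space n)}
    (hL : (L : Set (Space n)) = (K : Set (Space n)) ∩ M) {x y : Space n} (hy : y ∈ interior M) :
    metricProj L x = y ↔ metricProj K x = y := by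
  have hsub : ∀ z, z ∈ L ↔ z ∈ K ∧ z ∈ M := fun z => by
    rw [← SetLike.mem_coe, hL]; rfl
  constructor
  · rintro rfl
    refine metricProj_eq_of_inner_le K ((hsub _).1 (metricProj_mem L x)).1 fun z hz => ?_
    set p := metricProj L x
    have hc : Tendsto (fun t : ℝ => p + t • (z - p)) (𝓝[>] 0) (𝓝 p) := by
      refine Tendsto.mono_left ?_ nhdsWithin_le_nhds
      have : Continuous fun t : ℝ => p + t • (z - p) := by fun_prop
      simpa using this.tendsto 0
    -- A short step from p towards z stays in K by convexity and in M because p is interior to M;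
    -- the obtuse-angle inequality for L at that point is t times the desired one.
    obtain ⟨t, ⟨ht, ht0⟩, ht1⟩ := (((hc.eventually (mem_interior_iff_mem_nhds.1 hy)).and
      self_mem_nhdsWithin).and (Ioc_mem_nhdsGT one_pos)).exists
    have ht0 : 0 < t := ht0
    have hmem : p + t • (z - p) ∈ L := (hsub _).2
      ⟨K.convex.add_smul_sub_mem ((hsub _).1 (metricProj_mem L x)).1 hz ⟨ht0.le, ht1.2⟩, ht⟩
    have h1 := inner_sub_metricProj_le L x hmem
    rw [add_sub_cancel_left, inner_smul_right] at h1
    exact nonpos_of_mul_nonpos_right h1 ht0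
  · rintro rfl
    exact metricProj_eq_of_inner_le L ((hsub _).2 ⟨metricProj_mem K x, interior_subset hy⟩)
      fun z hz => inner_sub_metricProj_le K x ((hsub z).1 hz).1

theorem mem_shell' (K : Body n) {ε : ℝ} {x : Space n} :
    x ∈ shell K ε ↔ ‖x - metricProj K x‖ ≤ ε ∧ metricProj K x ≠ x := by
  rw [mem_shell, ne_eq, metricProj_eq_self_iff]

/-- Locality of the support measure. -/
theorem areaMeasure_inter [NeZero n] {K L : Body n} {M : Set (Space n)}
    (hL : (L : Set (Space n)) = (K : Set (Space n)) ∩ M) {η : Set (Space n × Sph n)}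
    (hη : MeasurableSet η)
    (hsub : ∀ q ∈ η, q.1 ∈ interior M) : areaMeasure L η = areaMeasure K η := by
  refine areaMeasure_eq_of_parallelMeasure_eq hη hη fun ε _ => ?_
  rw [parallelMeasure_apply _ _ hη, parallelMeasure_apply _ _ hη, localParallelSet_eq,
    localParallelSet_eq]
  congr 1
  ext x
  simp only [Set.mem_inter_iff, mem_shell', Set.mem_preimage, normalPair]
  constructor
  · rintro ⟨h1, h2⟩
    have := (metricProj_inter_iff hL (hsub _ h2)).1 rfl
    rw [this]
    exact ⟨h1, h2⟩
  · rintro ⟨h1, h2⟩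
    have := (metricProj_inter_iff hL (x := x) (hsub _ h2)).2 rfl
    rw [this]
    exact ⟨h1, h2⟩

theorem mem_translate {K : Body n} {a x : Space n} : x ∈ translate K a ↔ x - a ∈ K := by
  constructor
  · rintro ⟨y, hy, rfl⟩
    simpa using hy
  · intro h
    exact ⟨x - a, h, by simp⟩

theorem metricProj_translate (K : Body n) (a x : Space n) :
    metricProj (translate K a) x = metricProj K (x - a) + a := by
  refine metricProj_eq_of_inner_le _ (mem_translate.2 (by simpa using metricProj_mem K (x - a)))
    fun z hz => ?_
  have := inner_sub_metricProj_le K (x - a) (mem_translate.1 hz)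
  convert this using 2 <;> abel

theorem areaMeasure_translate [NeZero n] (K : Body n) (a : Space n) :
    areaMeasure (translate K a) = (areaMeasure K).map (Prod.map (· + a) id) := by
  have hm : Measurable (Prod.map (· + a) id : Space n × Sph n → Space n × Sph n) :=
    (measurable_add_const a).prodMap measurable_id
  ext η hη
  rw [Measure.map_apply hm hη]
  refine areaMeasure_eq_of_parallelMeasure_eq hη (hm hη) fun ε _ => ?_
  rw [parallelMeasure_apply _ _ hη, parallelMeasure_apply _ _ (hm hη), localParallelSet_eq,
    localParallelSet_eq, ← measure_preimage_add_right volume a]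
  congr 1
  ext x
  simp only [Set.mem_inter_iff, mem_shell', Set.mem_preimage, normalPair, metricProj_translate,
    add_sub_cancel_right, add_sub_add_right_eq_sub, ne_eq, add_left_inj, Prod.map, id]

/-- Taking the parallel distance equal to ϱ gives ϱW + ϱB = ϱ(W + B), so the mass is O(ϱ^{n-1}). -/
theorem areaMeasure_smul_univ_le [NeZero n] (W : Body n) {ρ : ℝ} (hρ : 0 < ρ) :
    areaMeasure (ρ • W) Set.univ ≤ ENNReal.ofReal ((ρ * unitBallVolume 1)⁻¹ * ρ ^ n) *
      volume ((W : Set (Space n)) + Metric.closedBall 0 1) := by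
  refine (areaMeasure_le _ hρ _).trans ?_
  have hκ := unitBallVolume_pos 1
  rw [ENNReal.ofReal_mul (by positivity), mul_assoc]
  gcongr
  rw [parallelMeasure_univ, shell, ConvexBody.coe_smul]
  refine (measure_mono Set.sdiff_subset).trans ?_
  have : ρ • (W : Set (Space n)) + Metric.closedBall 0 ρ =
      ρ • ((W : Set (Space n)) + Metric.closedBall 0 1) := by
    rw [smul_add, smul_closedBall _ _ zero_le_one, smul_zero, mul_one, Real.norm_of_nonneg hρ.le]
  rw [this, Measure.addHaar_smul]
  simp [abs_of_pos hρ]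


/-! ### Linear relations between indicator functions of convex sets -/

open Classical in
-- A nonempty compact interval has exactly one greatest element, so nonempty intervals are counted
-- by their right end points. A point t is the right end point of I exactly when t ∈ I while points
-- just to the right of t are not, and there the indicator relation can be used twice.
theorem sum_ite_nonempty_eq_zero_of_real {ι : Type*} (s : Finset ι) (I : ι → Set ℝ) (a : ι → ℤ)
    (hc : ∀ i, IsCompact (I i)) (hconv : ∀ i, Convex ℝ (I i))
    (h : ∀ t, ∑ i ∈ s, (if t ∈ I i then a i else 0) = 0) :
    ∑ i ∈ s, (if (I i).Nonempty then a i else 0) = 0 := by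
  have key : ∀ t, ∑ i ∈ s, (if IsGreatest (I i) t then a i else 0) = 0 := by
    intro t
    have hev : ∀ i, ∀ᶠ r in 𝓝[>] t, (r ∈ I i ↔ t ∈ I i ∧ ¬ IsGreatest (I i) t) := by
      intro i
      by_cases ht : t ∈ I i
      · by_cases hg : IsGreatest (I i) t
        · filter_upwards [self_mem_nhdsWithin] with r hr
          simp only [hg, not_true_eq_false, and_false, iff_false]
          exact fun hrI => (hg.2 hrI).not_gt hr
        · have : ∃ r ∈ I i, t < r := by
            by_contra! hcon
            exact hg ⟨ht, fun r hr => hcon r hr⟩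
          obtain ⟨r, hr, htr⟩ := this
          filter_upwards [Ioo_mem_nhdsGT htr] with q hq
          simp only [ht, hg, not_false_eq_true, and_self, iff_true]
          exact (hconv i).ordConnected.out ht hr ⟨hq.1.le, hq.2.le⟩
      · have : ∀ᶠ r in 𝓝[>] t, r ∉ I i :=
          nhdsWithin_le_nhds ((hc i).isClosed.isOpen_compl.mem_nhds ht)
        filter_upwards [this] with r hr
        simp [ht, hr]
    obtain ⟨r, hr⟩ := ((Finset.eventually_all s).2 fun i _ => hev i).exists
    have h1 : ∑ i ∈ s, (if IsGreatest (I i) t then a i else 0) =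
        ∑ i ∈ s, (if t ∈ I i then a i else 0) - ∑ i ∈ s, (if r ∈ I i then a i else 0) := by
      rw [← Finset.sum_sub_distrib]
      refine Finset.sum_congr rfl fun i hi => ?_
      by_cases hg : IsGreatest (I i) t
      · simp [hr i hi, hg, hg.1]
      · simp [hr i hi, hg]
    rw [h1, h, h, sub_zero]
  have hg : ∀ i t, IsGreatest (I i) t ↔ (I i).Nonempty ∧ sSup (I i) = t := by
    intro i t
    constructor
    · exact fun hg => ⟨⟨t, hg.1⟩, hg.csSup_eq⟩
    · rintro ⟨hne, rfl⟩
      exact (hc i).isGreatest_sSup hne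
  rw [← Finset.sum_fiberwise_of_maps_to (t := s.image fun i => sSup (I i))
    (g := fun i => sSup (I i)) fun i hi => Finset.mem_image_of_mem _ hi]
  refine Finset.sum_eq_zero fun t _ => ?_
  rw [Finset.sum_filter]
  refine Eq.trans (Finset.sum_congr rfl fun i _ => ?_) (key t)
  rw [hg]
  by_cases h1 : sSup (I i) = t <;> by_cases h2 : (I i).Nonempty <;> simp [h1, h2]

open Classical in
/-- The Euler characteristic is well defined on linear combinations of indicator functions of
compact convex sets. -/
theorem sum_ite_nonempty_eq_zero {ι : Type*} (s : Finset ι) (K : ι → Set (Space n)) (a : ι → ℤ)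
    (hc : ∀ i, IsCompact (K i)) (hconv : ∀ i, Convex ℝ (K i))
    (h : ∀ x, ∑ i ∈ s, (if x ∈ K i then a i else 0) = 0) :
    ∑ i ∈ s, (if (K i).Nonempty then a i else 0) = 0 := by
  -- Induction on the number d of free coordinates: all coordinates with index at least d are frozen
  -- at the values of y.
  have key : ∀ (d : ℕ) (y : Fin n → ℝ) (K : ι → Set (Space n)), (∀ i, IsCompact (K i)) →
      (∀ i, Convex ℝ (K i)) → (∀ x, ∑ i ∈ s, (if x ∈ K i then a i else 0) = 0) →
      (∀ i, ∀ z ∈ K i, ∀ j : Fin n, d ≤ j → z j = y j) →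
      ∑ i ∈ s, (if (K i).Nonempty then a i else 0) = 0 := by
    intro d
    induction d with
    | zero =>
      intro y K hc hconv h hy
      refine Eq.trans (Finset.sum_congr rfl fun i _ => ?_) (h (WithLp.toLp 2 y))
      have : (K i).Nonempty ↔ WithLp.toLp 2 y ∈ K i := by
        refine ⟨?_, fun h => ⟨_, h⟩⟩
        rintro ⟨z, hz⟩
        have : z = WithLp.toLp 2 y := by
          ext j; exact hy i z hz j (Nat.zero_le _)
        exact this ▸ hz
      simp only [this]
    | succ d ih =>
      intro y K hc hconv h hy
      by_cases hd : d < n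
      · let j : Fin n := ⟨d, hd⟩
        let g : Space n →L[ℝ] ℝ := EuclideanSpace.proj j
        have hne : ∀ i t, t ∈ g '' K i ↔ (K i ∩ {z | g z = t}).Nonempty := fun i t => Iff.rfl
        -- A set is nonempty iff its image under the last free coordinate is, and t lies in that
        -- image iff the slice at height t is nonempty. The slices have one free coordinate fewer,
        -- so the induction hypothesis supplies the relation between the images.
        have h1 := sum_ite_nonempty_eq_zero_of_real s (fun i => g '' K i) a
          (fun i => (hc i).image g.continuous) (fun i => (hconv i).is_linear_image g.isLinear)
          (fun t => ?_)
        · simpa using h1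
        · simp only [hne]
          refine ih (Function.update y j t) (fun i => K i ∩ {z | g z = t})
            (fun i => (hc i).inter_right (isClosed_eq g.continuous continuous_const))
            (fun i => (hconv i).inter (convex_hyperplane g.isLinear t)) (fun x => ?_) ?_
          · by_cases hx : g x = t
            · simpa [hx] using h x
            · simp [hx]
          · rintro i z ⟨hz, hzt⟩ k hk
            by_cases hkj : k = j
            · subst hkj
              rw [Function.update_self]
              exact hzt
            · rw [Function.update_of_ne hkj]
              have : (k : ℕ) ≠ d := fun e => hkj (Fin.ext e)
              exact hy i z hz k (by omega)
      · refine ih y K hc hconv h fun i z hz k hk => ?_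
        exact absurd k.2 (by omega)
  exact key n 0 K hc hconv h fun i z _ j hj => absurd j.2 (by omega)

open Classical in
/-- Linear relations between indicator functions are respected by the metric projection. -/
theorem sum_ite_metricProj_eq_zero {ι : Type*} (s : Finset ι) (K : ι → Body n) (a : ι → ℤ)
    (h : ∀ z, ∑ i ∈ s, (if z ∈ K i then a i else 0) = 0) (x y : Space n) :
    ∑ i ∈ s, (if metricProj (K i) x = y then a i else 0) = 0 := by
  -- For small δ, bodies that miss y also miss the closed δ-ball around y.
  have h1 : ∀ i, ∀ᶠ δ : ℝ in 𝓝[>] 0, y ∉ K i → ¬ ((K i : Set (Space n)) ∩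
      Metric.closedBall y δ).Nonempty := by
    intro i
    by_cases hy : y ∈ K i
    · simp [hy]
    · obtain ⟨r, hr, hball⟩ := Metric.isOpen_iff.1 (K i).isClosed.isOpen_compl y hy
      filter_upwards [Ioo_mem_nhdsGT hr] with δ hδ _
      rintro ⟨z, hz1, hz2⟩
      exact hball (lt_of_le_of_lt hz2 hδ.2) hz1
  obtain ⟨δ, hδ, hδ0⟩ := (((Finset.eventually_all s).2 fun i _ => h1 i).and
    self_mem_nhdsWithin).exists
  have hδ0 : 0 < δ := hδ0
  -- A body containing y but projecting x elsewhere has points arbitrarily near y with positive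
  -- inner product against x - y; θ is chosen below the values reached inside the δ-ball.
  have h2 : ∀ i, ∀ᶠ θ : ℝ in 𝓝[>] 0, y ∈ K i → metricProj (K i) x ≠ y →
      ((K i : Set (Space n)) ∩ (Metric.closedBall y δ ∩
        {z | θ ≤ inner ℝ (x - y) (z - y)})).Nonempty := by
    intro i
    by_cases hy : y ∈ K i
    · by_cases hp : metricProj (K i) x = y
      · simp [hp]
      · have : ∃ z ∈ K i, 0 < inner ℝ (x - y) (z - y) := by
          by_contra! hcon
          exact hp (metricProj_eq_of_inner_le _ hy hcon)
        obtain ⟨z, hz, hpos⟩ := this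
        have hc : Tendsto (fun t : ℝ => y + t • (z - y)) (𝓝[>] 0) (𝓝 y) := by
          refine Tendsto.mono_left ?_ nhdsWithin_le_nhds
          have : Continuous fun t : ℝ => y + t • (z - y) := by fun_prop
          simpa using this.tendsto 0
        obtain ⟨t, ⟨ht, ht0⟩, ht1⟩ := (((hc.eventually (Metric.closedBall_mem_nhds y hδ0)).and
          self_mem_nhdsWithin).and (Ioc_mem_nhdsGT one_pos)).exists
        have ht0 : 0 < t := ht0
        filter_upwards [Ioo_mem_nhdsGT (mul_pos ht0 hpos)] with θ hθ _ _
        refine ⟨y + t • (z - y), (K i).convex.add_smul_sub_mem hy hz ⟨ht0.le, ht1.2⟩, ht, ?_⟩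
        rw [Set.mem_ofPred_eq, add_sub_cancel_left, inner_smul_right]
        exact hθ.2.le
    · simp [hy]
  obtain ⟨θ, hθ, hθ0⟩ := (((Finset.eventually_all s).2 fun i _ => h2 i).and
    self_mem_nhdsWithin).exists
  have hθ0 : 0 < θ := hθ0
  have key : ∀ C : Set (Space n), IsCompact C → Convex ℝ C →
      ∑ i ∈ s, (if ((K i : Set (Space n)) ∩ C).Nonempty then a i else 0) = 0 := by
    intro C hC hconv
    refine sum_ite_nonempty_eq_zero s (fun i => (K i : Set (Space n)) ∩ C) a
      (fun i => (K i).isCompact.inter hC) (fun i => (K i).convex.inter hconv) fun z => ?_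
    by_cases hz : z ∈ C
    · simpa [hz] using h z
    · simp [hz]
  have hclosed : IsClosed {z : Space n | θ ≤ inner ℝ (x - y) (z - y)} :=
    isClosed_le continuous_const (by fun_prop)
  have hconv : Convex ℝ {z : Space n | θ ≤ inner ℝ (x - y) (z - y)} := by
    have hlin : IsLinearMap ℝ fun z : Space n => inner ℝ (x - y) z :=
      ⟨fun z w => inner_add_right _ _ _, fun c z => real_inner_smul_right _ _ _⟩
    have := convex_halfSpace_ge hlin (θ + inner ℝ (x - y) y)
    simpa only [inner_sub_right _ _ y, le_sub_iff_add_le] using this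
  have e1 := key _ (isCompact_closedBall y δ) (convex_closedBall y δ)
  have e2 := key _ ((isCompact_closedBall y δ).inter_right hclosed)
    ((convex_closedBall y δ).inter hconv)
  -- With these δ and θ, the indicator of p(K,x) = y is the Euler characteristic of K ∩ ball minus
  -- that of K ∩ ball ∩ half-space, and both respect the relation.
  refine Eq.trans ?_ ((congrArg₂ (· - ·) e1 e2).trans (sub_zero 0))
  rw [← Finset.sum_sub_distrib]
  refine Finset.sum_congr rfl fun i hi => ?_
  by_cases hy : y ∈ K i
  · have n1 : ((K i : Set (Space n)) ∩ Metric.closedBall y δ).Nonempty :=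
      ⟨y, hy, Metric.mem_closedBall_self hδ0.le⟩
    by_cases hp : metricProj (K i) x = y
    · have n2 : ¬ ((K i : Set (Space n)) ∩ (Metric.closedBall y δ ∩
        {z | θ ≤ inner ℝ (x - y) (z - y)})).Nonempty := by
        rintro ⟨z, hz, -, hz2⟩
        have := inner_sub_metricProj_le (K i) x hz
        rw [hp] at this
        exact (hθ0.trans_le hz2).not_ge this
      rw [if_pos hp, if_pos n1, if_neg n2, sub_zero]
    · rw [if_neg hp, if_pos n1, if_pos (hθ i hi hy hp), sub_self]
  · have n1 := hδ i hi hy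
    have n2 : ¬ ((K i : Set (Space n)) ∩ (Metric.closedBall y δ ∩
        {z | θ ≤ inner ℝ (x - y) (z - y)})).Nonempty :=
      fun h => n1 (h.mono (Set.inter_subset_inter_right _ Set.inter_subset_left))
    have hp : metricProj (K i) x ≠ y := fun e => hy (e ▸ metricProj_mem (K i) x)
    rw [if_neg hp, if_neg n1, if_neg n2, sub_zero]

open Classical in
theorem sum_smul_metricProj_eq_zero {ι T : Type*} [AddCommGroup T] (s : Finset ι) (K : ι → Body n)
    (a : ι → ℤ) (h : ∀ z, ∑ i ∈ s, (if z ∈ K i then a i else 0) = 0) (x : Space n)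
    (g : Space n → T) : ∑ i ∈ s, a i • g (metricProj (K i) x) = 0 := by
  rw [← Finset.sum_fiberwise_of_maps_to (t := s.image fun i => metricProj (K i) x)
    (g := fun i => metricProj (K i) x) fun i hi => Finset.mem_image_of_mem _ hi]
  refine Finset.sum_eq_zero fun y _ => ?_
  have : ∑ i ∈ s with metricProj (K i) x = y, a i • g (metricProj (K i) x) =
      (∑ i ∈ s with metricProj (K i) x = y, a i) • g y := by
    rw [Finset.sum_smul]
    exact Finset.sum_congr rfl fun i hi => by rw [(Finset.mem_filter.1 hi).2]
  rw [this, Finset.sum_filter, sum_ite_metricProj_eq_zero s K a h, zero_smul]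

/-! ### Additive extensions -/

/-- The convex body with a given carrier (and `{0}` if the set is not a convex body). -/
def bodyOf (A : Set (Space n)) : Body n :=
  open Classical in
  if h : Convex ℝ A ∧ IsCompact A ∧ A.Nonempty then ⟨A, h.1, h.2.1, h.2.2⟩ else 0

theorem coe_bodyOf {A : Set (Space n)} (h1 : Convex ℝ A) (h2 : IsCompact A) (h3 : A.Nonempty) :
    (bodyOf A : Set (Space n)) = A := by
  rw [bodyOf, dif_pos ⟨h1, h2, h3⟩]; rfl

theorem coe_bodyOf_inter {K L : Body n} (h : ((K : Set (Space n)) ∩ L).Nonempty) :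
    (bodyOf ((K : Set (Space n)) ∩ L) : Set (Space n)) = (K : Set (Space n)) ∩ L :=
  coe_bodyOf (K.convex.inter L.convex) (K.isCompact.inter L.isCompact) h

theorem isPolyconvex_body (K : Body n) : IsPolyconvex (K : Set (Space n)) := ⟨{K}, by simp, by simp⟩

theorem isPolyconvex_biUnion {F : Set (Body n)} (hF : F.Finite) :
    IsPolyconvex (⋃ K ∈ F, (K : Set (Space n))) := ⟨F, hF, rfl⟩

theorem IsPolyconvex.inter {A B : Set (Space n)} (hA : IsPolyconvex A) (hB : IsPolyconvex B) :
    IsPolyconvex (A ∩ B) := by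
  obtain ⟨F, hF, rfl⟩ := hA
  obtain ⟨G, hG, rfl⟩ := hB
  refine ⟨(fun q : Body n × Body n => bodyOf ((q.1 : Set (Space n)) ∩ q.2)) ''
    {q ∈ F ×ˢ G | ((q.1 : Set (Space n)) ∩ q.2).Nonempty}, ((hF.prod hG).subset
      (Set.sep_subset _ _)).image _, ?_⟩
  ext x
  simp only [Set.mem_inter_iff, Set.mem_iUnion, exists_prop, Set.mem_image, Set.mem_ofPred_eq,
    Set.mem_prod]
  constructor
  · rintro ⟨⟨K, hK, hxK⟩, L, hL, hxL⟩
    have hne : ((K : Set (Space n)) ∩ L).Nonempty := ⟨x, hxK, hxL⟩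
    exact ⟨_, ⟨(K, L), ⟨⟨hK, hL⟩, hne⟩, rfl⟩, by rw [coe_bodyOf_inter hne]; exact ⟨hxK, hxL⟩⟩
  · rintro ⟨_, ⟨⟨K, L⟩, ⟨⟨hK, hL⟩, hne⟩, rfl⟩, hx⟩
    rw [coe_bodyOf_inter hne] at hx
    exact ⟨⟨K, hK, hx.1⟩, L, hL, hx.2⟩

/-- The indicator function of a convex body. -/
def bodyInd (K : Body n) : Space n → ℤ := (K : Set (Space n)).indicator 1

theorem bodyInd_mul_mem_span (K L : Body n) :
    bodyInd K * bodyInd L ∈ Submodule.span ℤ (Set.range (bodyInd (n := n))) := by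
  have h : bodyInd K * bodyInd L = ((K : Set (Space n)) ∩ L).indicator 1 := by
    rw [bodyInd, bodyInd, Set.inter_indicator_one]
  rw [h]
  by_cases hne : ((K : Set (Space n)) ∩ L).Nonempty
  · rw [← coe_bodyOf_inter hne]
    exact Submodule.subset_span ⟨_, rfl⟩
  · rw [Set.not_nonempty_iff_eq_empty.1 hne, Set.indicator_empty]
    exact Submodule.zero_mem _

theorem mul_mem_span_bodyInd {f g : Space n → ℤ}
    (hf : f ∈ Submodule.span ℤ (Set.range (bodyInd (n := n))))
    (hg : g ∈ Submodule.span ℤ (Set.range (bodyInd (n := n)))) :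
    f * g ∈ Submodule.span ℤ (Set.range (bodyInd (n := n))) := by
  have h := Submodule.mul_mem_mul hf hg
  rw [Submodule.span_mul_span] at h
  refine Submodule.span_le.2 ?_ h
  rintro _ ⟨_, ⟨K, rfl⟩, _, ⟨L, rfl⟩, rfl⟩
  exact bodyInd_mul_mem_span K L

theorem indicator_union_eq (A B : Set (Space n)) :
    (A ∪ B).indicator (1 : Space n → ℤ) =
      A.indicator 1 + B.indicator 1 - A.indicator 1 * B.indicator 1 := by
  classical
  ext x
  by_cases h1 : x ∈ A <;> by_cases h2 : x ∈ B <;> simp [h1, h2]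

theorem IsPolyconvex.indicator_mem_span {A : Set (Space n)} (hA : IsPolyconvex A) :
    A.indicator 1 ∈ Submodule.span ℤ (Set.range (bodyInd (n := n))) := by
  obtain ⟨F, hF, rfl⟩ := hA
  induction F, hF using Set.Finite.induction_on with
  | empty =>
    rw [Set.biUnion_empty, Set.indicator_empty]
    exact Submodule.zero_mem _
  | @insert K F _ _ ih =>
    rw [Set.biUnion_insert, indicator_union_eq]
    have hK : (K : Set (Space n)).indicator 1 ∈ Submodule.span ℤ (Set.range (bodyInd (n := n))) :=
      Submodule.subset_span ⟨K, rfl⟩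
    exact Submodule.sub_mem _ (Submodule.add_mem _ hK ih) (mul_mem_span_bodyInd hK ih)

/-- A functional on convex bodies which respects all linear relations between indicator functions
has an additive extension to the convex ring. -/
theorem exists_isAdditiveExtension {T : Type*} [AddCommGroup T] (φ : Body n → T)
    (h : ∀ c : Body n →₀ ℤ, Finsupp.linearCombination ℤ (bodyInd (n := n)) c = 0 →
      Finsupp.linearCombination ℤ φ c = 0) : ∃ ψ, IsAdditiveExtension φ ψ := by
  classical
  -- The value is read off from an arbitrary representation of the indicator of A; hypothesis `h`
  -- makes it independent of that representation.
  let ψ : Set (Space n) → T := fun A =>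
    if hA : ∃ c, Finsupp.linearCombination ℤ (bodyInd (n := n)) c = A.indicator 1 then
      Finsupp.linearCombination ℤ φ hA.choose else 0
  have hψ : ∀ (A : Set (Space n)) (c : Body n →₀ ℤ),
      Finsupp.linearCombination ℤ (bodyInd (n := n)) c = A.indicator 1 →
      ψ A = Finsupp.linearCombination ℤ φ c := by
    intro A c hc
    have hA : ∃ c, Finsupp.linearCombination ℤ (bodyInd (n := n)) c = A.indicator 1 := ⟨c, hc⟩
    have e : ψ A = Finsupp.linearCombination ℤ φ hA.choose := dif_pos hA
    rw [e, ← sub_eq_zero, ← map_sub]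
    exact h _ (by rw [map_sub, hA.choose_spec, hc, sub_self])
  have hex : ∀ {A : Set (Space n)}, IsPolyconvex A →
      ∃ c, Finsupp.linearCombination ℤ (bodyInd (n := n)) c = A.indicator 1 := by
    intro A hA
    have := hA.indicator_mem_span
    rw [← Finsupp.range_linearCombination] at this
    exact this
  refine ⟨ψ, ⟨?_, fun K => ?_, fun A B hA hB => ?_⟩⟩
  · rw [hψ ∅ 0 (by rw [map_zero, Set.indicator_empty]; rfl), map_zero]
  · rw [hψ K (Finsupp.single K 1) (by simp [bodyInd])]
    simp
  · obtain ⟨a, ha⟩ := hex hA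
    obtain ⟨b, hb⟩ := hex hB
    obtain ⟨c, hc⟩ := hex (hA.inter hB)
    have hu : Finsupp.linearCombination ℤ (bodyInd (n := n)) (a + b - c) =
        (A ∪ B).indicator 1 := by
      rw [map_sub, map_add, ha, hb, hc, indicator_union_eq, Set.inter_indicator_one]
    rw [hψ _ _ hu, hψ _ _ ha, hψ _ _ hb, hψ _ _ hc, map_sub, map_add, sub_add_cancel]

/-- Inclusion–exclusion. -/
theorem IsAdditiveExtension.sum_powerset {T : Type*} [AddCommGroup T] {φ : Body n → T}
    {ψ : Set (Space n) → T} (h : IsAdditiveExtension φ ψ) (F : Finset (Body n))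
    (C : Set (Space n)) (hC : IsPolyconvex C) :
    ∑ S ∈ F.powerset, (-1 : ℤ) ^ S.card • ψ (C ∩ ⋂ K ∈ S, (K : Set (Space n))) =
      ψ C - ψ (C ∩ ⋃ K ∈ F, (K : Set (Space n))) := by
  classical
  -- The set C has to vary: subsets containing the new body K are handled by the induction
  -- hypothesis for C ∩ K.
  induction F using Finset.induction_on generalizing C with
  | empty => simp [h.empty]
  | insert K F hK ih =>
    have hCK : IsPolyconvex (C ∩ K) := hC.inter (isPolyconvex_body K)
    have hF : IsPolyconvex (⋃ K ∈ F, (K : Set (Space n))) :=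
      isPolyconvex_biUnion (F := (F : Set (Body n))) F.finite_toSet
    rw [Finset.sum_powerset_insert hK, ih C hC]
    have h1 : ∑ S ∈ F.powerset, (-1 : ℤ) ^ (insert K S).card •
        ψ (C ∩ ⋂ L ∈ insert K S, (L : Set (Space n))) =
        -(ψ (C ∩ K) - ψ (C ∩ K ∩ ⋃ K ∈ F, (K : Set (Space n)))) := by
      rw [← ih (C ∩ K) hCK, ← Finset.sum_neg_distrib]
      refine Finset.sum_congr rfl fun S hS => ?_
      have hKS : K ∉ S := fun hh => hK (Finset.mem_powerset.1 hS hh)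
      rw [Finset.card_insert_of_notMem hKS, Finset.set_biInter_insert, Set.inter_assoc, pow_succ,
        mul_neg_one, neg_smul]
    have h2 := h.additive (C ∩ K) (C ∩ ⋃ K ∈ F, (K : Set (Space n))) hCK (hC.inter hF)
    have h3 : C ∩ K ∩ (C ∩ ⋃ K ∈ F, (K : Set (Space n))) =
        C ∩ K ∩ ⋃ K ∈ F, (K : Set (Space n)) := by
      ext x; simp only [Set.mem_inter_iff]; tauto
    rw [← Set.inter_union_distrib_left, h3, ← Finset.set_biUnion_insert] at h2
    rw [h1, eq_sub_of_add_eq h2]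
    abel


/-! ### Integrals over the normal directions -/

theorem exists_forall_norm_le {T : Type*} [NormedAddCommGroup T] {f : Sph n → T}
    (hf : Continuous f) :
    ∃ C, 0 ≤ C ∧ ∀ u, ‖f u‖ ≤ C := by
  obtain ⟨C, hC⟩ := isCompact_univ.exists_bound_of_continuousOn hf.continuousOn
  exact ⟨max C 0, le_max_right _ _, fun u => (hC u (Set.mem_univ u)).trans (le_max_left _ _)⟩

theorem stronglyMeasurable_comp_snd {T : Type*} [NormedAddCommGroup T] {f : Sph n → T}
    (hf : Continuous f) :
    StronglyMeasurable fun q : Space n × Sph n => f q.2 :=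
  hf.stronglyMeasurable.comp_measurable measurable_snd

theorem measurableSet_shell_uncurry (ε : ℝ) :
    MeasurableSet {q : Body n × Space n | q.2 ∈ shell q.1 ε} := by
  have h := continuous_metricProj_uncurry (n := n)
  have : {q : Body n × Space n | q.2 ∈ shell q.1 ε} =
      {q | ‖q.2 - metricProj q.1 q.2‖ ≤ ε} \ {q | metricProj q.1 q.2 = q.2} := by
    ext q; exact mem_shell' q.1
  rw [this]
  exact (isClosed_le (continuous_snd.sub h).norm continuous_const).measurableSet.diff
    (isClosed_eq h continuous_snd).measurableSet

/-- For fixed x and ε the integrand depends on K only through p(K,x), the form required by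
`sum_smul_metricProj_eq_zero`. -/
theorem indicator_shell_eq [NeZero n] {T : Type*} [NormedAddCommGroup T] (f : Sph n → T)
    (ε : ℝ) (K : Body n) (x : Space n) :
    (shell K ε).indicator (fun x => f (direction (x - metricProj K x))) x =
      open Classical in (fun y : Space n => if ‖x - y‖ ≤ ε ∧ y ≠ x then f (direction (x - y)) else 0)
        (metricProj K x) := by
  classical
  simp only [Set.indicator_apply, mem_shell']

theorem tendsto_one_div_nhdsGT : Tendsto (fun m : ℕ => 1 / ((m : ℝ) + 1)) atTop (𝓝[>] 0) :=
  tendsto_nhdsWithin_iff.2 ⟨tendsto_one_div_add_atTop_nhds_zero_nat,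
    Eventually.of_forall fun m => by simp only [Set.mem_Ioi]; positivity⟩

theorem integrable_comp_snd {T : Type*} [NormedAddCommGroup T] {f : Sph n → T}
    (hf : Continuous f) (μ : Measure (Space n × Sph n))
    [IsFiniteMeasure μ] : Integrable (fun q => f q.2) μ := by
  obtain ⟨C, -, hC⟩ := exists_forall_norm_le hf
  exact Integrable.of_bound (stronglyMeasurable_comp_snd hf).aestronglyMeasurable C
    (Eventually.of_forall fun q => hC q.2)

theorem integrableOn_shell [NeZero n] {T : Type*} [NormedAddCommGroup T] {f : Sph n → T}
    (hf : Continuous f) (ε : ℝ) (K : Body n) :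
    IntegrableOn (fun x => f (direction (x - metricProj K x))) (shell K ε) := by
  obtain ⟨C, -, hC⟩ := exists_forall_norm_le hf
  have : IsFiniteMeasure (volume.restrict (shell K ε)) := ⟨by simpa using volume_shell_lt_top K ε⟩
  refine Integrable.of_bound ?_ C (Eventually.of_forall fun x => hC _)
  exact (hf.stronglyMeasurable.comp_measurable (measurable_direction.comp
    (measurable_id.sub (continuous_metricProj K).measurable))).aestronglyMeasurable

section SurfaceIntegral

variable [NeZero n] {T : Type*} [NormedAddCommGroup T] [NormedSpace ℝ T]

/-- The integral `∫ f(u) Λ_{n-1}(K; d(x, u))`. -/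
def surfaceIntegral (f : Sph n → T) (K : Body n) : T := ∫ q, f q.2 ∂(areaMeasure K)

/-- The integral of `f(u(K, x))` over the parallel shell of `K`. -/
def shellIntegral (f : Sph n → T) (ε : ℝ) (K : Body n) : T :=
  ∫ x in shell K ε, f (direction (x - metricProj K x))

theorem shellIntegral_eq {f : Sph n → T} (hf : Continuous f) (ε : ℝ) (K : Body n) :
    shellIntegral f ε K = ∫ q, f q.2 ∂(parallelMeasure K ε) := by
  rw [parallelMeasure, integral_map (measurable_normalPair K).aemeasurable
    (stronglyMeasurable_comp_snd hf).aestronglyMeasurable]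
  rfl

theorem tendsto_shellIntegral {f : Sph n → T} (hf : Continuous f) (K : Body n) :
    Tendsto (fun ε : ℝ => (ε * unitBallVolume 1)⁻¹ • shellIntegral f ε K) (𝓝[>] 0)
      (𝓝 (surfaceIntegral f K)) := by
  simp only [shellIntegral_eq hf]
  exact tendsto_integral_parallelMeasure K fun k => integrable_comp_snd hf _

theorem stronglyMeasurable_shellIntegral {f : Sph n → T} (hf : Continuous f) (ε : ℝ) :
    StronglyMeasurable (shellIntegral f ε) := by
  have h1 : StronglyMeasurable ({q : Body n × Space n | q.2 ∈ shell q.1 ε}.indicator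
      fun q => f (direction (q.2 - metricProj q.1 q.2))) :=
    (hf.stronglyMeasurable.comp_measurable (measurable_direction.comp
      (measurable_snd.sub measurable_metricProj_uncurry))).indicator (measurableSet_shell_uncurry ε)
  have h2 := h1.integral_prod_right' (ν := (volume : Measure (Space n)))
  convert h2 using 1
  ext K
  rw [shellIntegral, ← integral_indicator (measurableSet_shell K ε)]
  rfl

/-- The support measures come from a choice made separately for each K, so measurability in K is
obtained from the pointwise limit of shell integrals. -/
theorem stronglyMeasurable_surfaceIntegral {f : Sph n → T} (hf : Continuous f) :
    StronglyMeasurable (surfaceIntegral f) := by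
  refine stronglyMeasurable_of_tendsto atTop
    (fun m : ℕ => (stronglyMeasurable_shellIntegral hf (1 / ((m : ℝ) + 1))).const_smul
      (1 / ((m : ℝ) + 1) * unitBallVolume 1)⁻¹) ?_
  exact tendsto_pi_nhds.2 fun K => (tendsto_shellIntegral hf K).comp tendsto_one_div_nhdsGT

theorem areaMeasure_univ_le (K : Body n) :
    areaMeasure K Set.univ ≤ ENNReal.ofReal (unitBallVolume 1)⁻¹ *
      volume ((K : Set (Space n)) + Metric.closedBall 0 1) := by
  refine (areaMeasure_le K one_pos _).trans ?_
  rw [one_mul, parallelMeasure_univ]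
  gcongr
  exact Set.sdiff_subset

theorem norm_surfaceIntegral_le {f : Sph n → T} {C : ℝ} (hC : ∀ u, ‖f u‖ ≤ C) (K : Body n) :
    ‖surfaceIntegral f K‖ ≤ C * (areaMeasure K).real Set.univ :=
  norm_integral_le_of_norm_le_const (Eventually.of_forall fun q => hC q.2)

/-- The relation holds pointwise for the integrands on the shells, hence for the shell integrals,
hence for their rescaled limit. -/
theorem linearCombination_surfaceIntegral {f : Sph n → T} (hf : Continuous f)
    (c : Body n →₀ ℤ) (hc : Finsupp.linearCombination ℤ (bodyInd (n := n)) c = 0) :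
    Finsupp.linearCombination ℤ (surfaceIntegral f) c = 0 := by
  classical
  have hrel : ∀ z : Space n, ∑ K ∈ c.support, (if z ∈ K then c K else 0) = 0 := by
    intro z
    have := congrFun hc z
    rw [Finsupp.linearCombination_apply, Finsupp.sum, Finset.sum_apply] at this
    refine Eq.trans (Finset.sum_congr rfl fun K _ => ?_) this
    simp [bodyInd, Set.indicator_apply]
  have hshell : ∀ ε, ∑ K ∈ c.support, (c K : ℝ) • shellIntegral f ε K = 0 := by
    intro ε
    have h1 : ∀ K, (c K : ℝ) • shellIntegral f ε K = ∫ x, (c K : ℝ) •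
        (shell K ε).indicator (fun x => f (direction (x - metricProj K x))) x := by
      intro K
      rw [integral_smul, integral_indicator (measurableSet_shell K ε)]
      rfl
    simp only [h1]
    have hint : ∀ K ∈ c.support, Integrable fun x => (c K : ℝ) •
        (shell K ε).indicator (fun x => f (direction (x - metricProj K x))) x := fun K _ =>
      ((integrable_indicator_iff (measurableSet_shell K ε)).2 (integrableOn_shell hf ε K)).smul _
    rw [← integral_finsetSum _ hint]
    refine integral_eq_zero_of_ae (Eventually.of_forall fun x => ?_)
    simp only [indicator_shell_eq, Int.cast_smul_eq_zsmul]
    exact sum_smul_metricProj_eq_zero (T := T) c.support id c hrel x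
      fun y => if ‖x - y‖ ≤ ε ∧ y ≠ x then f (direction (x - y)) else 0
  have hlim : Tendsto (fun ε : ℝ => ∑ K ∈ c.support,
      (c K : ℝ) • ((ε * unitBallVolume 1)⁻¹ • shellIntegral f ε K)) (𝓝[>] 0)
      (𝓝 (∑ K ∈ c.support, (c K : ℝ) • surfaceIntegral f K)) :=
    tendsto_finsetSum _ fun K _ => (tendsto_shellIntegral hf K).const_smul _
  have hzero : ∀ ε : ℝ, ∑ K ∈ c.support,
      (c K : ℝ) • ((ε * unitBallVolume 1)⁻¹ • shellIntegral f ε K) = 0 := by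
    intro ε
    simp only [smul_comm (_ : ℝ) (ε * unitBallVolume 1)⁻¹]
    rw [← Finset.smul_sum, hshell, smul_zero]
  simp only [hzero] at hlim
  rw [Finsupp.linearCombination_apply, Finsupp.sum]
  simpa only [Int.cast_smul_eq_zsmul] using tendsto_nhds_unique hlim tendsto_const_nhds

theorem exists_isAdditiveExtension_surfaceIntegral {f : Sph n → T} (hf : Continuous f) :
    ∃ ψ, IsAdditiveExtension (surfaceIntegral f) ψ :=
  exists_isAdditiveExtension _ (linearCombination_surfaceIntegral hf)

end SurfaceIntegral

/-! ### Measurability of intersections -/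

theorem continuous_infDist_body : Continuous fun q : Body n × Space n =>
    Metric.infDist q.2 (q.1 : Set (Space n)) := by
  simp only [← norm_sub_metricProj]
  exact (continuous_snd.sub continuous_metricProj_uncurry).norm

/-- The Hausdorff distance is the supremum of the difference of the distance functions, and by
continuity a dense sequence of points suffices. -/
theorem dist_body_le_iff {K L : Body n} {r : ℝ} (hr : 0 ≤ r) :
    dist K L ≤ r ↔ ∀ m, |Metric.infDist (TopologicalSpace.denseSeq (Space n) m) (K : Set (Space n)) -
      Metric.infDist (TopologicalSpace.denseSeq (Space n) m) (L : Set (Space n))| ≤ r := by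
  constructor
  · intro h m
    refine le_trans ?_ h
    rw [abs_le]
    have h1 := Metric.infDist_le_infDist_add_hausdorffDist
      (x := TopologicalSpace.denseSeq (Space n) m) (ConvexBody.hausdorffEDist_ne_top (K := K) (L := L))
    have h2 := Metric.infDist_le_infDist_add_hausdorffDist
      (x := TopologicalSpace.denseSeq (Space n) m) (ConvexBody.hausdorffEDist_ne_top (K := L) (L := K))
    rw [ConvexBody.hausdorffDist_coe] at h1 h2
    rw [dist_comm] at h2
    constructor <;> linarith
  · intro h
    have hall : ∀ z : Space n, |Metric.infDist z (K : Set (Space n)) -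
        Metric.infDist z (L : Set (Space n))| ≤ r := by
      have hcl : IsClosed {z : Space n | |Metric.infDist z (K : Set (Space n)) -
          Metric.infDist z (L : Set (Space n))| ≤ r} :=
        isClosed_le ((Metric.continuous_infDist_pt _).sub (Metric.continuous_infDist_pt _)).abs
          continuous_const
      intro z
      have : Set.range (TopologicalSpace.denseSeq (Space n)) ⊆ {z : Space n |
          |Metric.infDist z (K : Set (Space n)) - Metric.infDist z (L : Set (Space n))| ≤ r} := by
        rintro _ ⟨m, rfl⟩; exact h m
      have h2 := hcl.closure_subset_iff.2 this
      rw [(TopologicalSpace.denseRange_denseSeq (Space n)).closure_range] at h2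
      exact h2 (Set.mem_univ z)
    rw [← ConvexBody.hausdorffDist_coe]
    refine Metric.hausdorffDist_le_of_infDist hr (fun z hz => ?_) fun z hz => ?_
    · have := hall z
      rw [Metric.infDist_zero_of_mem hz, zero_sub, abs_neg] at this
      exact (le_abs_self _).trans this
    · have := hall z
      rw [Metric.infDist_zero_of_mem hz, sub_zero] at this
      exact (le_abs_self _).trans this

/-- Preimages of balls are countable intersections of events on distance functions, and every open
set is a countable union of balls. -/
theorem measurable_of_infDist {Y : Type*} [MeasurableSpace Y] {g : Y → Body n}
    (h : ∀ z, Measurable fun y => Metric.infDist z (g y : Set (Space n))) : Measurable g := by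
  have hdist : ∀ L, Measurable fun y => dist (g y) L := by
    intro L
    refine measurable_of_Iic fun r => ?_
    by_cases hr : 0 ≤ r
    · have : (fun y => dist (g y) L) ⁻¹' Set.Iic r = ⋂ m,
          {y | |Metric.infDist (TopologicalSpace.denseSeq (Space n) m) (g y : Set (Space n)) -
      Metric.infDist (TopologicalSpace.denseSeq (Space n) m) (L : Set (Space n))| ≤ r} := by
        ext y
        rw [Set.mem_iInter]
        exact dist_body_le_iff hr
      rw [this]
      exact MeasurableSet.iInter fun m =>
        measurableSet_le ((h _).sub measurable_const).abs measurable_const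
    · convert MeasurableSet.empty
      ext y
      simp only [Set.mem_preimage, Set.mem_Iic, Set.mem_empty_iff_false, iff_false]
      exact fun hy => hr (dist_nonneg.trans hy)
  refine measurable_of_isOpen fun U hU => ?_
  choose r hr hrU using fun K : U => Metric.isOpen_iff.1 hU K K.2
  obtain ⟨S, hS, hSU⟩ := TopologicalSpace.isOpen_iUnion_countable
    (fun K : U => Metric.ball (K : Body n) (r K)) fun K => Metric.isOpen_ball
  have : U = ⋃ K ∈ S, Metric.ball (K : Body n) (r K) := by
    rw [hSU]
    refine Set.Subset.antisymm (fun K hK => ?_) (Set.iUnion_subset hrU)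
    exact Set.mem_iUnion.2 ⟨⟨K, hK⟩, Metric.mem_ball_self (hr _)⟩
  rw [this, Set.preimage_iUnion₂]
  exact MeasurableSet.biUnion hS fun K _ => measurableSet_lt (hdist K) measurable_const

/-- The set of pairs hitting inside B is the projection, along the compact factor B, of a closed set
of pairs with a common point. -/
theorem isClosed_inter_nonempty {B : Set (Space n)} (hB : IsCompact B) :
    IsClosed {q : Body n × Body n | ((q.1 : Set (Space n)) ∩ q.2 ∩ B).Nonempty} := by
  have : CompactSpace B := isCompact_iff_compactSpace.1 hB
  have hmem : ∀ (K : Body n) (z : Space n), z ∈ (K : Set (Space n)) ↔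
      Metric.infDist z (K : Set (Space n)) = 0 := fun K z =>
    K.isClosed.mem_iff_infDist_zero K.nonempty
  have h1 : IsClosed {w : (Body n × Body n) × B |
      Metric.infDist (w.2 : Space n) (w.1.1 : Set (Space n)) = 0 ∧
      Metric.infDist (w.2 : Space n) (w.1.2 : Set (Space n)) = 0} := by
    refine (isClosed_eq ?_ continuous_const).and (isClosed_eq ?_ continuous_const)
    · exact continuous_infDist_body.comp (f := fun w : (Body n × Body n) × B =>
        (w.1.1, (w.2 : Space n))) (by fun_prop)
    · exact continuous_infDist_body.comp (f := fun w : (Body n × Body n) × B =>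
        (w.1.2, (w.2 : Space n))) (by fun_prop)
  convert isClosedMap_fst_of_compactSpace _ h1
  ext ⟨K, L⟩
  constructor
  · rintro ⟨z, ⟨hK, hL⟩, hz⟩
    exact ⟨((K, L), ⟨z, hz⟩), ⟨(hmem K z).1 hK, (hmem L z).1 hL⟩, rfl⟩
  · rintro ⟨⟨⟨K', L'⟩, z⟩, ⟨h1, h2⟩, he⟩
    obtain ⟨rfl, rfl⟩ := Prod.mk.inj he
    exact ⟨z, ⟨(hmem _ _).2 h1, (hmem _ _).2 h2⟩, z.2⟩

theorem measurableSet_inter_nonempty :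
    MeasurableSet {q : Body n × Body n | ((q.1 : Set (Space n)) ∩ q.2).Nonempty} := by
  have : {q : Body n × Body n | ((q.1 : Set (Space n)) ∩ q.2).Nonempty} = ⋃ m : ℕ,
      {q | ((q.1 : Set (Space n)) ∩ q.2 ∩ Metric.closedBall 0 m).Nonempty} := by
    ext q
    rw [Set.mem_iUnion]
    constructor
    · rintro ⟨z, hz⟩
      obtain ⟨m, hm⟩ := exists_nat_ge ‖z‖
      exact ⟨m, z, hz, by simpa using hm⟩
    · rintro ⟨m, hm⟩
      exact hm.mono Set.inter_subset_left
  rw [this]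
  exact MeasurableSet.iUnion fun m =>
    (isClosed_inter_nonempty (isCompact_closedBall 0 _)).measurableSet

/-- Intersection is not continuous in the Hausdorff metric. However, the distance from z to K ∩ L is
at most r exactly when K ∩ L hits the closed ball of radius r around z, which is a closed condition.
-/
theorem measurable_bodyOf_inter :
    Measurable fun q : Body n × Body n => bodyOf ((q.1 : Set (Space n)) ∩ q.2) := by
  refine measurable_of_infDist fun z => measurable_of_Iic fun r => ?_
  set N := {q : Body n × Body n | ((q.1 : Set (Space n)) ∩ q.2).Nonempty} with hN
  have hNm : MeasurableSet N := measurableSet_inter_nonempty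
  have hzero : ∀ q ∉ N, bodyOf ((q.1 : Set (Space n)) ∩ q.2) = 0 := fun q hq => by
    rw [bodyOf, dif_neg fun h => hq h.2.2]
  have : (fun q : Body n × Body n => Metric.infDist z
      (bodyOf ((q.1 : Set (Space n)) ∩ q.2) : Set (Space n))) ⁻¹' Set.Iic r =
      {q | ((q.1 : Set (Space n)) ∩ q.2 ∩ Metric.closedBall z r).Nonempty} ∪
      -- On disjoint pairs `bodyOf` has the default value {0}, which contributes this constant
      -- event.
      (Nᶜ ∩ {_q | Metric.infDist z ((0 : Body n) : Set (Space n)) ≤ r}) := by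
    ext q
    by_cases hq : q ∈ N
    · simp only [Set.mem_preimage, Set.mem_Iic, Set.mem_union, Set.mem_inter_iff, Set.mem_compl_iff,
        hq, not_true_eq_false, false_and, or_false]
      rw [infDist_eq_dist_metricProj]
      constructor
      · intro h
        have hm := metricProj_mem (bodyOf ((q.1 : Set (Space n)) ∩ q.2)) z
        rw [← SetLike.mem_coe, coe_bodyOf_inter hq] at hm
        exact ⟨_, hm, by rwa [Metric.mem_closedBall, dist_comm]⟩
      · rintro ⟨y, hy, hyz⟩
        rw [← infDist_eq_dist_metricProj, coe_bodyOf_inter hq]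
        exact (Metric.infDist_le_dist_of_mem hy).trans (by rwa [dist_comm])
    · have h2 : ¬ ((q.1 : Set (Space n)) ∩ q.2 ∩ Metric.closedBall z r).Nonempty :=
        fun h => hq (h.mono Set.inter_subset_left)
      simp only [Set.mem_preimage, hzero q hq, Set.mem_Iic, Set.mem_union, Set.mem_inter_iff,
        Set.mem_compl_iff, hq, not_false_eq_true, true_and]
      exact ⟨Or.inr, fun h => h.resolve_left h2⟩
  rw [this]
  exact (isClosed_inter_nonempty (isCompact_closedBall z r)).measurableSet.union
    (hNm.compl.inter (MeasurableSet.const _))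

/-- A functional on convex bodies, extended by zero to all sets that are no convex bodies. -/
def onBody {R : Type*} [Zero R] (F : Body n → R) (A : Set (Space n)) : R :=
  open Classical in if Convex ℝ A ∧ IsCompact A ∧ A.Nonempty then F (bodyOf A) else 0

theorem onBody_empty {R : Type*} [Zero R] (F : Body n → R) : onBody F ∅ = 0 :=
  if_neg fun h => Set.not_nonempty_empty h.2.2

theorem bodyOf_coe (K : Body n) : bodyOf (K : Set (Space n)) = K :=
  SetLike.coe_injective (coe_bodyOf K.convex K.isCompact K.nonempty)

theorem onBody_coe {R : Type*} [Zero R] (F : Body n → R) (K : Body n) : onBody F K = F K := by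
  rw [onBody, if_pos ⟨K.convex, K.isCompact, K.nonempty⟩, bodyOf_coe]

/-- Compact convex sets: the convex bodies and the empty set. -/
def IsCompactConvex (A : Set (Space n)) : Prop := Convex ℝ A ∧ IsCompact A

theorem IsCompactConvex.eq_empty_or_exists {A : Set (Space n)} (h : IsCompactConvex A) :
    A = ∅ ∨ ∃ K : Body n, A = K := by
  rcases A.eq_empty_or_nonempty with h0 | h0
  · exact Or.inl h0
  · exact Or.inr ⟨bodyOf A, (coe_bodyOf h.1 h.2 h0).symm⟩

theorem isCompactConvex_body (K : Body n) : IsCompactConvex (K : Set (Space n)) :=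
  ⟨K.convex, K.isCompact⟩

theorem IsCompactConvex.inter {A B : Set (Space n)} (hA : IsCompactConvex A)
    (hB : IsCompactConvex B) : IsCompactConvex (A ∩ B) := ⟨hA.1.inter hB.1, hA.2.inter hB.2⟩

theorem IsAdditiveExtension.eq_onBody {T : Type*} [AddCommGroup T] {φ : Body n → T}
    {ψ : Set (Space n) → T} (h : IsAdditiveExtension φ ψ) {A : Set (Space n)}
    (hA : IsCompactConvex A) : ψ A = onBody φ A := by
  rcases hA.eq_empty_or_exists with rfl | ⟨K, rfl⟩
  · rw [h.empty, onBody_empty]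
  · rw [h.extends_body, onBody_coe]

/-- A measurable family of compact convex sets. -/
def IsMeasurableFamily {Y : Type*} [MeasurableSpace Y] (g : Y → Set (Space n)) : Prop :=
  ∃ (N : Set Y) (b : Y → Body n), MeasurableSet N ∧ Measurable b ∧
    (∀ y ∈ N, g y = b y) ∧ ∀ y ∉ N, g y = ∅

theorem onBody_eq_indicator {Y : Type*} {g : Y → Set (Space n)} {N : Set Y} {b : Y → Body n}
    (h1 : ∀ y ∈ N, g y = b y) (h2 : ∀ y ∉ N, g y = ∅) {R : Type*} [Zero R] (F : Body n → R) :
    (fun y => onBody F (g y)) = N.indicator (F ∘ b) := by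
  ext y
  by_cases hy : y ∈ N
  · rw [Set.indicator_of_mem hy, h1 y hy, onBody_coe]; rfl
  · rw [Set.indicator_of_notMem hy, h2 y hy, onBody_empty]

section MeasurableFamily

variable {Y : Type*} [MeasurableSpace Y]

theorem isMeasurableFamily_of_measurable {b : Y → Body n} (hb : Measurable b) :
    IsMeasurableFamily fun y => (b y : Set (Space n)) :=
  ⟨Set.univ, b, MeasurableSet.univ, hb, fun _ _ => rfl, fun y hy => absurd (Set.mem_univ y) hy⟩

theorem isMeasurableFamily_const {A : Set (Space n)} (hA : IsCompactConvex A) :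
    IsMeasurableFamily fun _ : Y => A := by
  rcases hA.eq_empty_or_exists with rfl | ⟨K, rfl⟩
  · exact ⟨∅, fun _ => 0, MeasurableSet.empty, measurable_const, fun y hy => absurd hy id,
      fun _ _ => rfl⟩
  · exact isMeasurableFamily_of_measurable measurable_const

theorem IsMeasurableFamily.inter_body {g : Y → Set (Space n)} (hg : IsMeasurableFamily g)
    {b : Y → Body n} (hb : Measurable b) :
    IsMeasurableFamily fun y => g y ∩ (b y : Set (Space n)) := by
  obtain ⟨N, c, hN, hc, h1, h2⟩ := hg
  refine ⟨N ∩ {y | ((c y : Set (Space n)) ∩ b y).Nonempty},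
    fun y => bodyOf ((c y : Set (Space n)) ∩ b y),
    hN.inter ((hc.prodMk hb) measurableSet_inter_nonempty),
    measurable_bodyOf_inter.comp (hc.prodMk hb), fun y hy => ?_, fun y hy => ?_⟩
  · rw [coe_bodyOf_inter hy.2, ← h1 y hy.1]
  · by_cases hyN : y ∈ N
    · beta_reduce
      rw [h1 y hyN]
      exact Set.not_nonempty_iff_eq_empty.1 fun h => hy ⟨hyN, h⟩
    · beta_reduce
      rw [h2 y hyN, Set.empty_inter]

theorem IsMeasurableFamily.measurable_onBody {g : Y → Set (Space n)} (hg : IsMeasurableFamily g)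
    {F : Body n → ℝ≥0∞} (hF : Measurable F) : Measurable fun y => onBody F (g y) := by
  obtain ⟨N, b, hN, hb, h1, h2⟩ := hg
  rw [onBody_eq_indicator h1 h2]
  exact (hF.comp hb).indicator hN

theorem IsMeasurableFamily.stronglyMeasurable_onBody {T : Type*} [NormedAddCommGroup T]
    {g : Y → Set (Space n)} (hg : IsMeasurableFamily g)
    {F : Body n → T} (hF : StronglyMeasurable F) : StronglyMeasurable fun y => onBody F (g y) := by
  obtain ⟨N, b, hN, hb, h1, h2⟩ := hg
  rw [onBody_eq_indicator h1 h2]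
  exact (hF.comp_measurable hb).indicator hN

end MeasurableFamily

theorem measurable_volume_body : Measurable fun K : Body n => volume (K : Set (Space n)) := by
  have h : MeasurableSet {q : Body n × Space n | q.2 ∈ (q.1 : Set (Space n))} := by
    have := continuous_metricProj_uncurry (n := n)
    have e : {q : Body n × Space n | q.2 ∈ (q.1 : Set (Space n))} =
      {q | metricProj q.1 q.2 = q.2} := by
      ext q; exact (metricProj_eq_self_iff q.1).symm
    rw [e]
    exact (isClosed_eq this continuous_snd).measurableSet
  exact measurable_measure_prodMk_left h

theorem measurable_vol : Measurable (vol : Body n → ℝ) := measurable_volume_body.ennreal_toReal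

theorem measurable_volume_shell (ε : ℝ) : Measurable fun K : Body n => volume (shell K ε) :=
  measurable_measure_prodMk_left (measurableSet_shell_uncurry ε)

theorem measurable_translate_right (K : Body n) : Measurable fun x => translate K x :=
  (continuous_translate (n := n)).measurable.comp measurable_prodMk_right


/-! ### The translative formula -/

section Shift

variable {Y : Type*} [MeasurableSpace Y] {p : Y → Space n} {τ : Space n → Space n}
  {U : Set (Space n)}

theorem measurableSet_shift (hp : Measurable p) (hτ : Measurable τ) (hU : MeasurableSet U) :
    MeasurableSet {z : Space n × Y | p z.2 + τ z.1 ∈ U} :=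
  ((hp.comp measurable_snd).add (hτ.comp measurable_fst)) hU

theorem volume_shift (hτ : MeasurePreserving τ (volume : Measure (Space n)) volume)
    (hU : MeasurableSet U) (y : Space n) : volume {x | y + τ x ∈ U} = volume U := by
  have h := hτ.measure_preimage (measurable_const_add y hU).nullMeasurableSet
  rw [measure_preimage_add] at h
  exact h

/-- Fubini and translation invariance. The map τ is the identity or the negation, according to which
of the two bodies carries the measure. -/
theorem lintegral_measure_shift (ν : Measure Y) [SFinite ν] (hp : Measurable p)
    (hτ : MeasurePreserving τ (volume : Measure (Space n)) volume) (hU : MeasurableSet U) :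
    ∫⁻ x, ν {q | p q + τ x ∈ U} = volume U * ν Set.univ := by
  have hS := measurableSet_shift hp hτ.measurable hU
  have h1 : (volume.prod ν) {z : Space n × Y | p z.2 + τ z.1 ∈ U} =
    ∫⁻ x, ν {q | p q + τ x ∈ U} := Measure.prod_apply hS
  have h2 : (volume.prod ν) {z : Space n × Y | p z.2 + τ z.1 ∈ U} =
    ∫⁻ q, volume {x | p q + τ x ∈ U} ∂ν := Measure.prod_apply_symm hS
  simp only [volume_shift hτ hU, lintegral_const] at h2
  rw [← h1, h2]

variable {T : Type*} [NormedAddCommGroup T] [NormedSpace ℝ T] [CompleteSpace T]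

theorem integral_shift (ν : Measure Y) [IsFiniteMeasure ν] (hp : Measurable p)
    (hτ : MeasurePreserving τ (volume : Measure (Space n)) volume) (hU : MeasurableSet U)
    (hfin : volume U ≠ ∞) {f : Y → T} (hf : StronglyMeasurable f) {C : ℝ} (hC : ∀ y, ‖f y‖ ≤ C) :
    Integrable (fun x => ∫ q in {q | p q + τ x ∈ U}, f q ∂ν) ∧
      ∫ x, ∫ q in {q | p q + τ x ∈ U}, f q ∂ν = (volume U).toReal • ∫ q, f q ∂ν := by
  have hS := measurableSet_shift hp hτ.measurable hU
  set S := {z : Space n × Y | p z.2 + τ z.1 ∈ U} with hSdef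
  have hSfin : (volume.prod ν) S ≠ ∞ := by
    have h1 : (volume.prod ν) S = ∫⁻ x, ν {q | p q + τ x ∈ U} := Measure.prod_apply hS
    rw [h1, lintegral_measure_shift ν hp hτ hU]
    exact ENNReal.mul_ne_top hfin (measure_ne_top _ _)
  have hint : Integrable (S.indicator fun z => f z.2) (volume.prod ν) := by
    rw [integrable_indicator_iff hS]
    exact Measure.integrableOn_of_bounded hSfin
      (hf.comp_measurable measurable_snd).aestronglyMeasurable
      (Eventually.of_forall fun z => hC z.2)
  have hx : ∀ x, ∫ q in {q | p q + τ x ∈ U}, f q ∂ν = ∫ q, S.indicator (fun z => f z.2) (x, q) ∂ν := by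
    intro x
    have hm : MeasurableSet {q | p q + τ x ∈ U} := (hp.add_const (τ x)) hU
    rw [← integral_indicator hm]
    rfl
  have hq : ∀ q, ∫ x, S.indicator (fun z => f z.2) (x, q) = (volume U).toReal • f q := by
    intro q
    have hm : MeasurableSet {x | p q + τ x ∈ U} := (hτ.measurable.const_add (p q)) hU
    rw [← volume_shift hτ hU (p q)]
    exact (integral_indicator hm).trans (setIntegral_const (f q))
  simp only [hx]
  refine ⟨hint.integral_prod_left, ?_⟩
  rw [integral_integral_swap (f := fun x q => S.indicator (fun z => f z.2) (x, q)) hint]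
  simp only [hq]
  exact integral_smul _ _

end Shift

/-! ### Translative integrals of volume and area measure -/

theorem mem_interior_translate {K : Body n} {a x : Space n} :
    x ∈ interior (translate K a : Set (Space n)) ↔ x - a ∈ interior (K : Set (Space n)) := by
  have h : (translate K a : Set (Space n)) = Homeomorph.addRight a '' (K : Set (Space n)) := rfl
  rw [h, ← Homeomorph.image_interior]
  constructor
  · rintro ⟨y, hy, rfl⟩
    simpa using hy
  · intro hx
    exact ⟨x - a, hx, by simp⟩

theorem volume_interior (K : Body n) :
    volume (interior (K : Set (Space n))) = volume (K : Set (Space n)) := by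
  refine le_antisymm (measure_mono interior_subset) ?_
  have h : (K : Set (Space n)) ⊆ interior (K : Set (Space n)) ∪ frontier (K : Set (Space n)) := by
    intro x hx
    by_cases hi : x ∈ interior (K : Set (Space n))
    · exact Or.inl hi
    · exact Or.inr ⟨subset_closure hx, hi⟩
  refine (measure_mono h).trans ((measure_union_le _ _).trans ?_)
  rw [Convex.addHaar_frontier volume K.convex, add_zero]

theorem volume_body_ne_top (K : Body n) : volume (K : Set (Space n)) ≠ ∞ :=
  K.isCompact.measure_lt_top.ne

theorem isMeasurableFamily_inter_translate (K M : Body n) :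
    IsMeasurableFamily fun x => (K : Set (Space n)) ∩ translate M x :=
  (isMeasurableFamily_const (isCompactConvex_body K)).inter_body (measurable_translate_right M)

theorem lintegral_volume_inter_shift (A : Set (Space n)) {B : Set (Space n)}
    (hB : MeasurableSet B) : ∫⁻ x, volume ({y | y + -x ∈ B} ∩ A) = volume B * volume A := by
  have h := lintegral_measure_shift (volume.restrict A) measurable_id
    (Measure.measurePreserving_neg (volume : Measure (Space n))) hB
  rw [Measure.restrict_apply MeasurableSet.univ, Set.univ_inter] at h
  rw [← h]
  exact lintegral_congr fun x => (Measure.restrict_apply ((measurable_id.add_const (-x)) hB)).symm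

theorem inter_translate_eq (A : Set (Space n)) (M : Body n) (x : Space n) :
    A ∩ (translate M x : Set (Space n)) = {y | y + -x ∈ (M : Set (Space n))} ∩ A := by
  ext y
  rw [Set.mem_inter_iff, and_comm]
  refine and_congr_left fun _ => ?_
  rw [SetLike.mem_coe, mem_translate, sub_eq_add_neg]
  rfl

/-- The translative formula for the volume. -/
theorem lintegral_volume_inter_translate (A : Set (Space n)) (M : Body n) :
    ∫⁻ x, volume (A ∩ (translate M x : Set (Space n))) =
      volume (M : Set (Space n)) * volume A := by
  simp only [inter_translate_eq]
  exact lintegral_volume_inter_shift A M.isClosed.measurableSet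

section Translative

variable [NeZero n]

theorem tendsto_volume_shell (K : Body n) :
    Tendsto (fun ε : ℝ => ENNReal.ofReal (ε * unitBallVolume 1)⁻¹ * volume (shell K ε)) (𝓝[>] 0)
      (𝓝 (areaMeasure K Set.univ)) := by
  have h := ENNReal.tendsto_ofReal (tendsto_parallelMeasure_real K MeasurableSet.univ)
  rw [ofReal_measureReal] at h
  refine h.congr' ?_
  filter_upwards [self_mem_nhdsWithin] with ε hε
  have hκ := mul_pos hε (unitBallVolume_pos 1)
  rw [ENNReal.ofReal_mul (by positivity), ofReal_measureReal, parallelMeasure_univ]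

/-- The total mass of the area measure of `K ∩ M`, in terms of local contributions. -/
theorem areaMeasure_interior_add_le (K M : Body n) :
    areaMeasure K {q | q.1 ∈ interior (M : Set (Space n))} +
      areaMeasure M {q | q.1 ∈ interior (K : Set (Space n))} ≤
      onBody (fun L => areaMeasure L Set.univ) ((K : Set (Space n)) ∩ M) := by
  have mK := measurableSet_fst_mem (n := n) (isOpen_interior (s := (K : Set (Space n)))).measurableSet
  have mM := measurableSet_fst_mem (n := n) (isOpen_interior (s := (M : Set (Space n)))).measurableSet
  rcases ((isCompactConvex_body K).inter (isCompactConvex_body M)).eq_empty_or_exists with h | ⟨L, h⟩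
  · have h1 : areaMeasure K {q | q.1 ∈ interior (M : Set (Space n))} = 0 := by
      refine measure_mono_null (fun q hq => ?_) (areaMeasure_fst_notMem K)
      change q.1 ∉ _
      intro hqK
      have : q.1 ∈ (K : Set (Space n)) ∩ M := ⟨hqK, interior_subset hq⟩
      rwa [h] at this
    have h2 : areaMeasure M {q | q.1 ∈ interior (K : Set (Space n))} = 0 := by
      refine measure_mono_null (fun q hq => ?_) (areaMeasure_fst_notMem M)
      change q.1 ∉ _
      intro hqM
      have : q.1 ∈ (K : Set (Space n)) ∩ M := ⟨interior_subset hq, hqM⟩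
      rwa [h] at this
    rw [h1, h2, zero_add]
    exact zero_le
  · rw [h, onBody_coe, ← areaMeasure_inter h.symm mM fun q hq => hq,
      ← areaMeasure_inter (by rw [← h, Set.inter_comm]) mK fun q hq => hq,
      ← measure_union₀ mK.nullMeasurableSet]
    · exact measure_mono (Set.subset_univ _)
    -- The two pieces overlap only over the interior of K ∩ M, where Λ_{n-1} has no mass.
    · refine measure_mono_null ?_ (areaMeasure_interior L)
      rintro q ⟨hM, hK⟩
      change q.1 ∈ interior (L : Set (Space n))
      rw [← h, interior_inter]
      exact ⟨hK, hM⟩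

variable {T : Type*} [NormedAddCommGroup T] [NormedSpace ℝ T]

/-- Equality of total masses says that Λ_{n-1}(K ∩ M) does not charge points outside both interiors,
so by locality the integral splits into the two contributions. -/
theorem onBody_surfaceIntegral_inter {f : Sph n → T} (hf : Continuous f) (K M : Body n)
    (h : areaMeasure K {q | q.1 ∈ interior (M : Set (Space n))} +
      areaMeasure M {q | q.1 ∈ interior (K : Set (Space n))} =
      onBody (fun L => areaMeasure L Set.univ) ((K : Set (Space n)) ∩ M)) :
    onBody (surfaceIntegral f) ((K : Set (Space n)) ∩ M) =
      ∫ q in {q | q.1 ∈ interior (M : Set (Space n))}, f q.2 ∂(areaMeasure K) +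
      ∫ q in {q | q.1 ∈ interior (K : Set (Space n))}, f q.2 ∂(areaMeasure M) := by
  have mK := measurableSet_fst_mem (n := n) (isOpen_interior (s := (K : Set (Space n)))).measurableSet
  have mM := measurableSet_fst_mem (n := n) (isOpen_interior (s := (M : Set (Space n)))).measurableSet
  rcases ((isCompactConvex_body K).inter (isCompactConvex_body M)).eq_empty_or_exists with e | ⟨L, e⟩
  · rw [e, onBody_empty, add_eq_zero] at h
    rw [e, onBody_empty, Measure.restrict_eq_zero.2 h.1, Measure.restrict_eq_zero.2 h.2]
    simp
  · have rM : (areaMeasure L).restrict {q | q.1 ∈ interior (M : Set (Space n))} =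
        (areaMeasure K).restrict {q | q.1 ∈ interior (M : Set (Space n))} := by
      ext η hη
      rw [Measure.restrict_apply hη, Measure.restrict_apply hη]
      exact areaMeasure_inter e.symm (hη.inter mM) fun q hq => hq.2
    have rK : (areaMeasure L).restrict {q | q.1 ∈ interior (K : Set (Space n))} =
        (areaMeasure M).restrict {q | q.1 ∈ interior (K : Set (Space n))} := by
      ext η hη
      rw [Measure.restrict_apply hη, Measure.restrict_apply hη]
      exact areaMeasure_inter (by rw [← e, Set.inter_comm]) (hη.inter mK) fun q hq => hq.2
    have hd : AEDisjoint (areaMeasure L) {q | q.1 ∈ interior (M : Set (Space n))}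
        {q | q.1 ∈ interior (K : Set (Space n))} := by
      refine measure_mono_null ?_ (areaMeasure_interior L)
      rintro q ⟨hM, hK⟩
      change q.1 ∈ interior (L : Set (Space n))
      rw [← e, interior_inter]
      exact ⟨hK, hM⟩
    rw [e, onBody_coe, ← areaMeasure_inter e.symm mM fun q hq => hq,
      ← areaMeasure_inter (by rw [← e, Set.inter_comm]) mK fun q hq => hq,
      ← measure_union₀ mK.nullMeasurableSet hd] at h
    have hnull := (ae_iff_measure_eq (μ := areaMeasure L)
      (p := fun q => q ∈ {q : Space n × Sph n | q.1 ∈ interior (M : Set (Space n))} ∪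
        {q | q.1 ∈ interior (K : Set (Space n))}) (mM.union mK).nullMeasurableSet).2 h
    rw [e, onBody_coe, surfaceIntegral, ← rM, ← rK, ← setIntegral_union₀ hd mK.nullMeasurableSet
      (integrable_comp_snd hf _).integrableOn (integrable_comp_snd hf _).integrableOn,
      Measure.restrict_eq_self_of_ae_mem hnull]

theorem measurable_areaMeasure_univ : Measurable fun K : Body n => areaMeasure K Set.univ := by
  refine measurable_of_tendsto_metrizable' atTop (f := fun (m : ℕ) (K : Body n) =>
    ENNReal.ofReal (1 / ((m : ℝ) + 1) * unitBallVolume 1)⁻¹ *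
      volume (shell K (1 / ((m : ℝ) + 1)))) (fun m => (measurable_volume_shell _).const_mul _) ?_
  exact tendsto_pi_nhds.2 fun K => (tendsto_volume_shell K).comp tendsto_one_div_nhdsGT

/-- Integrate the inclusion (K ∩ M_x) + εB ⊆ (K + εB) ∩ (M_x + εB), where M_x = M + x, and cancel
the finite term V_n(K) V_n(M). For negative ε all shells are empty. -/
theorem lintegral_volume_shell_inter_le (K M : Body n) (ε : ℝ) :
    ∫⁻ x, onBody (fun L => volume (shell L ε)) ((K : Set (Space n)) ∩ translate M x) ≤
      volume (shell M ε) * volume (K : Set (Space n)) + volume (M : Set (Space n)) *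
        volume (shell K ε) + volume (shell M ε) * volume (shell K ε) := by
  have hvol : ∀ L : Body n, 0 ≤ ε → volume ((L : Set (Space n)) + Metric.closedBall 0 ε) =
      volume (L : Set (Space n)) + volume (shell L ε) := by
    intro L hε
    have hsub : (L : Set (Space n)) ⊆ (L : Set (Space n)) + Metric.closedBall 0 ε := fun x hx =>
      ⟨x, hx, 0, Metric.mem_closedBall_self hε, add_zero x⟩
    rw [shell, ← measure_union Set.disjoint_sdiff_right
      (measurableSet_shell L ε), Set.union_sdiff_cancel hsub]
  by_cases hε : 0 ≤ ε
  · have hpt : ∀ x, onBody (fun L => volume (shell L ε)) ((K : Set (Space n)) ∩ translate M x) +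
        volume ({y | y + -x ∈ (M : Set (Space n))} ∩ (K : Set (Space n))) ≤
        volume ({y | y + -x ∈ (M : Set (Space n)) + Metric.closedBall 0 ε} ∩
          ((K : Set (Space n)) + Metric.closedBall 0 ε)) := by
      intro x
      rw [← inter_translate_eq]
      rcases ((isCompactConvex_body K).inter
        (isCompactConvex_body (translate M x))).eq_empty_or_exists with e | ⟨L, e⟩
      · rw [e, onBody_empty, measure_empty, zero_add]
        exact zero_le
      · rw [e, onBody_coe, add_comm, ← hvol L hε]
        refine measure_mono ?_
        rintro _ ⟨y, hy, z, hz, rfl⟩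
        have hy' : y ∈ (K : Set (Space n)) ∩ translate M x := e ▸ hy
        refine ⟨⟨y - x, mem_translate.1 hy'.2, z, hz, ?_⟩, ⟨y, hy'.1, z, hz, rfl⟩⟩
        change y - x + z = y + z + -x
        abel
    have hle := lintegral_mono (μ := volume) hpt
    rw [lintegral_add_left ((isMeasurableFamily_inter_translate K M).measurable_onBody
      (measurable_volume_shell ε)), lintegral_volume_inter_shift _ M.isClosed.measurableSet,
      lintegral_volume_inter_shift _ (isCompact_add_closedBall M ε).isClosed.measurableSet, hvol K hε,
      hvol M hε] at hle
    refine ENNReal.le_of_add_le_add_right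
      (ENNReal.mul_ne_top (volume_body_ne_top M) (volume_body_ne_top K)) (hle.trans_eq ?_)
    ring
  · have hz : ∀ x, onBody (fun L => volume (shell L ε)) ((K : Set (Space n)) ∩ translate M x) = 0 := by
      intro x
      have h0 : ∀ L : Body n, volume (shell L ε) = 0 := fun L => by
        rw [shell, Metric.closedBall_eq_empty.2 (not_le.1 hε)]; simp
      rcases ((isCompactConvex_body K).inter
        (isCompactConvex_body (translate M x))).eq_empty_or_exists with e | ⟨L, e⟩
      · rw [e, onBody_empty]
      · rw [e, onBody_coe, h0]
    simp [hz]

/-- The shell inequality is divided by εκ₁ and combined with Fatou's lemma. The product of two shell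
volumes is O(ε²) and disappears in the limit. -/
theorem lintegral_areaMeasure_inter_le (K M : Body n) :
    ∫⁻ x, onBody (fun L => areaMeasure L Set.univ) ((K : Set (Space n)) ∩ translate M x) ≤
      volume (M : Set (Space n)) * areaMeasure K Set.univ +
        volume (K : Set (Space n)) * areaMeasure M Set.univ := by
  set e : ℕ → ℝ := fun m => 1 / ((m : ℝ) + 1) with he
  have he0 : ∀ m, 0 < e m := fun m => by positivity
  have hκ := unitBallVolume_pos 1
  set c : ℕ → ℝ≥0∞ := fun m => ENNReal.ofReal (e m * unitBallVolume 1)⁻¹ with hc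
  set H : ℕ → Space n → ℝ≥0∞ := fun m x =>
    onBody (fun L => volume (shell L (e m))) ((K : Set (Space n)) ∩ translate M x) with hH
  have hHm : ∀ m, Measurable (H m) := fun m =>
    (isMeasurableFamily_inter_translate K M).measurable_onBody (measurable_volume_shell (e m))
  have hlim : ∀ x, onBody (fun L => areaMeasure L Set.univ) ((K : Set (Space n)) ∩ translate M x) =
      liminf (fun m => c m * H m x) atTop := by
    intro x
    refine (Tendsto.liminf_eq ?_).symm
    simp only [hH]
    rcases ((isCompactConvex_body K).inter
      (isCompactConvex_body (translate M x))).eq_empty_or_exists with h | ⟨L, h⟩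
    · simp only [h, onBody_empty, mul_zero]
      exact tendsto_const_nhds
    · simp only [h, onBody_coe]
      exact (tendsto_volume_shell L).comp tendsto_one_div_nhdsGT
  have tK : Tendsto (fun m => c m * volume (shell K (e m))) atTop (𝓝 (areaMeasure K Set.univ)) :=
    (tendsto_volume_shell K).comp tendsto_one_div_nhdsGT
  have tM : Tendsto (fun m => c m * volume (shell M (e m))) atTop (𝓝 (areaMeasure M Set.univ)) :=
    (tendsto_volume_shell M).comp tendsto_one_div_nhdsGT
  have te : Tendsto (fun m => ENNReal.ofReal (e m * unitBallVolume 1)) atTop (𝓝 0) := by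
    have := (tendsto_one_div_add_atTop_nhds_zero_nat (𝕜 := ℝ)).mul_const (unitBallVolume 1)
    rw [zero_mul] at this
    rw [← ENNReal.ofReal_zero]
    exact ENNReal.tendsto_ofReal this
  have hbound : Tendsto (fun m => volume (K : Set (Space n)) * (c m * volume (shell M (e m))) +
      volume (M : Set (Space n)) * (c m * volume (shell K (e m))) +
      ENNReal.ofReal (e m * unitBallVolume 1) * (c m * volume (shell M (e m))) *
        (c m * volume (shell K (e m)))) atTop
      (𝓝 (volume (K : Set (Space n)) * areaMeasure M Set.univ +
        volume (M : Set (Space n)) * areaMeasure K Set.univ +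
        0 * areaMeasure M Set.univ * areaMeasure K Set.univ)) := by
    have nK := measure_ne_top (areaMeasure K) Set.univ
    have nM := measure_ne_top (areaMeasure M) Set.univ
    refine ((ENNReal.Tendsto.const_mul tM (Or.inr (volume_body_ne_top K))).add
      (ENNReal.Tendsto.const_mul tK (Or.inr (volume_body_ne_top M)))).add ?_
    refine ENNReal.Tendsto.mul (ENNReal.Tendsto.mul te (Or.inr nM) tM (Or.inr ENNReal.zero_ne_top))
      (Or.inr nK) tK (Or.inr ?_)
    simp
  have hle : ∀ m, ∫⁻ x, c m * H m x ≤
      volume (K : Set (Space n)) * (c m * volume (shell M (e m))) +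
      volume (M : Set (Space n)) * (c m * volume (shell K (e m))) +
      ENNReal.ofReal (e m * unitBallVolume 1) * (c m * volume (shell M (e m))) *
        (c m * volume (shell K (e m))) := by
    intro m
    have hcm : ENNReal.ofReal (e m * unitBallVolume 1) * c m = 1 := by
      have := mul_pos (he0 m) hκ
      rw [hc, ← ENNReal.ofReal_mul this.le, mul_inv_cancel₀ this.ne', ENNReal.ofReal_one]
    rw [lintegral_const_mul _ (hHm m)]
    refine (mul_le_mul_right (lintegral_volume_shell_inter_le K M (e m)) (c m)).trans_eq ?_
    have : ENNReal.ofReal (e m * unitBallVolume 1) * (c m * volume (shell M (e m))) =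
        volume (shell M (e m)) := by rw [← mul_assoc, hcm, one_mul]
    rw [this]
    ring
  simp only [hlim]
  refine (lintegral_liminf_le fun m => (hHm m).const_mul _).trans ?_
  refine (liminf_le_liminf (Eventually.of_forall hle)).trans_eq ?_
  rw [hbound.liminf_eq]
  ring

/-- The **translative formula** for surface integrals. -/
theorem integral_surfaceIntegral_inter_translate [CompleteSpace T] {f : Sph n → T}
    (hf : Continuous f) (K M : Body n) :
    Integrable (fun x => onBody (surfaceIntegral f) ((K : Set (Space n)) ∩ translate M x)) ∧
      ∫ x, onBody (surfaceIntegral f) ((K : Set (Space n)) ∩ translate M x) =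
        vol M • surfaceIntegral f K + vol K • surfaceIntegral f M := by
  obtain ⟨C, -, hC⟩ := exists_forall_norm_le hf
  have hUK := (isOpen_interior (s := (K : Set (Space n)))).measurableSet
  have hUM := (isOpen_interior (s := (M : Set (Space n)))).measurableSet
  have eM : ∀ x, {q : Space n × Sph n | q.1 ∈ interior (translate M x : Set (Space n))} =
      {q | q.1 + -x ∈ interior (M : Set (Space n))} := fun x => by
    ext q
    simp only [Set.mem_ofPred_eq, mem_interior_translate, sub_eq_add_neg]
  have hshift : ∀ x, Measurable (Prod.map (· + x) id : Space n × Sph n → Space n × Sph n) :=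
    fun x => (measurable_add_const x).prodMap measurable_id
  have eK : ∀ x, areaMeasure (translate M x) {q | q.1 ∈ interior (K : Set (Space n))} =
      areaMeasure M {q | q.1 + x ∈ interior (K : Set (Space n))} := fun x => by
    rw [areaMeasure_translate, Measure.map_apply (hshift x) (measurableSet_fst_mem hUK)]
    rfl
  have iK : ∀ x, ∫ q in {q | q.1 ∈ interior (K : Set (Space n))}, f q.2
      ∂(areaMeasure (translate M x)) =
      ∫ q in {q | q.1 + x ∈ interior (K : Set (Space n))}, f q.2 ∂(areaMeasure M) := fun x => by
    rw [areaMeasure_translate, setIntegral_map (measurableSet_fst_mem hUK)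
      (stronglyMeasurable_comp_snd hf).aestronglyMeasurable (hshift x).aemeasurable]
    rfl
  have la := lintegral_measure_shift (areaMeasure K) measurable_fst
    (Measure.measurePreserving_neg (volume : Measure (Space n))) hUM
  have lb := lintegral_measure_shift (areaMeasure M) measurable_fst
    (MeasurePreserving.id (volume : Measure (Space n))) hUK
  rw [volume_interior] at la lb
  simp only [id] at lb
  have hma : Measurable fun x : Space n =>
      areaMeasure K {q | q.1 + -x ∈ interior (M : Set (Space n))} :=
    measurable_measure_prodMk_left (measurableSet_shift measurable_fst measurable_neg hUM)
  have hmA := (isMeasurableFamily_inter_translate K M).measurable_onBody measurable_areaMeasure_univ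
  have hae : (fun x => areaMeasure K {q | q.1 + -x ∈ interior (M : Set (Space n))} +
      areaMeasure M {q | q.1 + x ∈ interior (K : Set (Space n))}) =ᵐ[volume]
      fun x => onBody (fun L => areaMeasure L Set.univ) ((K : Set (Space n)) ∩ translate M x) := by
    -- The left side is pointwise at most the right side, and its finite integral is at least that
    -- of the right side, so the two agree almost everywhere.
    refine ae_eq_of_ae_le_of_lintegral_le (Eventually.of_forall fun x => ?_) ?_ hmA.aemeasurable ?_
    · have := areaMeasure_interior_add_le K (translate M x)
      rwa [eM, eK] at this
    · rw [lintegral_add_left hma, la, lb]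
      exact ENNReal.add_ne_top.2 ⟨ENNReal.mul_ne_top (volume_body_ne_top M) (measure_ne_top _ _),
        ENNReal.mul_ne_top (volume_body_ne_top K) (measure_ne_top _ _)⟩
    · rw [lintegral_add_left hma, la, lb]
      exact lintegral_areaMeasure_inter_le K M
  have heq : (fun x => onBody (surfaceIntegral f) ((K : Set (Space n)) ∩ translate M x)) =ᵐ[volume]
      fun x => ∫ q in {q | q.1 + -x ∈ interior (M : Set (Space n))}, f q.2 ∂(areaMeasure K) +
        ∫ q in {q | q.1 + x ∈ interior (K : Set (Space n))}, f q.2 ∂(areaMeasure M) := by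
    filter_upwards [hae] with x hx
    have := onBody_surfaceIntegral_inter hf K (translate M x) (by rw [eM, eK]; exact hx)
    rw [this, eM, iK]
  have ha := integral_shift (areaMeasure K) measurable_fst
    (Measure.measurePreserving_neg (volume : Measure (Space n))) hUM
    ((volume_interior M).trans_ne (volume_body_ne_top M)) (stronglyMeasurable_comp_snd hf)
    fun q => hC q.2
  have hb := integral_shift (areaMeasure M) measurable_fst
    (MeasurePreserving.id (volume : Measure (Space n))) hUK
    ((volume_interior K).trans_ne (volume_body_ne_top K)) (stronglyMeasurable_comp_snd hf)
    fun q => hC q.2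
  rw [volume_interior] at ha hb
  simp only [id] at hb
  refine ⟨(integrable_congr heq).2 (ha.1.add hb.1), ?_⟩
  rw [integral_congr_ae heq, integral_add ha.1 hb.1, ha.2, hb.2]
  rfl

end Translative

/-! ### Factorial moment measures of the Poisson process -/

theorem lintegral_poissonMeasure_id (r : ℝ≥0) : ∫⁻ k, (k : ℝ≥0∞) ∂(poissonMeasure r) = r := by
  rw [lintegral_countable', tsum_eq_zero_add' ENNReal.summable]
  have h : ∀ k : ℕ, ((k + 1 : ℕ) : ℝ≥0∞) * poissonMeasure r {k + 1} = r * poissonMeasure r {k} := by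
    intro k
    rw [poissonMeasure_singleton, poissonMeasure_singleton, ← ENNReal.ofReal_natCast,
      ← ENNReal.ofReal_coe_nnreal, ← ENNReal.ofReal_mul (by positivity),
      ← ENNReal.ofReal_mul (by positivity)]
    congr 1
    rw [Nat.factorial_succ]
    push_cast
    field_simp
    ring
  simp only [h]
  have h1 : ∑' k : ℕ, poissonMeasure r {k} = 1 := by
    have := lintegral_countable' (μ := poissonMeasure r) (fun _ => 1)
    simpa using this.symm
  rw [ENNReal.tsum_mul_left, h1]
  simp

/-- The `k`-tuples of distinct elements of a set. -/
def distinctTuples (k : ℕ) (A : Set (Body n)) : Set (Fin k → Body n) :=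
  {t | Function.Injective t ∧ ∀ i, t i ∈ A}

theorem finite_distinctTuples (k : ℕ) {A : Set (Body n)} (hA : A.Finite) :
    (distinctTuples k A).Finite :=
  (Set.Finite.pi' fun _ => hA).subset fun _ ht => ht.2

/-- The counting measure on the `k`-tuples of distinct elements of a set. -/
def tupleMeasure (k : ℕ) (A : Set (Body n)) : Measure (Fin k → Body n) :=
  Measure.count.restrict (distinctTuples k A)

theorem tupleMeasure_apply (k : ℕ) (A : Set (Body n)) {B : Set (Fin k → Body n)}
    (hB : MeasurableSet B) : tupleMeasure k A B = Measure.count (B ∩ distinctTuples k A) :=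
  Measure.restrict_apply hB

theorem isFiniteMeasure_tupleMeasure (k : ℕ) {A : Set (Body n)} (hA : A.Finite) :
    IsFiniteMeasure (tupleMeasure k A) :=
  ⟨by
    rw [tupleMeasure_apply k A MeasurableSet.univ, Set.univ_inter]
    exact Measure.count_apply_lt_top.2 (finite_distinctTuples k hA)⟩

/-- Entries taken from pairwise disjoint sides are automatically distinct, so the count factorizes.
-/
theorem tupleMeasure_pi (k : ℕ) {A : Set (Body n)} (hA : A.Finite) {B : Fin k → Set (Body n)}
    (hB : ∀ i, MeasurableSet (B i)) (hd : Pairwise fun i j => Disjoint (B i) (B j)) :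
    tupleMeasure k A (Set.univ.pi B) = ∏ i, ((A ∩ B i).encard : ℝ≥0∞) := by
  have h : Set.univ.pi B ∩ distinctTuples k A = Set.univ.pi fun i => A ∩ B i := by
    ext t
    constructor
    · exact fun h i _ => ⟨h.2.2 i, h.1 i (Set.mem_univ i)⟩
    · intro h
      refine ⟨fun i _ => (h i (Set.mem_univ i)).2, fun i j hij => ?_,
        fun i => (h i (Set.mem_univ i)).1⟩
      by_contra hne
      exact Set.disjoint_left.1 (hd hne) (h i (Set.mem_univ i)).2
        (hij ▸ (h j (Set.mem_univ j)).2)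
  have hfin : (Set.univ.pi fun i => A ∩ B i).Finite := Set.Finite.pi fun _ => hA.inter_of_left _
  rw [tupleMeasure_apply k A (MeasurableSet.univ_pi hB), h, Measure.count_apply hfin.measurableSet,
    Set.encard_pi_eq_prod_encard]
  exact map_prod ENat.toENNRealRingHom _ _

/-- Distinct points have disjoint basic neighbourhoods, and a countable basis gives only countably
many such rectangles. On them the independence of counts applies directly. -/
theorem exists_disjoint_rectangles (k : ℕ) :
    ∃ R : ℕ → Fin k → Set (Body n), (∀ j i, MeasurableSet (R j i)) ∧
      (∀ j, Pairwise fun i l => Disjoint (R j i) (R j l)) ∧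
      ⋃ j, Set.univ.pi (R j) = {t : Fin k → Body n | Function.Injective t} := by
  let b := insert ∅ (TopologicalSpace.countableBasis (Body n))
  have hb : b.Countable := (TopologicalSpace.countable_countableBasis _).insert _
  let D : Set (Fin k → Set (Body n)) :=
    {B | (∀ i, B i ∈ b) ∧ Pairwise fun i l => Disjoint (B i) (B l)}
  have hD : D.Countable := (Set.countable_pi fun _ => hb).mono fun B hB => hB.1
  have hne : D.Nonempty := ⟨fun _ => ∅, fun _ => Set.mem_insert _ _, fun _ _ _ => disjoint_bot_left⟩
  obtain ⟨R, hR⟩ := hD.exists_eq_range hne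
  have hRD : ∀ j, R j ∈ D := fun j => hR ▸ Set.mem_range_self j
  refine ⟨R, fun j i => ?_, fun j => (hRD j).2, ?_⟩
  · rcases (hRD j).1 i with h | h
    · rw [h]; exact MeasurableSet.empty
    · exact (TopologicalSpace.isOpen_of_mem_countableBasis h).measurableSet
  · ext t
    rw [Set.mem_iUnion]
    constructor
    · rintro ⟨j, hj⟩ i l hil
      by_contra hne
      exact Set.disjoint_left.1 ((hRD j).2 hne) (hj i (Set.mem_univ i))
        (hil ▸ hj l (Set.mem_univ l))
    · intro ht
      obtain ⟨U, hU, hdis⟩ := (Set.finite_range t).t2_separation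
      have hex : ∀ i, ∃ V ∈ TopologicalSpace.countableBasis (Body n), t i ∈ V ∧ V ⊆ U (t i) :=
        fun i => (TopologicalSpace.isBasis_countableBasis _).exists_subset_of_mem_open
          (hU (t i)).1 (hU (t i)).2
      choose V hV htV hVU using hex
      have hVD : V ∈ D := ⟨fun i => Set.mem_insert_of_mem _ (hV i), fun i l hil =>
        (hdis (Set.mem_range_self i) (Set.mem_range_self l) (ht.ne hil)).mono (hVU i) (hVU l)⟩
      rw [hR] at hVD
      obtain ⟨j, hj⟩ := hVD
      exact ⟨j, fun i _ => hj ▸ htV i⟩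

theorem tupleMeasure_inter_pi {A F : Set (Body n)} (hA : (A ∩ F).Finite) (k : ℕ)
    {Q R : Fin k → Set (Body n)}
    (hQ : ∀ i, MeasurableSet (Q i)) (hR : ∀ i, MeasurableSet (R i))
    (hd : Pairwise fun i j => Disjoint (R i) (R j)) :
    tupleMeasure k (A ∩ F) (Set.univ.pi Q ∩ Set.univ.pi R) =
      ∏ i, ((A ∩ (F ∩ (Q i ∩ R i))).encard : ℝ≥0∞) := by
  rw [← Set.pi_inter_distrib, tupleMeasure_pi k (hA) (fun i => (hQ i).inter (hR i))
    fun i j hij => (hd hij).mono Set.inter_subset_right Set.inter_subset_right]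
  simp only [Set.inter_assoc]

/-- By Fubini each diagonal t i = t j is null when μ has no atoms. -/
theorem pi_not_injective_eq_zero (μ : Measure (Body n)) [SigmaFinite μ] [NullSingletonClass μ]
    (k : ℕ) :
    Measure.pi (fun _ : Fin k => μ) {t | Function.Injective t}ᶜ = 0 := by
  have hpair : ∀ i j : Fin k, i ≠ j → Measure.pi (fun _ : Fin k => μ) {t | t i = t j} = 0 := by
    cases k with
    | zero => exact fun i => i.elim0
    | succ m =>
      intro i j hij
      obtain ⟨l, rfl⟩ := Fin.exists_succAbove_eq hij.symm
      have hmp := measurePreserving_piFinSuccAbove (fun _ : Fin (m + 1) => μ) i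
      have hset : MeasurableSet {z : Body n × (Fin m → Body n) | z.1 = z.2 l} :=
        measurableSet_eq_fun measurable_fst ((measurable_pi_apply l).comp measurable_snd)
      have h2 := hmp.measure_preimage hset.nullMeasurableSet
      have h3 : (μ.prod (Measure.pi fun _ : Fin m => μ))
          {z : Body n × (Fin m → Body n) | z.1 = z.2 l} = 0 := by
        rw [Measure.prod_apply_symm hset]
        refine (lintegral_congr fun r => ?_).trans lintegral_zero
        exact measure_singleton (r l)
      rw [h3] at h2
      exact h2
  refine measure_mono_null (t := ⋃ i, ⋃ j, ⋃ _ : i ≠ j, {t : Fin k → Body n | t i = t j}) ?_ ?_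
  · intro t ht
    have ht : ¬ Function.Injective t := ht
    simp only [Function.Injective, not_forall] at ht
    obtain ⟨i, j, hij, hne⟩ := ht
    exact Set.mem_iUnion.2 ⟨i, Set.mem_iUnion.2 ⟨j, Set.mem_iUnion.2 ⟨hne, hij⟩⟩⟩
  · exact measure_iUnion_null fun i => measure_iUnion_null fun j =>
      measure_iUnion_null fun hne => hpair i j hne

section Poisson

variable {Ω : Type*} [MeasurableSpace Ω] {P : Measure Ω} {X : Ω → Set (Body n)}
  {Θ : Measure (Body n)} {F : Set (Body n)}

theorem IsPoissonProcess.measurable_encard (hX : IsPoissonProcess P X Θ) {A : Set (Body n)}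
    (hA : MeasurableSet A) : Measurable fun ω => ((X ω ∩ A).encard : ℝ≥0∞) :=
  (Measurable.of_discrete (f := ENat.toENNReal)).comp (hX.measurable_count A hA)

theorem IsPoissonProcess.lintegral_encard (hX : IsPoissonProcess P X Θ) {A : Set (Body n)}
    (hA : MeasurableSet A) (hfin : Θ A ≠ ∞) : ∫⁻ ω, ((X ω ∩ A).encard : ℝ≥0∞) ∂P = Θ A := by
  have h1 : ∫⁻ ω, ((X ω ∩ A).encard : ℝ≥0∞) ∂P =
      ∫⁻ k, (k : ℝ≥0∞) ∂(P.map fun ω => (X ω ∩ A).encard) :=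
    (lintegral_map (f := ENat.toENNReal) Measurable.of_discrete (hX.measurable_count A hA)).symm
  rw [h1, hX.poisson_count A hA hfin, lintegral_map Measurable.of_discrete Measurable.of_discrete]
  simp only [ENat.toENNReal_coe]
  rw [lintegral_poissonMeasure_id, ENNReal.coe_toNNReal hfin]

/-- A π-λ argument in B: on product sets the value is a product of counts, and complements are
handled by subtraction, the tuple measure being finite. -/
theorem IsPoissonProcess.measurable_tupleMeasure_inter (hX : IsPoissonProcess P X Θ)
    (hF : MeasurableSet F) (hXF : ∀ ω, (X ω ∩ F).Finite) (k : ℕ) {R : Fin k → Set (Body n)}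
    (hR : ∀ i, MeasurableSet (R i)) (hd : Pairwise fun i j => Disjoint (R i) (R j))
    {B : Set (Fin k → Body n)} (hB : MeasurableSet B) :
    Measurable fun ω => tupleMeasure k (X ω ∩ F) (B ∩ Set.univ.pi R) := by
  have hRm : MeasurableSet (Set.univ.pi R) := MeasurableSet.univ_pi hR
  have hbase : ∀ Q : Fin k → Set (Body n), (∀ i, MeasurableSet (Q i)) →
      Measurable fun ω => tupleMeasure k (X ω ∩ F) (Set.univ.pi Q ∩ Set.univ.pi R) := by
    intro Q hQ
    simp only [fun ω => tupleMeasure_inter_pi (hXF ω) k hQ hR hd]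
    exact Finset.measurable_prod _ fun i _ =>
      hX.measurable_encard (hF.inter ((hQ i).inter (hR i)))
  refine MeasurableSpace.induction_on_inter (C := fun B _ => Measurable fun ω =>
    tupleMeasure k (X ω ∩ F) (B ∩ Set.univ.pi R)) generateFrom_pi.symm isPiSystem_pi
    ?_ ?_ ?_ ?_ B hB
  · simp
  · rintro _ ⟨Q, hQ, rfl⟩
    exact hbase Q fun i => hQ i (Set.mem_univ i)
  · intro B hB ih
    have h0 := hbase (fun _ => Set.univ) fun _ => MeasurableSet.univ
    simp only [Set.pi_univ, Set.univ_inter] at h0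
    have : ∀ ω, tupleMeasure k (X ω ∩ F) (Bᶜ ∩ Set.univ.pi R) =
        tupleMeasure k (X ω ∩ F) (Set.univ.pi R) -
          tupleMeasure k (X ω ∩ F) (B ∩ Set.univ.pi R) := by
      intro ω
      have := isFiniteMeasure_tupleMeasure k (hXF ω)
      rw [← measure_sdiff Set.inter_subset_right (hB.inter hRm).nullMeasurableSet
        (measure_ne_top _ _)]
      congr 1
      ext t
      simp only [Set.mem_inter_iff, Set.mem_compl_iff, Set.mem_sdiff]
      tauto
    simp only [this]
    exact h0.sub ih
  · intro B hdis hB ih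
    have : ∀ ω, tupleMeasure k (X ω ∩ F) ((⋃ j, B j) ∩ Set.univ.pi R) =
        ∑' j, tupleMeasure k (X ω ∩ F) (B j ∩ Set.univ.pi R) := by
      intro ω
      rw [Set.iUnion_inter, measure_iUnion]
      · exact fun i j hij => (hdis hij).mono Set.inter_subset_left Set.inter_subset_left
      · exact fun j => (hB j).inter hRm
    simp only [this]
    exact Measurable.tsum ih

theorem IsPoissonProcess.measurable_tupleMeasure (hX : IsPoissonProcess P X Θ)
    (hF : MeasurableSet F) (hXF : ∀ ω, (X ω ∩ F).Finite) (k : ℕ) :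
    Measurable fun ω => tupleMeasure k (X ω ∩ F) := by
  obtain ⟨R, hR, hd, hU⟩ := exists_disjoint_rectangles (n := n) k
  refine Measure.measurable_of_measurable_coe _ fun B hB => ?_
  set S : ℕ → Set (Fin k → Body n) := fun j => Set.univ.pi (R j) with hS
  have hSm : ∀ j, MeasurableSet (S j) := fun j => MeasurableSet.univ_pi (hR j)
  have hDm : ∀ j, MeasurableSet (B ∩ disjointed S j) := fun j =>
    hB.inter (MeasurableSet.disjointed hSm j)
  have : ∀ ω, tupleMeasure k (X ω ∩ F) B = ∑' j, tupleMeasure k (X ω ∩ F)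
      ((B ∩ disjointed S j) ∩ S j) := by
    intro ω
    have h1 : ∀ j, B ∩ disjointed S j ∩ S j = B ∩ disjointed S j := fun j =>
      Set.inter_eq_left.2 (Set.inter_subset_right.trans (disjointed_subset S j))
    simp only [h1]
    rw [← measure_iUnion (fun i j hij => (disjoint_disjointed S hij).mono Set.inter_subset_right
      Set.inter_subset_right) hDm, ← Set.inter_iUnion, iUnion_disjointed, hU,
      tupleMeasure_apply _ _ hB, tupleMeasure_apply]
    · congr 1
      ext t
      simp only [Set.mem_inter_iff, distinctTuples, Set.mem_ofPred_eq]
      tauto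
    · rw [← hU]
      exact hB.inter (MeasurableSet.iUnion hSm)
  simp only [this]
  exact Measurable.tsum fun j => hX.measurable_tupleMeasure_inter hF hXF k (hR j) (hd j) (hDm j)

/-- The factorial moment measures of a Poisson process are the powers of its intensity measure. -/
theorem IsPoissonProcess.bind_tupleMeasure [IsProbabilityMeasure P] (hX : IsPoissonProcess P X Θ)
    (hF : MeasurableSet F) (hXF : ∀ ω, (X ω ∩ F).Finite) (hfin : Θ F ≠ ∞) [NullSingletonClass Θ]
    (k : ℕ) :
    P.bind (fun ω => tupleMeasure k (X ω ∩ F)) =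
      Measure.pi fun _ : Fin k => Θ.restrict F := by
  obtain ⟨R, hR, hd, hU⟩ := exists_disjoint_rectangles (n := n) k
  have hN := hX.measurable_tupleMeasure hF hXF k
  have : IsFiniteMeasure (Θ.restrict F) := ⟨by simpa using hfin.lt_top⟩
  set μ₁ := P.bind (fun ω => tupleMeasure k (X ω ∩ F)) with hμ₁
  set μ₂ := Measure.pi (fun _ : Fin k => Θ.restrict F) with hμ₂
  have hDm : MeasurableSet {t : Fin k → Body n | Function.Injective t} := by
    rw [← hU]
    exact MeasurableSet.iUnion fun j => MeasurableSet.univ_pi (hR j)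
  -- Inside a rectangle with disjoint sides, independence turns the expected product of counts into
  -- the product of the intensities.
  have hrect : ∀ j (Q : Fin k → Set (Body n)), (∀ i, MeasurableSet (Q i)) →
      μ₁ (Set.univ.pi Q ∩ Set.univ.pi (R j)) = μ₂ (Set.univ.pi Q ∩ Set.univ.pi (R j)) := by
    intro j Q hQ
    have hA : ∀ i, MeasurableSet (F ∩ (Q i ∩ R j i)) := fun i =>
      hF.inter ((hQ i).inter (hR j i))
    rw [hμ₁, Measure.bind_apply ((MeasurableSet.univ_pi hQ).inter (MeasurableSet.univ_pi (hR j)))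
      hN.aemeasurable]
    simp only [fun ω => tupleMeasure_inter_pi (hXF ω) k hQ (hR j) (hd j)]
    have hind := (hX.indep_count k (fun i => F ∩ (Q i ∩ R j i)) hA fun i l hil =>
      (hd j hil).mono (Set.inter_subset_right.trans Set.inter_subset_right)
        (Set.inter_subset_right.trans Set.inter_subset_right)).comp
      (fun _ => ENat.toENNReal) fun _ => Measurable.of_discrete
    have hprod := lintegral_prod_eq_prod_lintegral_of_indepFun Finset.univ _ hind
      fun i => hX.measurable_encard (hA i)
    simp only [Function.comp] at hprod
    rw [hprod, hμ₂, ← Set.pi_inter_distrib, Measure.pi_pi]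
    refine Finset.prod_congr rfl fun i _ => ?_
    rw [hX.lintegral_encard (hA i) (measure_ne_top_of_subset Set.inter_subset_left hfin),
      Measure.restrict_apply ((hQ i).inter (hR j i)), Set.inter_comm]
  have hres : μ₁.restrict (⋃ j, Set.univ.pi (R j)) = μ₂.restrict (⋃ j, Set.univ.pi (R j)) := by
    refine Measure.restrict_iUnion_congr.2 fun j => ?_
    have huniv := hrect j (fun _ => Set.univ) fun _ => MeasurableSet.univ
    simp only [Set.pi_univ, Set.univ_inter] at huniv
    have : IsFiniteMeasure (μ₁.restrict (Set.univ.pi (R j))) :=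
      ⟨by rw [Measure.restrict_apply_univ, huniv]; exact measure_lt_top _ _⟩
    refine ext_of_generate_finite _ generateFrom_pi.symm isPiSystem_pi ?_ ?_
    · rintro _ ⟨Q, hQ, rfl⟩
      have hQ' : ∀ i, MeasurableSet (Q i) := fun i => hQ i (Set.mem_univ i)
      rw [Measure.restrict_apply (MeasurableSet.univ_pi hQ'),
        Measure.restrict_apply (MeasurableSet.univ_pi hQ'), hrect j Q hQ']
    · rw [Measure.restrict_apply_univ, Measure.restrict_apply_univ, huniv]
  rw [hU] at hres
  -- Both measures live on injective tuples, which the rectangles cover: μ₁ by construction, μ₂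
  -- because Θ has no atoms.
  have h1 : ∀ᵐ t ∂μ₁, t ∈ {t : Fin k → Body n | Function.Injective t} := by
    rw [ae_iff]
    change μ₁ {t | Function.Injective t}ᶜ = 0
    rw [hμ₁, Measure.bind_apply hDm.compl hN.aemeasurable]
    refine (lintegral_congr fun ω => ?_).trans lintegral_zero
    rw [tupleMeasure_apply _ _ hDm.compl]
    convert measure_empty (μ := Measure.count)
    ext t
    simp only [Set.mem_inter_iff, Set.mem_compl_iff, distinctTuples, Set.mem_ofPred_eq,
      Set.mem_empty_iff_false]
    tauto
  have h2 : ∀ᵐ t ∂μ₂, t ∈ {t : Fin k → Body n | Function.Injective t} :=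
    ae_iff.2 (pi_not_injective_eq_zero (Θ.restrict F) k)
  rw [← Measure.restrict_eq_self_of_ae_mem h1, hres, Measure.restrict_eq_self_of_ae_mem h2]

/-- The kernel of factorial moment measures of the particles in `F`. -/
def IsPoissonProcess.tupleKernel (hX : IsPoissonProcess P X Θ) (hF : MeasurableSet F)
    (hXF : ∀ ω, (X ω ∩ F).Finite) (k : ℕ) : Kernel Ω (Fin k → Body n) :=
  ⟨fun ω => tupleMeasure k (X ω ∩ F), hX.measurable_tupleMeasure hF hXF k⟩

theorem IsPoissonProcess.integral_tupleMeasure [IsProbabilityMeasure P]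
    (hX : IsPoissonProcess P X Θ) (hF : MeasurableSet F) (hXF : ∀ ω, (X ω ∩ F).Finite)
    (hfin : Θ F ≠ ∞) [NullSingletonClass Θ] (k : ℕ)
    {T : Type*} [NormedAddCommGroup T] [NormedSpace ℝ T]
    {g : (Fin k → Body n) → T} (hg : Integrable g (Measure.pi fun _ : Fin k => Θ.restrict F)) :
    Integrable (fun ω => ∫ t, g t ∂(tupleMeasure k (X ω ∩ F))) P ∧
      Integrable (fun ω => ∫ t, ‖g t‖ ∂(tupleMeasure k (X ω ∩ F))) P ∧
      ∫ ω, ∫ t, g t ∂(tupleMeasure k (X ω ∩ F)) ∂P =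
        ∫ t, g t ∂(Measure.pi fun _ : Fin k => Θ.restrict F) := by
  have hcomp : (hX.tupleKernel hF hXF k ∘ₖ Kernel.const Unit P) () =
      Measure.pi fun _ : Fin k => Θ.restrict F := by
    rw [Kernel.comp_apply, Kernel.const_apply]
    exact hX.bind_tupleMeasure hF hXF hfin k
  rw [← hcomp] at hg ⊢
  have h1 := hg.integral_comp
  have h2 := hg.norm.integral_comp
  have h3 := Kernel.integral_comp hg
  rw [Kernel.const_apply] at h1 h2 h3
  exact ⟨h1, h2, h3.symm⟩

end Poisson


/-! ### The intensity measure of the particle process -/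

/-- If K + x = K + y, a point of K that is maximal in direction x - y would be moved further in that
direction unless x = y. -/
theorem translate_injective (K : Body n) : Function.Injective (translate K) := by
  intro x y h
  obtain ⟨k, hk, hmax⟩ := K.isCompact.exists_isMaxOn K.nonempty
    (f := fun z => inner ℝ (x - y) z) (by fun_prop)
  have h1 : k + x ∈ translate K y := h ▸ mem_translate.2 (by simpa using hk)
  have h2 : inner ℝ (x - y) (k + x - y) ≤ inner ℝ (x - y) k := hmax (mem_translate.1 h1)
  rw [add_sub_assoc, inner_add_right, add_le_iff_nonpos_right, real_inner_self_nonpos] at h2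
  exact sub_eq_zero.1 h2

theorem lintegral_particleIntensity (γ : ℝ) (Q : Measure (Body n)) [SFinite Q] {g : Body n → ℝ≥0∞}
    (hg : Measurable g) : ∫⁻ K, g K ∂(particleIntensity γ Q) =
      ENNReal.ofReal γ * ∫⁻ K, (∫⁻ x, g (translate K x)) ∂Q := by
  have hm := (continuous_translate (n := n)).measurable
  rw [particleIntensity, lintegral_smul_measure, smul_eq_mul, lintegral_map hg hm]
  congr 1
  exact lintegral_prod_symm' _ (hg.comp hm)

theorem integral_particleIntensity {γ : ℝ} (hγ : 0 ≤ γ) (Q : Measure (Body n)) [SFinite Q]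
    {T : Type*} [NormedAddCommGroup T] [NormedSpace ℝ T] {g : Body n → T}
    (hg : StronglyMeasurable g) (hint : Integrable g (particleIntensity γ Q)) :
    ∫ K, g K ∂(particleIntensity γ Q) = γ • ∫ K, (∫ x, g (translate K x)) ∂Q := by
  have hm := (continuous_translate (n := n)).measurable
  rcases hγ.eq_or_lt with rfl | hpos
  · simp [particleIntensity]
  rw [particleIntensity] at hint ⊢
  rw [integrable_smul_measure (by simpa using hpos) ENNReal.ofReal_ne_top,
    integrable_map_measure hg.aestronglyMeasurable hm.aemeasurable] at hint
  rw [integral_smul_measure, ENNReal.toReal_ofReal hγ,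
    integral_map hm.aemeasurable hg.aestronglyMeasurable]
  congr 1
  exact integral_prod_symm _ hint

/-- For each K at most one translate equals a given body, and single points are Lebesgue null
because n ≥ 1. -/
theorem nullSingletonClass_particleIntensity [NeZero n] (γ : ℝ) (Q : Measure (Body n)) [SFinite Q] :
    NullSingletonClass (particleIntensity γ Q) := by
  refine ⟨fun K₀ => ?_⟩
  have hs : MeasurableSet {K₀} := measurableSet_singleton K₀
  rw [← lintegral_indicator_one hs, lintegral_particleIntensity γ Q (measurable_one.indicator hs)]
  refine mul_eq_zero_of_right _ ((lintegral_congr fun K => ?_).trans lintegral_zero)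
  have hsub : (translate K ⁻¹' {K₀}).Subsingleton := fun x hx y hy =>
    translate_injective K (Eq.trans hx (Eq.symm hy))
  have h2 : (fun x => ({K₀} : Set (Body n)).indicator (1 : Body n → ℝ≥0∞) (translate K x)) =
      (translate K ⁻¹' {K₀}).indicator 1 := rfl
  have : Nontrivial (Space n) := inferInstance
  rw [h2, lintegral_indicator_one ((measurable_translate_right K) hs)]
  exact hsub.measure_zero _

/-- The convex bodies that hit the window `W`. -/
def hitting (W : Body n) : Set (Body n) := {K | ((K : Set (Space n)) ∩ W).Nonempty}

theorem measurableSet_hitting (W : Body n) : MeasurableSet (hitting W) :=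
  measurable_prodMk_right measurableSet_inter_nonempty

theorem volume_add_closedBall_le (K : Body n) {R : ℝ} (hR : 1 ≤ R) :
    volume ((K : Set (Space n)) + Metric.closedBall 0 R) ≤
      ENNReal.ofReal (R ^ n) * volume ((K : Set (Space n)) + Metric.closedBall 0 1) := by
  obtain ⟨k₀, hk₀⟩ := K.nonempty
  have hR0 : 0 < R := one_pos.trans_le hR
  have hsub : (K : Set (Space n)) + Metric.closedBall 0 R ⊆
      ((1 - R) • k₀) +ᵥ (R • ((K : Set (Space n)) + Metric.closedBall 0 1)) := by
    -- The point R⁻¹k + (1 - R⁻¹)k₀ lies in K by convexity; dilation by R and translation by (1 -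
    -- R)k₀ bring it back to k.
    rintro _ ⟨k, hk, b, hb, rfl⟩
    refine ⟨R • ((R⁻¹ • k + (1 - R⁻¹) • k₀) + R⁻¹ • b), ⟨_, ⟨R⁻¹ • k + (1 - R⁻¹) • k₀, ?_,
      R⁻¹ • b, ?_, rfl⟩, rfl⟩, ?_⟩
    · exact K.convex hk hk₀ (by positivity) (sub_nonneg.2 (inv_le_one_of_one_le₀ hR)) (by ring)
    · rw [mem_closedBall_zero_iff] at hb ⊢
      rw [norm_smul, Real.norm_eq_abs, abs_of_pos (inv_pos.2 hR0), inv_mul_le_iff₀ hR0]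
      simpa using hb
    · change (1 - R) • k₀ + R • ((R⁻¹ • k + (1 - R⁻¹) • k₀) + R⁻¹ • b) = k + b
      match_scalars <;> field_simp
      ring
  refine (measure_mono hsub).trans ?_
  rw [measure_vadd, Measure.addHaar_smul, finrank_euclideanSpace_fin, abs_of_pos (by positivity)]

/-- If K + x hits W, which lies in the ball of radius R, then -x ∈ K + RB; the volume of this set is
controlled by that of K + B. -/
theorem particleIntensity_hitting_ne_top (γ : ℝ) (Q : Measure (Body n)) [SFinite Q]
    (hint : ∫⁻ K, volume ((K : Set (Space n)) + Metric.closedBall 0 1) ∂Q < ⊤) (W : Body n) :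
    particleIntensity γ Q (hitting W) ≠ ∞ := by
  obtain ⟨R, hR⟩ := W.isCompact.isBounded.subset_closedBall 0
  have hs := measurableSet_hitting W
  rw [← lintegral_indicator_one hs, lintegral_particleIntensity γ Q (measurable_one.indicator hs)]
  refine ENNReal.mul_ne_top ENNReal.ofReal_ne_top (ne_top_of_le_ne_top (b := ENNReal.ofReal
    (max R 1 ^ n) * ∫⁻ K, volume ((K : Set (Space n)) + Metric.closedBall 0 1) ∂Q)
    (ENNReal.mul_ne_top ENNReal.ofReal_ne_top hint.ne) ?_)
  rw [← lintegral_const_mul' _ _ ENNReal.ofReal_ne_top]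
  refine lintegral_mono fun K => ?_
  have h2 : (fun x => (hitting W).indicator (1 : Body n → ℝ≥0∞) (translate K x)) =
      (translate K ⁻¹' hitting W).indicator 1 := rfl
  rw [h2, lintegral_indicator_one ((measurable_translate_right K) hs)]
  refine le_trans ?_ (volume_add_closedBall_le K (le_max_right R 1))
  rw [← Measure.measure_neg volume ((K : Set (Space n)) + _)]
  refine measure_mono ?_
  rintro x ⟨w, hw, hwW⟩
  refine Set.mem_neg.2 ⟨w - x, mem_translate.1 hw, -w, ?_, show w - x + -w = -x by abel⟩
  have := hR hwW
  rw [mem_closedBall_zero_iff] at this ⊢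
  rw [norm_neg]
  exact this.trans (le_max_left R 1)


/-! ### Iterated translative formulas -/

theorem norm_onBody_le {T : Type*} [NormedAddCommGroup T] {F : Body n → T} {W : Body n} {B : ℝ}
    (hB : 0 ≤ B) (hF : ∀ L : Body n, (L : Set (Space n)) ⊆ W → ‖F L‖ ≤ B) {A : Set (Space n)}
    (hA : A ⊆ W) : ‖onBody F A‖ ≤ B := by
  unfold onBody
  split_ifs with h
  · exact hF _ (by rwa [coe_bodyOf h.1 h.2.1 h.2.2])
  · simpa using hB

theorem isMeasurableFamily_inter_iInter {C : Set (Space n)} (hC : IsCompactConvex C) (k : ℕ) :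
    IsMeasurableFamily fun t : Fin k → Body n => C ∩ ⋂ i, (t i : Set (Space n)) := by
  have h : ∀ s : Finset (Fin k), IsMeasurableFamily fun t : Fin k → Body n =>
      C ∩ ⋂ i ∈ s, (t i : Set (Space n)) := by
    intro s
    induction s using Finset.induction_on with
    | empty => simpa using isMeasurableFamily_const (Y := Fin k → Body n) hC
    | insert i s _ ih =>
      have := ih.inter_body (measurable_pi_apply i)
      refine (congrArg IsMeasurableFamily (funext fun t => ?_)).mp this
      rw [Finset.set_biInter_insert, Set.inter_assoc, Set.inter_comm (t i : Set (Space n))]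
  simpa using h Finset.univ

theorem iInter_fin_cons {k : ℕ} (K : Body n) (t : Fin k → Body n) :
    ⋂ i, ((Fin.cons K t : Fin (k + 1) → Body n) i : Set (Space n)) =
      (K : Set (Space n)) ∩ ⋂ i, (t i : Set (Space n)) := by
  ext x
  simp only [Set.mem_iInter, Set.mem_inter_iff, Fin.forall_fin_succ, Fin.cons_zero, Fin.cons_succ]

section Iterated

variable {T : Type*} [NormedAddCommGroup T] {F : Body n → T} {W : Body n} {B : ℝ}
  {C : Set (Space n)}

theorem integrable_onBody_inter_iInter (hFm : StronglyMeasurable F) (hB : 0 ≤ B)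
    (hF : ∀ L : Body n, (L : Set (Space n)) ⊆ W → ‖F L‖ ≤ B) (hC : IsCompactConvex C)
    (hCW : C ⊆ W) (μ : Measure (Body n)) [IsFiniteMeasure μ] (k : ℕ) :
    Integrable (fun t : Fin k → Body n => onBody F (C ∩ ⋂ i, (t i : Set (Space n))))
      (Measure.pi fun _ => μ) :=
  Integrable.of_bound
    ((isMeasurableFamily_inter_iInter hC k).stronglyMeasurable_onBody hFm).aestronglyMeasurable B
    (Eventually.of_forall fun _ => norm_onBody_le hB hF (Set.inter_subset_left.trans hCW))

theorem integrable_onBody_inter (hFm : StronglyMeasurable F) (hB : 0 ≤ B)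
    (hF : ∀ L : Body n, (L : Set (Space n)) ⊆ W → ‖F L‖ ≤ B) (hC : IsCompactConvex C)
    (hCW : C ⊆ W) (μ : Measure (Body n)) [IsFiniteMeasure μ] :
    Integrable (fun K : Body n => onBody F (C ∩ K)) μ :=
  Integrable.of_bound (((isMeasurableFamily_const hC).inter_body
    measurable_id).stronglyMeasurable_onBody hFm).aestronglyMeasurable B
    (Eventually.of_forall fun _ => norm_onBody_le hB hF (Set.inter_subset_left.trans hCW))

theorem integral_onBody_inter_iInter_succ [NormedSpace ℝ T] (hFm : StronglyMeasurable F)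
    (hB : 0 ≤ B) (hF : ∀ L : Body n, (L : Set (Space n)) ⊆ W → ‖F L‖ ≤ B)
    (hC : IsCompactConvex C) (hCW : C ⊆ W) (μ : Measure (Body n)) [IsFiniteMeasure μ] (k : ℕ) :
    ∫ t : Fin (k + 1) → Body n, onBody F (C ∩ ⋂ i, (t i : Set (Space n))) ∂(Measure.pi fun _ => μ) =
      ∫ K : Body n, (∫ t : Fin k → Body n, onBody F (C ∩ K ∩ ⋂ i, (t i : Set (Space n)))
        ∂(Measure.pi fun _ => μ)) ∂μ := by
  have hmp := (measurePreserving_piFinSuccAbove (fun _ : Fin (k + 1) => μ) 0).symm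
  have hint := hmp.integrable_comp_of_integrable
    (integrable_onBody_inter_iInter hFm hB hF hC hCW μ (k + 1))
  rw [← hmp.integral_comp' (g := fun t : Fin (k + 1) → Body n =>
    onBody F (C ∩ ⋂ i, (t i : Set (Space n))))]
  refine (integral_prod _ hint).trans (integral_congr_ae (Eventually.of_forall fun K =>
    integral_congr_ae (Eventually.of_forall fun t => ?_)))
  simp only [Function.comp, MeasurableEquiv.piFinSuccAbove_symm_apply, Fin.insertNthEquiv_zero,
    Fin.consEquiv_apply]
  rw [iInter_fin_cons, Set.inter_assoc]

theorem onBody_vol {A : Set (Space n)} (hA : IsCompactConvex A) : onBody vol A = volume.real A := by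
  rcases hA.eq_empty_or_exists with rfl | ⟨K, rfl⟩
  · rw [onBody_empty, measureReal_empty]
  · rw [onBody_coe]; rfl

theorem vol_le_of_subset {L : Body n} (h : (L : Set (Space n)) ⊆ W) : ‖vol L‖ ≤ vol W := by
  rw [Real.norm_eq_abs, abs_of_nonneg (show 0 ≤ vol L from ENNReal.toReal_nonneg)]
  exact ENNReal.toReal_mono (volume_body_ne_top W) (measure_mono h)

/-- Intersecting with one more grain multiplies F by v and adds a multiple of D proportional to the
volume, while the volume is only multiplied by v. Hence D occurs linearly, once for each of the k
grains that may contribute it. -/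
theorem integral_onBody_inter_iInter [NormedSpace ℝ T] [CompleteSpace T]
    (hFm : StronglyMeasurable F) (hB : 0 ≤ B)
    (hF : ∀ L : Body n, (L : Set (Space n)) ⊆ W → ‖F L‖ ≤ B) (μ : Measure (Body n))
    [IsFiniteMeasure μ] {v : ℝ} {D : T}
    (h1 : ∀ C : Set (Space n), IsCompactConvex C → C ⊆ W →
      ∫ K : Body n, onBody F (C ∩ K) ∂μ = v • onBody F C + onBody vol C • D)
    (h2 : ∀ C : Set (Space n), IsCompactConvex C → C ⊆ W →
      ∫ K : Body n, onBody vol (C ∩ K) ∂μ = v * onBody vol C) (k : ℕ) (hC : IsCompactConvex C)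
    (hCW : C ⊆ W) :
    ∫ t : Fin k → Body n, onBody F (C ∩ ⋂ i, (t i : Set (Space n))) ∂(Measure.pi fun _ => μ) =
      v ^ k • onBody F C + (k * v ^ (k - 1) * onBody vol C) • D := by
  induction k generalizing C with
  | zero => simp [Measure.real]
  | succ k ih =>
    rw [integral_onBody_inter_iInter_succ hFm hB hF hC hCW μ k]
    have hstep : ∀ K : Body n, ∫ t : Fin k → Body n, onBody F (C ∩ K ∩ ⋂ i, (t i : Set (Space n)))
        ∂(Measure.pi fun _ => μ) =
        v ^ k • onBody F (C ∩ K) + (k * v ^ (k - 1) * onBody vol (C ∩ K)) • D := fun K =>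
      ih (hC.inter (isCompactConvex_body K)) (Set.inter_subset_left.trans hCW)
    have hi1 := integrable_onBody_inter hFm hB hF hC hCW μ
    have hi2 := integrable_onBody_inter (F := vol) measurable_vol.stronglyMeasurable
      ENNReal.toReal_nonneg (fun L => vol_le_of_subset) hC hCW μ
    simp only [hstep]
    rw [integral_add (hi1.fun_smul _) ((hi2.const_mul _).smul_const D), integral_smul,
      integral_smul_const, integral_const_mul, h1 C hC hCW, h2 C hC hCW, smul_add, smul_smul,
      smul_smul, add_assoc, ← add_smul, pow_succ]
    congr 2
    -- The case k = 0 is separate because the exponent k - 1 is truncated; its factor k vanishes.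
    rcases k with _ | k
    · simp
    · simp only [Nat.add_sub_cancel]
      push_cast
      ring

end Iterated

section Intensity

variable {γ : ℝ} {Q : Measure (Body n)} [IsProbabilityMeasure Q] {W : Body n}
  {T : Type*} [NormedAddCommGroup T]

theorem onBody_inter_of_notMem_hitting {F : Body n → T} {C : Set (Space n)} (hCW : C ⊆ W)
    {K : Body n} (hK : K ∉ hitting W) : onBody F (C ∩ K) = 0 := by
  have : C ∩ (K : Set (Space n)) = ∅ := by
    by_contra h
    obtain ⟨x, hx⟩ := Set.nonempty_iff_ne_empty.2 h
    exact hK ⟨x, hx.2, hCW hx.1⟩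
  rw [this, onBody_empty]

/-- Grains missing W contribute zero, so the finite restricted intensity may be replaced by the full
one, which is disintegrated into grains and translations. -/
theorem integral_restrict_hitting [NormedSpace ℝ T] (hγ : 0 ≤ γ) {F : Body n → T} {B : ℝ}
    (hFm : StronglyMeasurable F) (hB : 0 ≤ B)
    (hF : ∀ L : Body n, (L : Set (Space n)) ⊆ W → ‖F L‖ ≤ B)
    (hfin : particleIntensity γ Q (hitting W) ≠ ∞) {C : Set (Space n)} (hC : IsCompactConvex C)
    (hCW : C ⊆ W) :
    ∫ K in hitting W, onBody F (C ∩ K) ∂(particleIntensity γ Q) =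
      γ • ∫ K, (∫ x, onBody F (C ∩ translate K x)) ∂Q := by
  have : IsFiniteMeasure ((particleIntensity γ Q).restrict (hitting W)) :=
    ⟨by simpa using hfin.lt_top⟩
  have hzero : ∀ K ∉ hitting W, onBody F (C ∩ K) = 0 := fun K hK =>
    onBody_inter_of_notMem_hitting hCW hK
  have hi : Integrable (fun K : Body n => onBody F (C ∩ K)) (particleIntensity γ Q) := by
    refine (integrableOn_iff_integrable_of_support_subset fun K hK => ?_).1
      (integrable_onBody_inter hFm hB hF hC hCW ((particleIntensity γ Q).restrict (hitting W)))
    by_contra h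
    exact hK (hzero K h)
  rw [setIntegral_eq_integral_of_forall_compl_eq_zero hzero]
  exact integral_particleIntensity hγ Q (((isMeasurableFamily_const hC).inter_body
    measurable_id).stronglyMeasurable_onBody hFm) hi

theorem integral_vol_inter_translate (K M : Body n) :
    ∫ x, onBody vol ((K : Set (Space n)) ∩ translate M x) = vol M * vol K := by
  have hcc : ∀ x, IsCompactConvex ((K : Set (Space n)) ∩ translate M x) := fun x =>
    (isCompactConvex_body K).inter (isCompactConvex_body _)
  have hm : Measurable fun x => volume ((K : Set (Space n)) ∩ translate M x) := by
    have := (isMeasurableFamily_inter_translate K M).measurable_onBody measurable_volume_body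
    refine (congrArg Measurable (funext fun x => ?_)).mp this
    rcases (hcc x).eq_empty_or_exists with h | ⟨L, h⟩
    · rw [h, onBody_empty, measure_empty]
    · rw [h, onBody_coe]
  simp only [onBody_vol (hcc _), Measure.real]
  rw [integral_toReal hm.aemeasurable (Eventually.of_forall fun x =>
    (measure_mono Set.inter_subset_left).trans_lt (volume_body_ne_top K).lt_top),
    lintegral_volume_inter_translate, ENNReal.toReal_mul]
  rfl

theorem integral_vol_restrict_hitting (hγ : 0 ≤ γ)
    (hfin : particleIntensity γ Q (hitting W) ≠ ∞) {C : Set (Space n)} (hC : IsCompactConvex C)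
    (hCW : C ⊆ W) :
    ∫ K in hitting W, onBody vol (C ∩ K) ∂(particleIntensity γ Q) =
      volDensity γ Q * onBody vol C := by
  rw [integral_restrict_hitting hγ measurable_vol.stronglyMeasurable ENNReal.toReal_nonneg
    (fun L => vol_le_of_subset) hfin hC hCW]
  rcases hC.eq_empty_or_exists with rfl | ⟨L, rfl⟩
  · simp [onBody_empty]
  · simp only [integral_vol_inter_translate, onBody_coe, volDensity]
    rw [integral_mul_const, smul_eq_mul, mul_assoc]

theorem integral_surfaceIntegral_restrict_hitting [NeZero n] [NormedSpace ℝ T] [CompleteSpace T]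
    (hγ : 0 ≤ γ) {f : Sph n → T} (hf : Continuous f) {B : ℝ} (hB : 0 ≤ B)
    (hF : ∀ L : Body n, (L : Set (Space n)) ⊆ W → ‖surfaceIntegral f L‖ ≤ B)
    (hvol : Integrable vol Q) (hsurf : Integrable (surfaceIntegral f) Q)
    (hfin : particleIntensity γ Q (hitting W) ≠ ∞) {C : Set (Space n)} (hC : IsCompactConvex C)
    (hCW : C ⊆ W) :
    ∫ K in hitting W, onBody (surfaceIntegral f) (C ∩ K) ∂(particleIntensity γ Q) =
      volDensity γ Q • onBody (surfaceIntegral f) C +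
        onBody vol C • (γ • ∫ K, surfaceIntegral f K ∂Q) := by
  rw [integral_restrict_hitting hγ (stronglyMeasurable_surfaceIntegral hf) hB hF hfin hC hCW]
  rcases hC.eq_empty_or_exists with rfl | ⟨L, rfl⟩
  · simp [onBody_empty]
  · simp only [fun K => (integral_surfaceIntegral_inter_translate hf L K).2, onBody_coe]
    rw [integral_add (hvol.smul_const _) (hsurf.fun_smul _), integral_smul_const, integral_smul,
      smul_add, volDensity, smul_smul, smul_comm γ]

end Intensity


/-! ### Inclusion–exclusion for the union set -/

theorem ncard_distinctTuples {k : ℕ} {S : Finset (Body n)} (hS : S.card = k) :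
    (distinctTuples k (S : Set (Body n))).ncard = k.factorial := by
  have e : (Fin k ↪ (S : Set (Body n))) ≃ distinctTuples k (S : Set (Body n)) :=
    { toFun := fun f => ⟨fun i => f i, fun i j hij => f.injective (Subtype.ext hij),
        fun i => (f i).2⟩
      invFun := fun t => ⟨fun i => ⟨t.1 i, t.2.2 i⟩, fun i j hij =>
        t.2.1 (congrArg Subtype.val hij)⟩
      left_inv := fun f => rfl
      right_inv := fun t => rfl }
  rw [← Nat.card_coe_set_eq, ← Nat.card_congr e, Nat.card_eq_fintype_card,
    Fintype.card_embedding_eq]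
  simp [hS, Nat.descFactorial_self]

section InclusionExclusion

variable {T : Type*} [NormedAddCommGroup T] [NormedSpace ℝ T] [CompleteSpace T]

/-- The intersection ignores the order of the tuple, so each k-element subset is counted k! times.
-/
theorem integral_tupleMeasure_finset (F : Finset (Body n)) (k : ℕ) (G : Set (Space n) → T) :
    ∫ t, G (⋂ i, (t i : Set (Space n))) ∂(tupleMeasure k (F : Set (Body n))) =
      (k.factorial : ℝ) • ∑ S ∈ F.powersetCard k, G (⋂ K ∈ S, (K : Set (Space n))) := by
  classical
  have hfin := finite_distinctTuples k F.finite_toSet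
  set D := hfin.toFinset with hD
  have hDc : distinctTuples k (F : Set (Body n)) = (D : Set (Fin k → Body n)) :=
    hfin.coe_toFinset.symm
  have hmem : ∀ t, t ∈ D ↔ Function.Injective t ∧ ∀ i, t i ∈ F := fun t => hfin.mem_toFinset
  have hint : IntegrableOn (fun t : Fin k → Body n => G (⋂ i, (t i : Set (Space n))))
      (D : Set (Fin k → Body n)) Measure.count := by
    rw [← Set.biUnion_of_singleton (D : Set (Fin k → Body n))]
    exact integrableOn_finset_iUnion.2 fun t _ => integrableOn_singleton (hx := by simp)
  rw [tupleMeasure, hDc, setIntegral_finset D hint]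
  simp only [measureReal_def, Measure.count_singleton, ENNReal.toReal_one, one_smul]
  have hmaps : ∀ t ∈ D, Finset.univ.image t ∈ F.powersetCard k := by
    intro t ht
    rw [hmem] at ht
    rw [Finset.mem_powersetCard, Finset.card_image_of_injective _ ht.1, Finset.card_fin]
    exact ⟨Finset.image_subset_iff.2 fun i _ => ht.2 i, rfl⟩
  rw [← Finset.sum_fiberwise_of_maps_to hmaps, Finset.smul_sum]
  refine Finset.sum_congr rfl fun S hS => ?_
  rw [Finset.mem_powersetCard] at hS
  have hfib : ((D.filter fun t => Finset.univ.image t = S : Finset (Fin k → Body n)) :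
      Set (Fin k → Body n)) = distinctTuples k (S : Set (Body n)) := by
    ext t
    simp only [Finset.coe_filter, hmem, Set.mem_ofPred_eq, distinctTuples, Finset.mem_coe]
    constructor
    · rintro ⟨ht, rfl⟩
      exact ⟨ht.1, fun i => Finset.mem_image_of_mem t (Finset.mem_univ i)⟩
    · rintro ⟨h1, h2⟩
      refine ⟨⟨h1, fun i => hS.1 (h2 i)⟩, Finset.eq_of_subset_of_card_le
        (Finset.image_subset_iff.2 fun i _ => h2 i) ?_⟩
      rw [Finset.card_image_of_injective _ h1, Finset.card_fin, hS.2]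
  have hcard : (D.filter fun t => Finset.univ.image t = S).card = k.factorial := by
    rw [← ncard_distinctTuples hS.2, ← hfib, Set.ncard_coe_finset]
  rw [← hcard, Nat.cast_smul_eq_nsmul, ← Finset.sum_const]
  refine Finset.sum_congr rfl fun t ht => ?_
  rw [← (Finset.mem_filter.1 ht).2]
  congr 1
  simp

theorem inter_iUnion_eq_inter_hitting (A : Set (Body n)) (W : Body n) :
    (⋃ K ∈ A, (K : Set (Space n))) ∩ W =
      (W : Set (Space n)) ∩ ⋃ K ∈ A ∩ hitting W, (K : Set (Space n)) := by
  ext x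
  simp only [Set.mem_inter_iff, Set.mem_iUnion, exists_prop]
  constructor
  · rintro ⟨⟨K, hK, hx⟩, hW⟩
    exact ⟨hW, K, ⟨hK, x, hx, hW⟩, hx⟩
  · rintro ⟨hW, K, hK, hx⟩
    exact ⟨⟨K, hK.1, hx⟩, hW⟩

theorem isCompactConvex_inter_biInter (W : Body n) (S : Finset (Body n)) :
    IsCompactConvex ((W : Set (Space n)) ∩ ⋂ K ∈ S, (K : Set (Space n))) :=
  ⟨W.convex.inter (convex_iInter₂ fun K _ => K.convex),
    W.isCompact.inter_right (isClosed_biInter fun K _ => K.isClosed)⟩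

/-- Inclusion–exclusion regrouped by cardinality. Only finitely many grains hit W, so all but
finitely many terms vanish; the term k = 0 is φ(W), which explains the difference on the right. -/
theorem IsAdditiveExtension.hasSum_tupleMeasure {φ : Body n → T} {ψ : Set (Space n) → T}
    (h : IsAdditiveExtension φ ψ) {A : Set (Body n)} {W : Body n} (hA : (A ∩ hitting W).Finite) :
    HasSum (fun k : ℕ => ((-1 : ℝ) ^ k / k.factorial) •
      ∫ t, onBody φ ((W : Set (Space n)) ∩ ⋂ i, (t i : Set (Space n)))
        ∂(tupleMeasure k (A ∩ hitting W)))
      (φ W - ψ ((⋃ K ∈ A, (K : Set (Space n))) ∩ W)) := by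
  rw [inter_iUnion_eq_inter_hitting]
  obtain ⟨F, hF⟩ := hA.exists_finset_coe
  rw [← hF]
  have hIE := h.sum_powerset F W (isPolyconvex_body W)
  rw [h.extends_body, Finset.sum_powerset] at hIE
  have hterm : ∀ k : ℕ, ((-1 : ℝ) ^ k / k.factorial) •
      ∫ t, onBody φ ((W : Set (Space n)) ∩ ⋂ i, (t i : Set (Space n)))
        ∂(tupleMeasure k (F : Set (Body n))) = ∑ S ∈ F.powersetCard k,
        (-1 : ℤ) ^ S.card • ψ ((W : Set (Space n)) ∩ ⋂ K ∈ S, (K : Set (Space n))) := by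
    intro k
    rw [integral_tupleMeasure_finset F k fun B => onBody φ ((W : Set (Space n)) ∩ B), smul_smul,
      div_mul_cancel₀ _ (by positivity), Finset.smul_sum]
    refine Finset.sum_congr rfl fun S hS => ?_
    rw [h.eq_onBody (isCompactConvex_inter_biInter W S), (Finset.mem_powersetCard.1 hS).2,
      ← Int.cast_smul_eq_zsmul ℝ]
    push_cast
    rfl
  simp only [hterm]
  have hIE' : φ W - ψ ((W : Set (Space n)) ∩ ⋃ K ∈ (F : Set (Body n)), (K : Set (Space n))) =
      ∑ k ∈ Finset.range (F.card + 1), ∑ S ∈ F.powersetCard k,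
        (-1 : ℤ) ^ S.card • ψ ((W : Set (Space n)) ∩ ⋂ K ∈ S, (K : Set (Space n))) := hIE.symm
  rw [hIE']
  refine hasSum_sum_of_ne_finset_zero fun k hk => ?_
  rw [Finset.powersetCard_eq_empty.2 (by rw [Finset.mem_range] at hk; omega), Finset.sum_empty]

end InclusionExclusion

theorem integrable_of_hasSum {Ω : Type*} [MeasurableSpace Ω] {P : Measure Ω} {T : Type*}
    [NormedAddCommGroup T] {F : ℕ → Ω → T} {f : Ω → T} (hF : ∀ k, Integrable (F k) P)
    (hsum : Summable fun k => ∫ ω, ‖F k ω‖ ∂P) (hf : ∀ ω, HasSum (fun k => F k ω) (f ω)) :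
    Integrable f P := by
  refine ⟨aestronglyMeasurable_of_tendsto_ae atTop
    (f := fun (m : ℕ) ω => ∑ k ∈ Finset.range m, F k ω) (fun m => ?_)
    (Eventually.of_forall fun ω => (hf ω).tendsto_sum_nat), ?_⟩
  · exact (integrable_finsetSum _ fun k _ => hF k).aestronglyMeasurable
  · have hle : ∀ ω, ‖f ω‖ₑ ≤ ∑' k, ‖F k ω‖ₑ := by
      intro ω
      refine le_of_tendsto ((hf ω).tendsto_sum_nat.enorm) (Eventually.of_forall fun m => ?_)
      exact (enorm_sum_le _ _).trans (ENNReal.sum_le_tsum _)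
    refine (lintegral_mono hle).trans_lt ?_
    rw [lintegral_tsum fun k => (hF k).aestronglyMeasurable.enorm]
    have : ∀ k, ∫⁻ ω, ‖F k ω‖ₑ ∂P = ENNReal.ofReal (∫ ω, ‖F k ω‖ ∂P) := fun k =>
      (ofReal_integral_norm_eq_lintegral_enorm (hF k)).symm
    simp only [this]
    exact hsum.tsum_ofReal_lt_top

theorem hasSum_neg_pow_div_factorial (v : ℝ) :
    HasSum (fun k : ℕ => (-1 : ℝ) ^ k / k.factorial * v ^ k) (Real.exp (-v)) := by
  have := NormedSpace.expSeries_div_hasSum_exp (-v)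
  rw [← Real.exp_eq_exp_ℝ] at this
  refine this.congr_fun fun k => ?_
  rw [neg_pow v]
  ring

/-- The termwise derivative in v of the preceding exponential series. -/
theorem hasSum_neg_pow_div_factorial_deriv (v : ℝ) :
    HasSum (fun k : ℕ => (-1 : ℝ) ^ k / k.factorial * (k * v ^ (k - 1))) (-Real.exp (-v)) := by
  rw [← hasSum_nat_add_iff' 1]
  simp only [Finset.range_one, Finset.sum_singleton, Nat.cast_zero, zero_mul, mul_zero, sub_zero]
  refine (hasSum_neg_pow_div_factorial v).neg.congr_fun fun k => ?_
  rw [Nat.factorial_succ, Nat.add_sub_cancel]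
  push_cast
  field_simp
  ring


/-! ### Expectations for the Boolean model -/

section Expectation

variable {T : Type*} [NormedAddCommGroup T] [NormedSpace ℝ T]

theorem enorm_surfaceIntegral_le [NeZero n] {f : Sph n → T} {C : ℝ} (hC0 : 0 ≤ C)
    (hC : ∀ u, ‖f u‖ ≤ C) (K : Body n) :
    ‖surfaceIntegral f K‖ₑ ≤ ENNReal.ofReal C * ENNReal.ofReal (unitBallVolume 1)⁻¹ *
      volume ((K : Set (Space n)) + Metric.closedBall 0 1) := by
  rw [← ofReal_norm]
  refine (ENNReal.ofReal_le_ofReal (norm_surfaceIntegral_le hC K)).trans ?_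
  rw [ENNReal.ofReal_mul hC0, ofReal_measureReal, mul_assoc]
  gcongr
  exact areaMeasure_univ_le K

theorem exists_norm_surfaceIntegral_le [NeZero n] {f : Sph n → T} (hf : Continuous f) (W : Body n) :
    ∃ B, 0 ≤ B ∧ ∀ L : Body n, (L : Set (Space n)) ⊆ W → ‖surfaceIntegral f L‖ ≤ B := by
  obtain ⟨C, hC0, hC⟩ := exists_forall_norm_le hf
  set b := ENNReal.ofReal C * ENNReal.ofReal (unitBallVolume 1)⁻¹ *
    volume ((W : Set (Space n)) + Metric.closedBall 0 1) with hb
  have hbt : b ≠ ∞ := ENNReal.mul_ne_top (ENNReal.mul_ne_top ENNReal.ofReal_ne_top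
    ENNReal.ofReal_ne_top) (isCompact_add_closedBall W 1).measure_lt_top.ne
  refine ⟨b.toReal, ENNReal.toReal_nonneg, fun L hL => ?_⟩
  rw [← toReal_enorm]
  refine ENNReal.toReal_mono hbt ((enorm_surfaceIntegral_le hC0 hC L).trans ?_)
  rw [hb]
  gcongr

theorem integrable_surfaceIntegral [NeZero n] {f : Sph n → T} (hf : Continuous f)
    {Q : Measure (Body n)}
    (hint : ∫⁻ K, volume ((K : Set (Space n)) + Metric.closedBall 0 1) ∂Q < ⊤) :
    Integrable (surfaceIntegral f) Q := by
  obtain ⟨C, hC0, hC⟩ := exists_forall_norm_le hf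
  refine ⟨(stronglyMeasurable_surfaceIntegral hf).aestronglyMeasurable,
    (lintegral_mono fun K => enorm_surfaceIntegral_le hC0 hC K).trans_lt ?_⟩
  rw [lintegral_const_mul' _ _ (ENNReal.mul_ne_top ENNReal.ofReal_ne_top ENNReal.ofReal_ne_top)]
  exact ENNReal.mul_lt_top (ENNReal.mul_lt_top ENNReal.ofReal_lt_top ENNReal.ofReal_lt_top) hint

theorem integrable_vol {Q : Measure (Body n)}
    (hint : ∫⁻ K, volume ((K : Set (Space n)) + Metric.closedBall 0 1) ∂Q < ⊤) :
    Integrable vol Q := by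
  refine ⟨measurable_vol.aestronglyMeasurable, (lintegral_mono fun K => ?_).trans_lt hint⟩
  rw [Real.enorm_of_nonneg (show 0 ≤ vol K from ENNReal.toReal_nonneg)]
  refine ENNReal.ofReal_toReal_le.trans (measure_mono fun x hx => ?_)
  exact ⟨x, hx, 0, Metric.mem_closedBall_self zero_le_one, add_zero x⟩

theorem IsPoissonProcess.finite_inter_hitting {Ω : Type*} [MeasurableSpace Ω] {P : Measure Ω}
    {X : Ω → Set (Body n)} {Θ : Measure (Body n)} (hX : IsPoissonProcess P X Θ) (W : Body n)
    (ω : Ω) : (X ω ∩ hitting W).Finite :=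
  hX.locallyFinite ω W W.isCompact

theorem IsPoissonProcess.isPolyconvex_unionSet_inter {Ω : Type*} [MeasurableSpace Ω]
    {P : Measure Ω} {X : Ω → Set (Body n)} {Θ : Measure (Body n)} (hX : IsPoissonProcess P X Θ)
    (W : Body n) (ω : Ω) : IsPolyconvex (unionSet X ω ∩ W) := by
  rw [unionSet, inter_iUnion_eq_inter_hitting]
  exact (isPolyconvex_body W).inter (isPolyconvex_biUnion (hX.finite_inter_hitting W ω))

/-- The expectation of a surface functional of a Boolean model in the window `W`. -/
theorem IsPoissonProcess.integral_unionSet_inter [NeZero n] [CompleteSpace T] {γ : ℝ} (hγ : 0 ≤ γ)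
    {Q : Measure (Body n)} [IsProbabilityMeasure Q]
    (hint : ∫⁻ K, volume ((K : Set (Space n)) + Metric.closedBall 0 1) ∂Q < ⊤)
    {Ω : Type*} [MeasurableSpace Ω] {P : Measure Ω} [IsProbabilityMeasure P]
    {X : Ω → Set (Body n)} (hX : IsPoissonProcess P X (particleIntensity γ Q))
    {f : Sph n → T} (hf : Continuous f) {ψ : Set (Space n) → T}
    (hψ : IsAdditiveExtension (surfaceIntegral f) ψ) (W : Body n) :
    Integrable (fun ω => ψ (unionSet X ω ∩ W)) P ∧
      ∫ ω, ψ (unionSet X ω ∩ W) ∂P = (1 - Real.exp (-volDensity γ Q)) • surfaceIntegral f W +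
        vol W • (Real.exp (-volDensity γ Q) • γ • ∫ K, surfaceIntegral f K ∂Q) := by
  obtain ⟨B, hB, hF⟩ := exists_norm_surfaceIntegral_le hf W
  have hfin := particleIntensity_hitting_ne_top γ Q hint W
  have hatoms := nullSingletonClass_particleIntensity γ Q
  set Θ := particleIntensity γ Q with hΘ
  set v := volDensity γ Q
  set D := γ • ∫ K, surfaceIntegral f K ∂Q
  have hfinm : IsFiniteMeasure (Θ.restrict (hitting W)) := ⟨by simpa using hfin.lt_top⟩
  have hFm := stronglyMeasurable_surfaceIntegral hf
  set g : (k : ℕ) → (Fin k → Body n) → T := fun k t =>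
    onBody (surfaceIntegral f) ((W : Set (Space n)) ∩ ⋂ i, (t i : Set (Space n))) with hg
  have hgi : ∀ k, Integrable (g k) (Measure.pi fun _ => Θ.restrict (hitting W)) := fun k =>
    integrable_onBody_inter_iInter hFm hB hF (isCompactConvex_body W) subset_rfl _ k
  have hmom := fun k => hX.integral_tupleMeasure (measurableSet_hitting W)
    (hX.finite_inter_hitting W) hfin k (hgi k)
  have hnorm := fun k => (hX.integral_tupleMeasure (measurableSet_hitting W)
    (hX.finite_inter_hitting W) hfin k (hgi k).norm).2.2
  set I : ℕ → Ω → T := fun k ω => ((-1 : ℝ) ^ k / k.factorial) •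
    ∫ t, g k t ∂(tupleMeasure k (X ω ∩ hitting W)) with hI
  have hIint : ∀ k, Integrable (I k) P := fun k => (hmom k).1.smul _
  have hsum : ∀ ω, HasSum (fun k => I k ω) (surfaceIntegral f W - ψ (unionSet X ω ∩ W)) :=
    fun ω => hψ.hasSum_tupleMeasure (hX.finite_inter_hitting W ω)
  -- On subsets of W the functional is bounded by B, and the k-th factorial moment has total mass
  -- Θ(hitting W)^k. The factorial makes the series converge and justifies exchanging sum and
  -- expectation.
  have hbound : ∀ k, ∫ ω, ‖I k ω‖ ∂P ≤
      B * ((Θ.restrict (hitting W)).real Set.univ ^ k / k.factorial) := by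
    intro k
    have h1 : ∫ ω, ‖I k ω‖ ∂P ≤ ∫ ω, (k.factorial : ℝ)⁻¹ *
        ∫ t, ‖g k t‖ ∂(tupleMeasure k (X ω ∩ hitting W)) ∂P := by
      refine integral_mono (hIint k).norm ((hmom k).2.1.const_mul _) fun ω => ?_
      simp only [hI]
      rw [norm_smul, norm_div, norm_pow, norm_neg, norm_one, one_pow, one_div, Real.norm_natCast]
      gcongr
      exact norm_integral_le_integral_norm _
    refine h1.trans ?_
    rw [integral_const_mul, hnorm k]
    have h2 : ∫ t, ‖g k t‖ ∂(Measure.pi fun _ : Fin k => Θ.restrict (hitting W)) ≤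
        B * (Measure.pi fun _ : Fin k => Θ.restrict (hitting W)).real Set.univ := by
      refine (le_abs_self _).trans ?_
      rw [← Real.norm_eq_abs]
      refine norm_integral_le_of_norm_le_const (Eventually.of_forall fun t => ?_)
      rw [norm_norm]
      exact norm_onBody_le hB hF Set.inter_subset_left
    have h3 : (Measure.pi fun _ : Fin k => Θ.restrict (hitting W)).real Set.univ =
        (Θ.restrict (hitting W)).real Set.univ ^ k := by
      simp [Measure.real, Measure.pi_univ]
    rw [h3] at h2
    calc _ ≤ (k.factorial : ℝ)⁻¹ * (B * (Θ.restrict (hitting W)).real Set.univ ^ k) := by gcongr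
      _ = _ := by ring
  have hsummable : Summable fun k => ∫ ω, ‖I k ω‖ ∂P :=
    Summable.of_nonneg_of_le (fun k => integral_nonneg fun ω => norm_nonneg _) hbound
      ((Real.summable_pow_div_factorial _).mul_left B)
  have hdiff := integrable_of_hasSum hIint hsummable hsum
  have hψi : Integrable (fun ω => ψ (unionSet X ω ∩ W)) P := by
    refine ((integrable_const (surfaceIntegral f W)).sub hdiff).congr
      (Eventually.of_forall fun ω => ?_)
    simp
  refine ⟨hψi, ?_⟩
  have hE := hasSum_integral_of_summable_integral_norm hIint hsummable
  simp only [fun ω => (hsum ω).tsum_eq] at hE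
  rw [integral_sub (integrable_const _) hψi, integral_const, probReal_univ, one_smul] at hE
  have hterm : ∀ k : ℕ, ∫ ω, I k ω ∂P = ((-1 : ℝ) ^ k / k.factorial * v ^ k) • surfaceIntegral f W +
      ((-1 : ℝ) ^ k / k.factorial * (k * v ^ (k - 1))) • (vol W • D) := by
    intro k
    simp only [hI]
    have hJ := integral_onBody_inter_iInter hFm hB hF (Θ.restrict (hitting W))
      (fun C hC hCW => integral_surfaceIntegral_restrict_hitting hγ hf hB hF (integrable_vol hint)
        (integrable_surfaceIntegral hf hint) hfin hC hCW)
      (fun C hC hCW => integral_vol_restrict_hitting hγ hfin hC hCW) k (isCompactConvex_body W)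
      subset_rfl
    rw [onBody_coe, onBody_coe] at hJ
    rw [integral_smul, (hmom k).2.2, hJ]
    module
  simp only [hterm] at hE
  have hE' := ((hasSum_neg_pow_div_factorial v).smul_const (surfaceIntegral f W)).add
    ((hasSum_neg_pow_div_factorial_deriv v).smul_const (vol W • D))
  -- The series computes φ(W) - E ψ(Z ∩ W) = e^{-v} φ(W) - e^{-v} V_n(W) D, which is solved for the
  -- expectation.
  rw [← sub_sub_cancel (surfaceIntegral f W) (∫ ω, ψ (unionSet X ω ∩ W) ∂P), hE.unique hE']
  module

end Expectation


/-! ### Minkowski tensors and densities -/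

theorem continuous_tensorPow (s : ℕ) : Continuous (tensorPow s : Space n → _) := by
  have h : Continuous fun u : Space n => fun _ : Fin s => innerSL ℝ u := by fun_prop
  exact (ContinuousMultilinearMap.compContinuousLinearMapLRight
    (ContinuousMultilinearMap.mkPiAlgebra ℝ (Fin s) ℝ)).cont.comp h

theorem vol_smul (W : Body n) {ρ : ℝ} (hρ : 0 < ρ) : vol (ρ • W) = ρ ^ n * vol W := by
  rw [vol, ConvexBody.coe_smul, Measure.addHaar_smul, finrank_euclideanSpace_fin,
    abs_of_pos (by positivity), ENNReal.toReal_mul, ENNReal.toReal_ofReal (by positivity)]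
  rfl

theorem tendsto_surfaceIntegral_smul_div_vol [NeZero n] {T : Type*} [NormedAddCommGroup T]
    [NormedSpace ℝ T] {f : Sph n → T} (hf : Continuous f) (W : Body n) :
    Tendsto (fun ρ : ℝ => (vol (ρ • W))⁻¹ • surfaceIntegral f (ρ • W)) atTop (𝓝 0) := by
  obtain ⟨C, hC0, hC⟩ := exists_forall_norm_le hf
  have hκ := unitBallVolume_pos 1
  set b := (volume ((W : Set (Space n)) + Metric.closedBall 0 1)).toReal
  have hbt : volume ((W : Set (Space n)) + Metric.closedBall 0 1) ≠ ∞ :=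
    (isCompact_add_closedBall W 1).measure_lt_top.ne
  have hlim : Tendsto (fun ρ : ℝ => (vol W)⁻¹ * C * (unitBallVolume 1)⁻¹ * b * ρ⁻¹) atTop (𝓝 0) := by
    simpa using tendsto_inv_atTop_zero.const_mul ((vol W)⁻¹ * C * (unitBallVolume 1)⁻¹ * b)
  refine squeeze_zero_norm' ?_ hlim
  filter_upwards [eventually_gt_atTop 0] with ρ hρ
  have h0 : 0 ≤ vol W := ENNReal.toReal_nonneg
  have harea : (areaMeasure (ρ • W)).real Set.univ ≤ (ρ * unitBallVolume 1)⁻¹ * ρ ^ n * b := by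
    have := ENNReal.toReal_mono (ENNReal.mul_ne_top ENNReal.ofReal_ne_top hbt)
      (areaMeasure_smul_univ_le W hρ)
    rwa [ENNReal.toReal_mul, ENNReal.toReal_ofReal (by positivity)] at this
  rw [norm_smul, norm_inv, Real.norm_eq_abs, vol_smul W hρ, abs_of_nonneg (by positivity)]
  calc (ρ ^ n * vol W)⁻¹ * ‖surfaceIntegral f (ρ • W)‖
      ≤ (ρ ^ n * vol W)⁻¹ * (C * ((ρ * unitBallVolume 1)⁻¹ * ρ ^ n * b)) := by
        gcongr
        exact (norm_surfaceIntegral_le hC _).trans (by gcongr)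
    _ = _ := by
        rw [mul_inv, mul_inv]
        field_simp

/-- The normalizing constant is absorbed into f, so everything proved for surface integrals of
continuous vector-valued functions applies. -/
theorem minkowskiTensor_eq_surfaceIntegral [NeZero n] (h : n - 1 < n) (s : ℕ) :
    ∃ f : Sph n → ContinuousMultilinearMap ℝ (fun _ : Fin s => Space n) ℝ, Continuous f ∧
      minkowskiTensor ⟨n - 1, h⟩ s = surfaceIntegral f := by
  refine ⟨fun u => ((1 / (s.factorial : ℝ)) *
      (unitSphereArea (n - (n - 1)) / unitSphereArea (n - (n - 1) + s))) • tensorPow s (u : Space n),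
    ((continuous_tensorPow s).comp continuous_subtype_val).fun_const_smul _, ?_⟩
  ext1 K
  exact (integral_smul _ _).symm

theorem exists_isAdditiveExtension_eq {T : Type*} [AddCommGroup T] {φ : Body n → T}
    (h : ∃ ψ, IsAdditiveExtension φ ψ) : ∃ ψ, IsAdditiveExtension φ ψ ∧
      ∀ A, IsPolyconvex A → additiveExtension φ A = ψ A :=
  ⟨h.choose, h.choose_spec, fun _ hA => dif_pos ⟨hA, h⟩⟩

theorem hasTensorDensity_unionSet [NeZero n] (h : n - 1 < n) {γ : ℝ} (hγ : 0 ≤ γ)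
    {Q : Measure (Body n)} [IsProbabilityMeasure Q]
    (hint : ∫⁻ K, volume ((K : Set (Space n)) + Metric.closedBall 0 1) ∂Q < ⊤)
    {Ω : Type*} [MeasurableSpace Ω] {P : Measure Ω} [IsProbabilityMeasure P]
    {X : Ω → Set (Body n)} (hX : IsPoissonProcess P X (particleIntensity γ Q)) (s : ℕ) :
    HasTensorDensity P (unionSet X) ⟨n - 1, h⟩ s
      (Real.exp (-volDensity γ Q) • tensorDensity ⟨n - 1, h⟩ s γ Q) := by
  obtain ⟨f, hf, hφ⟩ := minkowskiTensor_eq_surfaceIntegral h s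
  obtain ⟨ψ, hψ, heq⟩ := exists_isAdditiveExtension_eq
    (exists_isAdditiveExtension_surfaceIntegral hf)
  intro W hW
  have hpoly := fun ρ : ℝ => hX.isPolyconvex_unionSet_inter (ρ • W)
  have hmean := fun ρ : ℝ => hX.integral_unionSet_inter hγ hint hf hψ (ρ • W)
  simp only [tensorDensity, hφ, fun ρ ω => heq _ (hpoly ρ ω), fun ρ => (hmean ρ).2]
  refine ⟨fun ρ _ => ⟨Eventually.of_forall (hpoly ρ), (hmean ρ).1⟩, ?_⟩
  have hlim := ((tendsto_surfaceIntegral_smul_div_vol hf W).const_smul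
    (1 - Real.exp (-volDensity γ Q))).add_const
    (Real.exp (-volDensity γ Q) • γ • ∫ K, surfaceIntegral f K ∂Q)
  rw [smul_zero, zero_add] at hlim
  refine hlim.congr' ?_
  filter_upwards [eventually_gt_atTop 0] with ρ hρ
  have hne : vol (ρ • W) ≠ 0 := by
    rw [vol_smul W hρ]
    positivity
  rw [smul_add, smul_smul _ (vol (ρ • W)), inv_mul_cancel₀ hne, one_smul, smul_comm]

end BooleanModel
end

theorem mainTheorem4 {n : ℕ} (hn : 1 ≤ n)
    (γ : ℝ) (hγ : 0 < γ)
    (Q : MeasureTheory.Measure (ConvexBody (EuclideanSpace ℝ (Fin n))))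
    [MeasureTheory.IsProbabilityMeasure Q]
    (hQ : ∀ᵐ K ∂Q, K ∈ BooleanModel.grainSpace n)
    (hint : ∫⁻ K, MeasureTheory.volume
      ((K : Set (EuclideanSpace ℝ (Fin n))) + Metric.closedBall 0 1) ∂Q < ⊤)
    {Ω : Type*} [MeasurableSpace Ω] (P : MeasureTheory.Measure Ω)
    [MeasureTheory.IsProbabilityMeasure P]
    (X : Ω → Set (ConvexBody (EuclideanSpace ℝ (Fin n))))
    (hX : BooleanModel.IsPoissonProcess P X (BooleanModel.particleIntensity γ Q))
    (s : ℕ) :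
    MeasureTheory.Integrable BooleanModel.vol Q ∧
    MeasureTheory.Integrable
      (BooleanModel.minkowskiTensor (⟨n - 1, Nat.sub_one_lt_of_lt hn⟩ : Fin n) s) Q ∧
    BooleanModel.HasTensorDensity P (BooleanModel.unionSet X)
      (⟨n - 1, Nat.sub_one_lt_of_lt hn⟩ : Fin n) s
      (Real.exp (-BooleanModel.volDensity γ Q) •
        BooleanModel.tensorDensity (⟨n - 1, Nat.sub_one_lt_of_lt hn⟩ : Fin n) s γ Q) := by
  have : NeZero n := ⟨by omega⟩
  refine ⟨BooleanModel.integrable_vol hint, ?_,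
    BooleanModel.hasTensorDensity_unionSet _ hγ.le hint hX s⟩
  obtain ⟨f, hf, hφ⟩ := BooleanModel.minkowskiTensor_eq_surfaceIntegral
    (Nat.sub_one_lt_of_lt hn) s
  rw [hφ]
  exact BooleanModel.integrable_surfaceIntegral hf hint
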